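/- Let $0<a<b$ and $c>1$, and for $\alpha>0$ let $L^2_\alpha$ be the space of complex-valued functions $g$ on $\mathbb R$ with $\|g\|_\alpha^2=\int_{\mathbb R}|e^{\alpha x}g(x)|^2\,dx<\infty$; $\|\cdot\|_\alpha$ also denotes the operator norm on $L^2_\alpha$. With $\hat g(\xi)=\int g(x)e^{-ix\xi}\,dx$, a Fourier multiplier with symbol $m$ acts in $L^2_\alpha$ by $\widehat{Tg}(\xi)=m(\xi)\hat g(\xi)$ on the line $\xi=k+i\alpha$, $k\in\mathbb R$ (on its maximal domain). Let $\partial$ have symbol $i\xi$, $B=I-b\partial^2$, let $\mathcal S$ have symbol $\hat{\mathcal S}(\xi)=\sqrt{(1+a\xi^2)/(1+b\xi^2)}$ (principal branch), and let $\mathcal Q_\pm=c\partial\pm\mathcal S\partial$. Put $$q(x)=\frac{c^2-1}{c}\,\mathrm{sech}^2\!\Big(\tfrac12\sqrt{\tfrac{c^2-1}{bc^2-a}}\;x\Big),\qquad r=-cq,$$ $$R_q=\tfrac12B^{-1}(q'+2q\partial),\qquad R_r=\tfrac12B^{-1}(r\partial+2r')\mathcal S^{-1},$$ $$W(\lambda)=I+(R_q+R_r)(\lambda-\mathcal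 Q_+)^{-1}+(R_q-R_r)(\lambda-\mathcal Q_-)^{-1}.$$ **Theorem 6.1 (Bundle convergence).** Fix $\hat\alpha\in(0,(b-a)^{-1/2})$ and let $\hat\beta=\hat\alpha\,(1-(b-a)\hat\alpha^2)$. For $\varepsilon>0$ put $c=1+\tfrac12\varepsilon^2$, let $I_\varepsilon:L^2_{\hat\alpha}\to L^2_{\varepsilon\hat\alpha}$ be $(I_\varepsilon g)(x)=\sqrt\varepsilon\,g(\varepsilon x)$, and let $W_\varepsilon(\Lambda)=I_\varepsilon^{-1}W(\tfrac12\varepsilon^3\Lambda)I_\varepsilon$, with $W$ acting in $L^2_{\varepsilon\hat\alpha}$. Let $\theta_0(x)=\mathrm{sech}^2\big(\tfrac12(b-a)^{-1/2}x\big)$ and $$W_0(\Lambda)f=f+3\,\partial\Big(\theta_0\,(\Lambda-\partial+(b-a)\partial^3)^{-1}f\Big).$$ Then $W_0(\Lambda)$, and for all sufficiently small $\varepsilon>0$ also $W_\varepsilon(\Lambda)$, is an everywhere defined bounded operator on $L^2_{\hat\alpha}$ for every $\Lambda\in\mathbb C$ with $\operatorname{Re}\Lambda\ge-\hat\beta/2$,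 and $$\sup_{\operatorname{Re}\Lambda\ge-\hat\beta/2}\|W_\varepsilon(\Lambda)-W_0(\Lambda)\|_{\hat\alpha}\to0\qquad\text{as }\varepsilon\to0^+ .$$ -/

import Mathlib

open MeasureTheory Set Filter Topology
open scoped ENNReal FourierTransform

namespace BenneyLuke

noncomputable section

/-! ## The weighted spaces `L²_α` -/

/-- The measure `e^{2αx} dx` on the real line. -/
def expMeasure (α : ℝ) : Measure ℝ :=
  volume.withDensity (fun x => ENNReal.ofReal (Real.exp (2 * α * x)))

/-- The complex Hilbert space `L²_α = {g | e^{αx} g ∈ L²(ℝ)}`, with norm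
`‖g‖² = ∫ |e^{αx} g(x)|² dx`. -/
abbrev L2w (α : ℝ) : Type := Lp ℂ 2 (expMeasure α)

theorem measurable_density (α : ℝ) :
    Measurable (fun x : ℝ => ENNReal.ofReal (Real.exp (2 * α * x))) := by fun_prop

theorem expMeasure_ac (α : ℝ) : expMeasure α ≪ volume :=
  withDensity_absolutelyContinuous _ _

theorem ac_expMeasure (α : ℝ) : volume ≪ expMeasure α :=
  withDensity_absolutelyContinuous' (measurable_density α).aemeasurable
    (ae_of_all _ fun x => by simp [Real.exp_pos])

theorem ae_expMeasure (α : ℝ) : ae (expMeasure α) = ae volume :=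
  le_antisymm (expMeasure_ac α).ae_le (ac_expMeasure α).ae_le

theorem aesm_expMeasure (α : ℝ) {g : ℝ → ℂ} :
    AEStronglyMeasurable g (expMeasure α) ↔ AEStronglyMeasurable g volume :=
  ⟨fun h => h.mono_ac (ac_expMeasure α), fun h => h.mono_ac (expMeasure_ac α)⟩

theorem eLpNorm_expWeight (α : ℝ) {g : ℝ → ℂ} (hg : AEStronglyMeasurable g volume) :
    eLpNorm (fun x => (Real.exp (α * x) : ℂ) * g x) 2 volume = eLpNorm g 2 (expMeasure α) := by
  rw [eLpNorm_eq_lintegral_rpow_enorm_toReal two_ne_zero ENNReal.ofNat_ne_top,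
    eLpNorm_eq_lintegral_rpow_enorm_toReal two_ne_zero ENNReal.ofNat_ne_top, expMeasure,
    lintegral_withDensity_eq_lintegral_mul₀ (measurable_density α).aemeasurable
      (by fun_prop)]
  congr 1
  refine lintegral_congr fun x => ?_
  have h : ‖(Real.exp (α * x) : ℂ)‖ₑ = ENNReal.ofReal (Real.exp (α * x)) := by
    rw [← ofReal_norm, Complex.norm_real, Real.norm_of_nonneg (Real.exp_pos _).le]
  simp only [Pi.mul_apply, enorm_mul, h, ENNReal.toReal_ofNat, ENNReal.rpow_ofNat, mul_pow]
  rw [← ENNReal.ofReal_pow (Real.exp_pos _).le, ← Real.exp_nat_mul]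
  congr 3
  push_cast
  ring

theorem memLp_expWeight_iff (α : ℝ) {g : ℝ → ℂ} :
    MemLp (fun x => (Real.exp (α * x) : ℂ) * g x) 2 volume ↔ MemLp g 2 (expMeasure α) := by
  have key : AEStronglyMeasurable (fun x => (Real.exp (α * x) : ℂ) * g x) volume ↔
      AEStronglyMeasurable g volume := by
    refine ⟨fun h => ?_, fun h => ?_⟩
    · have h2 : AEStronglyMeasurable (fun x : ℝ => (Real.exp (-(α * x)) : ℂ)) volume := by
        fun_prop
      refine (h2.mul h).congr (ae_of_all _ fun x => ?_)
      simp only [Pi.mul_apply]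
      rw [← mul_assoc, ← Complex.ofReal_mul, ← Real.exp_add]
      simp
    · have h2 : AEStronglyMeasurable (fun x : ℝ => (Real.exp (α * x) : ℂ)) volume := by
        fun_prop
      exact h2.mul h
  constructor
  · rintro ⟨h1, h2⟩
    have h3 := key.1 h1
    exact ⟨(aesm_expMeasure α).2 h3, by rwa [← eLpNorm_expWeight α h3]⟩
  · rintro ⟨h1, h2⟩
    have h3 := (aesm_expMeasure α).1 h1
    exact ⟨key.2 h3, by rwa [eLpNorm_expWeight α h3]⟩

/-- The unitary map `g ↦ e^{αx} g` from `L²_α` onto `L²(ℝ)`. -/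
def weight (α : ℝ) : L2w α ≃ₗ[ℂ] Lp ℂ 2 (volume : Measure ℝ) where
  toFun g := ((memLp_expWeight_iff α).2 (Lp.memLp g)).toLp
  map_add' f g := by
    ext1
    filter_upwards [MemLp.coeFn_toLp ((memLp_expWeight_iff α).2 (Lp.memLp (f + g))),
      MemLp.coeFn_toLp ((memLp_expWeight_iff α).2 (Lp.memLp f)),
      MemLp.coeFn_toLp ((memLp_expWeight_iff α).2 (Lp.memLp g)),
      Lp.coeFn_add ((memLp_expWeight_iff α).2 (Lp.memLp f)).toLp
        ((memLp_expWeight_iff α).2 (Lp.memLp g)).toLp,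
      (ac_expMeasure α).ae_le (Lp.coeFn_add f g)] with x h1 h2 h3 h4 h5
    rw [h1, h4, Pi.add_apply, h2, h3, h5, Pi.add_apply, mul_add]
  map_smul' c f := by
    ext1
    filter_upwards [MemLp.coeFn_toLp ((memLp_expWeight_iff α).2 (Lp.memLp (c • f))),
      MemLp.coeFn_toLp ((memLp_expWeight_iff α).2 (Lp.memLp f)),
      Lp.coeFn_smul c ((memLp_expWeight_iff α).2 (Lp.memLp f)).toLp,
      (ac_expMeasure α).ae_le (Lp.coeFn_smul c f)] with x h1 h2 h3 h4
    rw [h1, RingHom.id_apply, h3, Pi.smul_apply, h2, h4, Pi.smul_apply, smul_eq_mul,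
      smul_eq_mul, mul_left_comm]
  invFun g := MemLp.toLp (fun x => (Real.exp (-(α * x)) : ℂ) * g x)
    ((memLp_expWeight_iff α).1 ((Lp.memLp g).ae_eq (ae_of_all _ fun x => by
      beta_reduce
      rw [← mul_assoc, ← Complex.ofReal_mul, ← Real.exp_add]; simp)))
  left_inv f := by
    ext1
    refine (MemLp.coeFn_toLp _).trans ?_
    refine (expMeasure_ac α).ae_le ?_
    filter_upwards [MemLp.coeFn_toLp ((memLp_expWeight_iff α).2 (Lp.memLp f))] with x h1
    rw [h1, ← mul_assoc, ← Complex.ofReal_mul, ← Real.exp_add]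
    simp
  right_inv f := by
    ext1
    refine (MemLp.coeFn_toLp _).trans ?_
    have h := (MemLp.coeFn_toLp (μ := expMeasure α)
      (f := fun x => (Real.exp (-(α * x)) : ℂ) * f x) (p := 2)
      ((memLp_expWeight_iff α).1 ((Lp.memLp f).ae_eq (ae_of_all _ fun x => by
        beta_reduce
        rw [← mul_assoc, ← Complex.ofReal_mul, ← Real.exp_add]; simp))))
    filter_upwards [(ac_expMeasure α).ae_le h] with x h1
    rw [h1, ← mul_assoc, ← Complex.ofReal_mul, ← Real.exp_add]
    simp

theorem weight_coe (α : ℝ) (g : L2w α) :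
    weight α g =ᵐ[volume] fun x => (Real.exp (α * x) : ℂ) * g x :=
  MemLp.coeFn_toLp ((memLp_expWeight_iff α).2 (Lp.memLp g))

theorem memLp_comp_mul {ε : ℝ} (hε : ε ≠ 0) {g : ℝ → ℂ} (hg : MemLp g 2 volume) :
    MemLp (fun x => g (ε * x)) 2 volume := by
  have h : MemLp g 2 (Measure.map (fun x => ε * x) (volume : Measure ℝ)) := by
    rw [show (fun x : ℝ => ε * x) = (ε * ·) from rfl, Real.map_volume_mul_left hε]
    exact hg.smul_measure ENNReal.ofReal_ne_top
  exact (memLp_map_measure_iff h.1 (by fun_prop)).1 h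

theorem memLp_scaling (α : ℝ) {ε : ℝ} (hε : 0 < ε) (k : ℂ) {g : ℝ → ℂ}
    (hg : MemLp g 2 (expMeasure α)) :
    MemLp (fun x => k * g (ε * x)) 2 (expMeasure (ε * α)) := by
  rw [← memLp_expWeight_iff] at hg ⊢
  refine ((memLp_comp_mul hε.ne' hg).const_mul k).ae_eq (ae_of_all _ fun x => ?_)
  simp only [show ε * α * x = α * (ε * x) by ring]
  ring

theorem ae_comp_mul {ε : ℝ} (hε : ε ≠ 0) {α α' : ℝ} {p : ℝ → Prop}
    (h : ∀ᵐ x ∂(expMeasure α), p x) : ∀ᵐ x ∂(expMeasure α'), p (ε * x) := by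
  rw [ae_expMeasure] at h ⊢
  have hq : Measure.QuasiMeasurePreserving (fun x : ℝ => ε * x) volume volume := by
    refine ⟨by fun_prop, ?_⟩
    rw [show (fun x : ℝ => ε * x) = (ε * ·) from rfl, Real.map_volume_mul_left hε]
    exact Measure.smul_absolutelyContinuous
  exact hq.ae h

/-- The scaling operator `I_ε`, `(I_ε g)(x) = √ε g(εx)`, from `L²_α` onto `L²_{εα}`. -/
def scaling (α ε : ℝ) (hε : 0 < ε) : L2w α ≃ₗ[ℂ] L2w (ε * α) where
  toFun g := (memLp_scaling α hε (Real.sqrt ε : ℂ) (Lp.memLp g)).toLp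
  map_add' f g := by
    ext1
    filter_upwards [MemLp.coeFn_toLp (memLp_scaling α hε (Real.sqrt ε : ℂ) (Lp.memLp (f + g))),
      MemLp.coeFn_toLp (memLp_scaling α hε (Real.sqrt ε : ℂ) (Lp.memLp f)),
      MemLp.coeFn_toLp (memLp_scaling α hε (Real.sqrt ε : ℂ) (Lp.memLp g)),
      Lp.coeFn_add (memLp_scaling α hε (Real.sqrt ε : ℂ) (Lp.memLp f)).toLp
        (memLp_scaling α hε (Real.sqrt ε : ℂ) (Lp.memLp g)).toLp,
      ae_comp_mul hε.ne' (Lp.coeFn_add f g)] with x h1 h2 h3 h4 h5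
    rw [h1, h4, Pi.add_apply, h2, h3, h5, Pi.add_apply, mul_add]
  map_smul' c f := by
    ext1
    filter_upwards [MemLp.coeFn_toLp (memLp_scaling α hε (Real.sqrt ε : ℂ) (Lp.memLp (c • f))),
      MemLp.coeFn_toLp (memLp_scaling α hε (Real.sqrt ε : ℂ) (Lp.memLp f)),
      Lp.coeFn_smul c (memLp_scaling α hε (Real.sqrt ε : ℂ) (Lp.memLp f)).toLp,
      ae_comp_mul hε.ne' (Lp.coeFn_smul c f)] with x h1 h2 h3 h4
    rw [h1, RingHom.id_apply, h3, Pi.smul_apply, h2, h4, Pi.smul_apply, smul_eq_mul,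
      smul_eq_mul, mul_left_comm]
  invFun g := MemLp.toLp (fun x => ((Real.sqrt ε)⁻¹ : ℂ) * g (ε⁻¹ * x)) (by
    have h := memLp_scaling (ε * α) (inv_pos.2 hε) ((Real.sqrt ε)⁻¹ : ℂ) (Lp.memLp g)
    rwa [inv_mul_cancel_left₀ hε.ne'] at h)
  left_inv f := by
    ext1
    refine (MemLp.coeFn_toLp _).trans ?_
    filter_upwards [ae_comp_mul (α' := α) (inv_ne_zero hε.ne')
      (MemLp.coeFn_toLp (memLp_scaling α hε (Real.sqrt ε : ℂ) (Lp.memLp f)))] with x h1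
    have h0 : (Real.sqrt ε : ℂ) ≠ 0 := by exact_mod_cast (Real.sqrt_pos.2 hε).ne'
    rw [h1, mul_inv_cancel_left₀ hε.ne', inv_mul_cancel_left₀ h0]
  right_inv f := by
    ext1
    refine (MemLp.coeFn_toLp _).trans ?_
    have h := MemLp.coeFn_toLp (μ := expMeasure α) (p := 2)
      (f := fun x => ((Real.sqrt ε)⁻¹ : ℂ) * f (ε⁻¹ * x)) (by
        have h := memLp_scaling (ε * α) (inv_pos.2 hε) ((Real.sqrt ε)⁻¹ : ℂ) (Lp.memLp f)
        rwa [inv_mul_cancel_left₀ hε.ne'] at h)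
    filter_upwards [ae_comp_mul (α' := ε * α) hε.ne' h] with x h1
    have h0 : (Real.sqrt ε : ℂ) ≠ 0 := by exact_mod_cast (Real.sqrt_pos.2 hε).ne'
    rw [h1, inv_mul_cancel_left₀ hε.ne', mul_inv_cancel_left₀ h0]

theorem scaling_coe (α ε : ℝ) (hε : 0 < ε) (g : L2w α) :
    scaling α ε hε g =ᵐ[expMeasure (ε * α)] fun x => (Real.sqrt ε : ℂ) * g (ε * x) :=
  MemLp.coeFn_toLp (memLp_scaling α hε (Real.sqrt ε : ℂ) (Lp.memLp g))

/-! ## Operations on unbounded (partially defined) linear operators -/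

section Operators

variable {E F G : Type*} [AddCommGroup E] [Module ℂ E] [AddCommGroup F] [Module ℂ F]
  [AddCommGroup G] [Module ℂ G]

/-- The product `S T` of two unbounded operators, on its natural domain
`{x ∈ D(T) | T x ∈ D(S)}`. -/
def prodOp (S : F →ₗ.[ℂ] G) (T : E →ₗ.[ℂ] F) : E →ₗ.[ℂ] G where
  domain := (S.domain.comap T.toFun).map T.domain.subtype
  toFun :=
    { toFun := fun x => S ⟨T ⟨x, (by obtain ⟨y, -, hy⟩ := x.2; rw [← hy]; exact y.2)⟩,
        (by obtain ⟨x, y, hy, rfl⟩ := x; exact hy)⟩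
      map_add' := fun x y => by
        rw [← S.map_add]
        exact congrArg S (Subtype.ext (T.map_add ⟨x, _⟩ ⟨y, _⟩))
      map_smul' := fun c x => by
        rw [RingHom.id_apply, ← S.map_smul]
        exact congrArg S (Subtype.ext (T.map_smul c ⟨x, _⟩)) }

theorem mem_prodOp_domain {S : F →ₗ.[ℂ] G} {T : E →ₗ.[ℂ] F} {x : E} :
    x ∈ (prodOp S T).domain ↔ ∃ h : x ∈ T.domain, T ⟨x, h⟩ ∈ S.domain := by
  constructor
  · rintro ⟨y, hy, rfl⟩
    exact ⟨y.2, hy⟩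
  · rintro ⟨h, h'⟩
    exact ⟨⟨x, h⟩, h', rfl⟩

open Classical in
/-- The inverse `T⁻¹`, defined on the range of `T`, of an injective unbounded operator `T`.
(For an operator that is not injective the value is the operator with domain `{0}`.) -/
def inverseOp (T : E →ₗ.[ℂ] F) : F →ₗ.[ℂ] E :=
  if LinearMap.ker T.toFun = ⊥ then T.inverse else ⊥

/-- The operator `U⁻¹ T U` for a linear bijection `U`. -/
def conjOp (U : E ≃ₗ[ℂ] F) (T : F →ₗ.[ℂ] F) : E →ₗ.[ℂ] E :=
  prodOp (U.symm.toLinearMap.toPMap ⊤) (prodOp T (U.toLinearMap.toPMap ⊤))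

/-- The identity as an everywhere defined operator. -/
def idOp : E →ₗ.[ℂ] E := LinearMap.id.toPMap ⊤

end Operators

/-- The operator of multiplication by the function `m` in `L²(μ)`, on its maximal domain
`{f | m f ∈ L²(μ)}`. -/
def mulOp (μ : Measure ℝ) (m : ℝ → ℂ) : Lp ℂ 2 μ →ₗ.[ℂ] Lp ℂ 2 μ where
  domain :=
    { carrier := {f | MemLp (fun x => m x * f x) 2 μ}
      add_mem' := fun {f g} hf hg => (MemLp.add hf hg).ae_eq (by
        filter_upwards [Lp.coeFn_add f g] with x h
        rw [h, Pi.add_apply, Pi.add_apply, mul_add])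
      zero_mem' := (MemLp.zero' (ε := ℂ)).ae_eq (by
        filter_upwards [Lp.coeFn_zero ℂ 2 μ] with x h
        rw [h, Pi.zero_apply, mul_zero])
      smul_mem' := fun c f hf => (MemLp.const_mul hf c).ae_eq (by
        filter_upwards [Lp.coeFn_smul c f] with x h
        rw [h, Pi.smul_apply, smul_eq_mul, mul_left_comm]) }
  toFun :=
    { toFun := fun f => MemLp.toLp (fun x => m x * (f : Lp ℂ 2 μ) x) f.2
      map_add' := fun f g => by
        rw [← MemLp.toLp_add]
        refine MemLp.toLp_congr _ _ ?_
        filter_upwards [Lp.coeFn_add (f : Lp ℂ 2 μ) g] with x h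
        rw [Submodule.coe_add, h, Pi.add_apply, Pi.add_apply, mul_add]
      map_smul' := fun c f => by
        rw [RingHom.id_apply, ← MemLp.toLp_const_smul]
        refine MemLp.toLp_congr _ _ ?_
        filter_upwards [Lp.coeFn_smul c (f : Lp ℂ 2 μ)] with x h
        rw [Submodule.coe_smul, h, Pi.smul_apply, Pi.smul_apply, smul_eq_mul, smul_eq_mul,
          mul_left_comm] }

/-- The transform `g ↦ ĝ(2πv + iα) = ∫ g(x) e^{-i(2πv + iα)x} dx = 𝓕(e^{α·} g)(v)`, as a bijection
from `L²_α` onto `L²(dv)`; here `𝓕` is the `L²` Fourier transform in Mathlib's normalization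
`𝓕 f(v) = ∫ f(x) e^{-2πivx} dx`. -/
def lineFourier (α : ℝ) : L2w α ≃ₗ[ℂ] Lp ℂ 2 (volume : Measure ℝ) :=
  (weight α).trans (Lp.fourierTransformₗᵢ ℝ ℂ).toLinearEquiv

/-- The Fourier multiplier operator in `L²_α` with symbol `m`, that is
`(T g)^(k + iα) = m(k + iα) ĝ(k + iα)`, on its maximal domain. -/
def fourierMul (α : ℝ) (m : ℂ → ℂ) : L2w α →ₗ.[ℂ] L2w α :=
  conjOp (lineFourier α)
    (mulOp volume (fun v : ℝ => m (((2 * Real.pi * v : ℝ) : ℂ) + α * Complex.I)))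

/-- Multiplication by the real function `g` in `L²_α`. -/
def mulBy (α : ℝ) (g : ℝ → ℝ) : L2w α →ₗ.[ℂ] L2w α :=
  mulOp (expMeasure α) (fun x => (g x : ℂ))

/-- The derivative `∂` in `L²_α`, with symbol `iξ` and domain `H¹_α`. -/
def derivOp (α : ℝ) : L2w α →ₗ.[ℂ] L2w α := fourierMul α (fun ξ => Complex.I * ξ)

/-! ## The Benney-Luke bundle -/

/-- The component `q_c(x) = ((c² - 1)/c) sech²(α_c x / 2)` of the solitary wave, where
`α_c = √((c² - 1)/(b c² - a))`. -/
def qWave (a b c : ℝ) (x : ℝ) : ℝ :=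
  (c ^ 2 - 1) / c *
    (1 / Real.cosh (1 / 2 * Real.sqrt ((c ^ 2 - 1) / (b * c ^ 2 - a)) * x)) ^ 2

/-- The component `r_c = -c q_c` of the solitary wave. -/
def rWave (a b c : ℝ) (x : ℝ) : ℝ := -c * qWave a b c x

/-- The symbol `Ŝ(ξ) = √((1 + aξ²)/(1 + bξ²))` (principal branch) of `S = √(B⁻¹A)`. -/
def symS (a b : ℝ) (ξ : ℂ) : ℂ := Complex.sqrt ((1 + a * ξ ^ 2) / (1 + b * ξ ^ 2))

/-- The symbol `iξc + iξŜ(ξ)` of `Q₊ = c∂ + S∂`. -/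
def symQplus (a b c : ℝ) (ξ : ℂ) : ℂ := Complex.I * ξ * c + Complex.I * ξ * symS a b ξ

/-- The symbol `iξc - iξŜ(ξ)` of `Q₋ = c∂ - S∂`. -/
def symQminus (a b c : ℝ) (ξ : ℂ) : ℂ := Complex.I * ξ * c - Complex.I * ξ * symS a b ξ

/-- The inverse `B⁻¹` of `B = 1 - b∂²`, the multiplier with symbol `1 + bξ²`. -/
def Binv (b α : ℝ) : L2w α →ₗ.[ℂ] L2w α := inverseOp (fourierMul α (fun ξ => 1 + b * ξ ^ 2))

/-- The inverse `S⁻¹` of the multiplier `S`. -/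
def Sinv (a b α : ℝ) : L2w α →ₗ.[ℂ] L2w α := inverseOp (fourierMul α (symS a b))

/-- `R_q = ½ B⁻¹(q' + 2q∂)`. -/
def Rq (a b c α : ℝ) : L2w α →ₗ.[ℂ] L2w α :=
  (1 / 2 : ℂ) • prodOp (Binv b α)
    (mulBy α (deriv (qWave a b c)) + (2 : ℂ) • prodOp (mulBy α (qWave a b c)) (derivOp α))

/-- `R_r = ½ B⁻¹(r∂ + 2r')S⁻¹`. -/
def Rr (a b c α : ℝ) : L2w α →ₗ.[ℂ] L2w α :=
  (1 / 2 : ℂ) • prodOp (Binv b α) (prodOp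
    (prodOp (mulBy α (rWave a b c)) (derivOp α) + (2 : ℂ) • mulBy α (deriv (rWave a b c)))
    (Sinv a b α))

/-- `(λ - Q₊)⁻¹`. -/
def resQplus (a b c α : ℝ) (lam : ℂ) : L2w α →ₗ.[ℂ] L2w α :=
  inverseOp (fourierMul α (fun ξ => lam - symQplus a b c ξ))

/-- `(λ - Q₋)⁻¹`. -/
def resQminus (a b c α : ℝ) (lam : ℂ) : L2w α →ₗ.[ℂ] L2w α :=
  inverseOp (fourierMul α (fun ξ => lam - symQminus a b c ξ))

/-- The reduced resolvent bundle
`W(λ) = I + (R_q + R_r)(λ - Q₊)⁻¹ + (R_q - R_r)(λ - Q₋)⁻¹` in `L²_α`. -/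
def bundleW (a b c α : ℝ) (lam : ℂ) : L2w α →ₗ.[ℂ] L2w α :=
  idOp + prodOp (Rq a b c α + Rr a b c α) (resQplus a b c α lam)
    + prodOp (Rq a b c α - Rr a b c α) (resQminus a b c α lam)

/-- The rescaled bundle `W_ε(Λ) = I_ε⁻¹ W(ε³Λ/2) I_ε` in `L²_α`, for `c = 1 + ε²/2`; here `W` acts
in `L²_{εα}`. -/
def bundleWeps (a b α ε : ℝ) (hε : 0 < ε) (Lam : ℂ) : L2w α →ₗ.[ℂ] L2w α :=
  conjOp (scaling α ε hε) (bundleW a b (1 + ε ^ 2 / 2) (ε * α) ((ε : ℂ) ^ 3 / 2 * Lam))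

/-! ## The KdV bundle -/

/-- The KdV soliton profile `θ₀(x) = sech²(α₀ x / 2)`, `α₀ = (b - a)^{-1/2}`. -/
def theta0 (a b : ℝ) (x : ℝ) : ℝ :=
  (1 / Real.cosh (1 / 2 * (1 / Real.sqrt (b - a)) * x)) ^ 2

/-- `(Λ - ∂ + (b - a)∂³)⁻¹`. -/
def resKdV (a b α : ℝ) (Lam : ℂ) : L2w α →ₗ.[ℂ] L2w α :=
  inverseOp (fourierMul α
    (fun ξ => Lam - Complex.I * ξ + ((b - a : ℝ) : ℂ) * (Complex.I * ξ) ^ 3))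

/-- The KdV bundle `W₀(Λ) = I + (3∂θ₀)(Λ - ∂ + (b - a)∂³)⁻¹`, where `∂θ₀` is the composition of
multiplication by `θ₀` with `∂`. -/
def bundleW0 (a b α : ℝ) (Lam : ℂ) : L2w α →ₗ.[ℂ] L2w α :=
  idOp + prodOp ((3 : ℂ) • prodOp (derivOp α) (mulBy α (theta0 a b))) (resKdV a b α Lam)

/-- The unbounded operator `T` is everywhere defined and equal to the bounded operator `A`. -/
def IsBoundedRealization {α : ℝ} (A : L2w α →L[ℂ] L2w α) (T : L2w α →ₗ.[ℂ] L2w α) : Prop :=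
  T = A.toLinearMap.toPMap ⊤

end

end BenneyLuke

open BenneyLuke

/-! Conjugation with the weight `e^{αx}` and, for `W_ε`, with the dilation moves everything to
`L²(ℝ)`, where the operators are built from multiplications `mulL2` and Fourier multipliers `fmul`
whose symbols live on the line `Im ξ = α`. Write `N±` for the multipliers with symbols `1/(Λ - 2ε⁻³
Q±(εξ))`, `B` for the one with symbol `1/(1 + bε²ξ²)`, `σ` for the one with symbol `c/Ŝ(εξ)`, and
`θ` for the rescaled wave. All powers of `ε` cancel, and since `r = -cq`, `W_ε(Λ) = 1 + B(𝒬(N₊) -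
ℛ(σN₊)) + B(𝒬(N₋) + ℛ(σN₋))`, with `𝒬(N) = θ'N + 2θ∂N` and `ℛ(N) = θ∂N + 2θ'N` (`bundleOp`,
`maps_bundleWeps`).

Formally `B → 1`, `σ → 1`, `θ → θ₀`, `N₊ → 0`, and `N₋` tends to the KdV resolvent `N₀`. The limit
is `1 + (𝒬 + ℛ)(N₀) = 1 + 3(θ₀'N₀ + θ₀∂N₀) = 1 + 3∂(θ₀N₀)`, which is `W₀(Λ)`.

The symbol estimates come from an analysis of `Ŝ` in a thin strip. The real part of the denominator
of `N₋` is at least `β/4` plus a multiple of `(Re ξ)²/(1 + bε²(Re ξ)²)` (`re_denMinus_ge`). Hence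
the symbol `n` of `N₋` is `O((1 + ε²|ξ|²)/|ξ|²)`, the KdV symbol `n₀` is `O(|ξ|⁻²)`, and `n - n₀ =
O(ε²|ξ|)` (`areClose_resMinus`). The denominator of `N₊` is at least `α/ε²` (`areClose_resPlus`).
The lower bounds use only `Re Λ`, and `Λ` drops out of differences of denominators, so everything is
uniform in `Λ`.

The obstacle is `θ∂N₋`: the symbol `iξ n` is not bounded uniformly in `ε` and `Λ`, and the smoothing
factor `B` stands on the other side of `θ`. At frequencies above `1/ε` the product rule moves the
derivative across `θ`, `Bθ∂N = (∂B)θN - Bθ'N`. There `∂B = O(1/ε)` while the high-frequency part of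
`N` is `O(ε²)`, so these terms are `O(ε)`. At low frequencies `iξ n` is close to `iξ n₀` uniformly.
Finally `B` is removed from the limit operator because `(B - 1)∂⁻¹ = O(ε)` and `∂(θ₀N₀)` is bounded.
This is `norm_damped_deriv_sub_le`; summing the contributions gives `norm_bundleOp_sub_le`. -/

namespace BenneyLuke

noncomputable section

/-! ### Graph calculus for unbounded operators -/

section Graph

variable {E F G : Type*} [AddCommGroup E] [Module ℂ E] [AddCommGroup F] [Module ℂ F]
  [AddCommGroup G] [Module ℂ G]

/-- The point `x` lies in the domain of `T`, and `T x = y`. -/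
def Maps (T : E →ₗ.[ℂ] F) (x : E) (y : F) : Prop := ∃ h : x ∈ T.domain, T ⟨x, h⟩ = y

theorem Maps.add {S T : E →ₗ.[ℂ] F} {x : E} {y z : F} (hS : Maps S x y) (hT : Maps T x z) :
    Maps (S + T) x (y + z) := by
  obtain ⟨h, rfl⟩ := hS
  obtain ⟨h', rfl⟩ := hT
  exact ⟨⟨h, h'⟩, rfl⟩

theorem Maps.sub {S T : E →ₗ.[ℂ] F} {x : E} {y z : F} (hS : Maps S x y) (hT : Maps T x z) :
    Maps (S - T) x (y - z) := by
  obtain ⟨h, rfl⟩ := hS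
  obtain ⟨h', rfl⟩ := hT
  exact ⟨⟨h, h'⟩, rfl⟩

theorem Maps.smul {T : E →ₗ.[ℂ] F} {x : E} {y : F} (c : ℂ) (hT : Maps T x y) :
    Maps (c • T) x (c • y) := by
  obtain ⟨h, rfl⟩ := hT
  exact ⟨h, rfl⟩

theorem Maps.prodOp {S : F →ₗ.[ℂ] G} {T : E →ₗ.[ℂ] F} {x : E} {y : F} {z : G}
    (hS : Maps S y z) (hT : Maps T x y) : Maps (prodOp S T) x z := by
  obtain ⟨h, rfl⟩ := hT
  obtain ⟨h', rfl⟩ := hS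
  exact ⟨mem_prodOp_domain.2 ⟨h, h'⟩, rfl⟩

theorem Maps.toPMap (f : E →ₗ[ℂ] F) (x : E) : Maps (f.toPMap ⊤) x (f x) :=
  ⟨trivial, rfl⟩

theorem Maps.idOp (x : E) : Maps idOp x x := ⟨trivial, rfl⟩

theorem Maps.conjOp (U : E ≃ₗ[ℂ] F) {T : F →ₗ.[ℂ] F} {x y : E} (h : Maps T (U x) (U y)) :
    Maps (conjOp U T) x y := by
  have h1 := (Maps.toPMap U.symm.toLinearMap (U y)).prodOp
    (h.prodOp (Maps.toPMap U.toLinearMap x))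
  simpa [BenneyLuke.conjOp] using h1

theorem maps_of_conjOp (U : E ≃ₗ[ℂ] F) {T : F →ₗ.[ℂ] F} {x y : E}
    (h : Maps (BenneyLuke.conjOp U T) x y) : Maps T (U x) (U y) := by
  obtain ⟨h, rfl⟩ := h
  have h' := h
  rw [BenneyLuke.conjOp, mem_prodOp_domain] at h'
  obtain ⟨h1, -⟩ := h'
  rw [mem_prodOp_domain] at h1
  obtain ⟨_, h2⟩ := h1
  exact ⟨h2, (U.apply_symm_apply _).symm⟩

/-- The kernel hypothesis excludes the default branch of `inverseOp`, which has domain `{0}`. -/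
theorem Maps.inverseOp {T : E →ₗ.[ℂ] F} {x : E} {y : F} (hT : Maps T x y)
    (hker : ∀ z, Maps T z 0 → z = 0) : Maps (inverseOp T) y x := by
  have hk : LinearMap.ker T.toFun = ⊥ := by
    rw [LinearMap.ker_eq_bot']
    intro m hm
    exact Subtype.ext (hker m ⟨m.2, hm⟩)
  obtain ⟨h, rfl⟩ := hT
  rw [BenneyLuke.inverseOp, if_pos hk]
  have h1 := LinearPMap.mem_inverse_graph hk ⟨x, h⟩
  rw [LinearPMap.mem_graph_iff] at h1
  obtain ⟨z, hz1, hz2⟩ := h1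
  simp only at hz1 hz2
  refine ⟨hz1 ▸ z.2, ?_⟩
  exact (congrArg T.inverse (Subtype.ext hz1.symm)).trans hz2

/-- Computing `T` on each vector separately settles its domain as well, so this turns pointwise
`Maps` statements into `IsBoundedRealization`. -/
theorem eq_toPMap_of_maps {T : E →ₗ.[ℂ] F} {A : E →ₗ[ℂ] F} (h : ∀ x, Maps T x (A x)) :
    T = A.toPMap ⊤ := by
  have hd : T.domain = ⊤ := eq_top_iff.2 fun x _ => (h x).1
  refine LinearPMap.ext hd fun x hx hy => ?_
  exact (h x).2

end Graph

/-! ### Bounded multiplications on `L²(ℝ)` -/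

/-- The Hilbert space `L²(ℝ)` of complex-valued functions. -/
abbrev H2 : Type := Lp ℂ 2 (volume : Measure ℝ)

/-- A bounded Borel function on the line. -/
def IsBddSymbol (m : ℝ → ℂ) : Prop := Measurable m ∧ ∃ C, ∀ v, ‖m v‖ ≤ C

namespace IsBddSymbol

variable {m n : ℝ → ℂ}

theorem const (c : ℂ) : IsBddSymbol fun _ => c := ⟨measurable_const, ‖c‖, fun _ => le_rfl⟩

theorem add (hm : IsBddSymbol m) (hn : IsBddSymbol n) : IsBddSymbol fun v => m v + n v := by
  obtain ⟨h1, C, hC⟩ := hm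
  obtain ⟨h2, D, hD⟩ := hn
  exact ⟨h1.add h2, C + D, fun v => (norm_add_le _ _).trans (add_le_add (hC v) (hD v))⟩

theorem sub (hm : IsBddSymbol m) (hn : IsBddSymbol n) : IsBddSymbol fun v => m v - n v := by
  obtain ⟨h1, C, hC⟩ := hm
  obtain ⟨h2, D, hD⟩ := hn
  exact ⟨h1.sub h2, C + D, fun v => (norm_sub_le _ _).trans (add_le_add (hC v) (hD v))⟩

theorem mul (hm : IsBddSymbol m) (hn : IsBddSymbol n) : IsBddSymbol fun v => m v * n v := by
  obtain ⟨h1, C, hC⟩ := hm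
  obtain ⟨h2, D, hD⟩ := hn
  refine ⟨h1.mul h2, C * D, fun v => ?_⟩
  rw [norm_mul]
  exact mul_le_mul (hC v) (hD v) (norm_nonneg _) ((norm_nonneg _).trans (hC v))

theorem comp_mul (hm : IsBddSymbol m) (c : ℝ) : IsBddSymbol fun v => m (c * v) :=
  ⟨hm.1.comp (measurable_const_mul c), hm.2.imp fun _ h _ => h _⟩

theorem memLp (hm : IsBddSymbol m) (f : H2) : MemLp (fun x => m x * f x) 2 volume := by
  obtain ⟨h1, C, hC⟩ := hm
  refine (Lp.memLp f).of_le_mul (c := C) (h1.aestronglyMeasurable.mul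
    (Lp.aestronglyMeasurable f)) (ae_of_all _ fun x => ?_)
  rw [norm_mul]
  exact mul_le_mul_of_nonneg_right (hC x) (norm_nonneg _)

end IsBddSymbol

open Classical in
/-- Multiplication by the bounded Borel function `m`, as a bounded operator on `L²(ℝ)`; the zero
operator if `m` is not of this kind. -/
def mulL2 (m : ℝ → ℂ) : H2 →L[ℂ] H2 :=
  if hm : IsBddSymbol m then
    LinearMap.mkContinuousOfExistsBound
      { toFun := fun f => (hm.memLp f).toLp
        map_add' := fun f g => by
          rw [← MemLp.toLp_add]
          refine MemLp.toLp_congr _ _ ?_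
          filter_upwards [Lp.coeFn_add f g] with x h
          rw [h, Pi.add_apply, Pi.add_apply, mul_add]
        map_smul' := fun c f => by
          rw [RingHom.id_apply, ← MemLp.toLp_const_smul]
          refine MemLp.toLp_congr _ _ ?_
          filter_upwards [Lp.coeFn_smul c f] with x h
          rw [h, Pi.smul_apply, Pi.smul_apply, smul_eq_mul, smul_eq_mul, mul_left_comm] } (by
      obtain ⟨C, hC⟩ := hm.2
      refine ⟨C, fun f => Lp.norm_le_mul_norm_of_ae_le_mul ?_⟩
      filter_upwards [MemLp.coeFn_toLp (hm.memLp f)] with x h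
      simp only [LinearMap.coe_mk, AddHom.coe_mk]
      rw [h, norm_mul]
      exact mul_le_mul_of_nonneg_right (hC x) (norm_nonneg _))
  else 0

section MulL2

variable {m n : ℝ → ℂ}

theorem mulL2_coe (hm : IsBddSymbol m) (f : H2) : mulL2 m f =ᵐ[volume] fun x => m x * f x := by
  rw [mulL2, dif_pos hm]
  exact MemLp.coeFn_toLp (hm.memLp f)

/-- No measurability is needed: outside the class of bounded Borel symbols `mulL2` is zero by
definition. -/
theorem norm_mulL2_le {C : ℝ} (hC : ∀ v, ‖m v‖ ≤ C) : ‖mulL2 m‖ ≤ C := by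
  have hC0 : 0 ≤ C := (norm_nonneg _).trans (hC 0)
  by_cases hm : IsBddSymbol m
  · refine ContinuousLinearMap.opNorm_le_bound _ hC0 fun f =>
      Lp.norm_le_mul_norm_of_ae_le_mul ?_
    filter_upwards [mulL2_coe hm f] with x h
    rw [h, norm_mul]
    exact mul_le_mul_of_nonneg_right (hC x) (norm_nonneg _)
  · rw [mulL2, dif_neg hm, norm_zero]
    exact hC0

theorem mulL2_eq_of_ae (hm : IsBddSymbol m) {f g : H2}
    (h : g =ᵐ[volume] fun x => m x * f x) : mulL2 m f = g :=
  Lp.ext ((mulL2_coe hm f).trans h.symm)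

theorem mulL2_mul (hm : IsBddSymbol m) (hn : IsBddSymbol n) :
    mulL2 (fun v => m v * n v) = mulL2 m * mulL2 n := by
  ext1 f
  refine mulL2_eq_of_ae (hm.mul hn) ?_
  filter_upwards [mulL2_coe hm (mulL2 n f), mulL2_coe hn f] with x h1 h2
  rw [_root_.mul_apply_eq_comp, h1, h2, mul_assoc]

theorem mulL2_add (hm : IsBddSymbol m) (hn : IsBddSymbol n) :
    mulL2 (fun v => m v + n v) = mulL2 m + mulL2 n := by
  ext1 f
  refine mulL2_eq_of_ae (hm.add hn) ?_
  filter_upwards [Lp.coeFn_add (mulL2 m f) (mulL2 n f), mulL2_coe hm f, mulL2_coe hn f]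
    with x h h1 h2
  rw [_root_.add_apply, h, Pi.add_apply, h1, h2, add_mul]

theorem mulL2_sub (hm : IsBddSymbol m) (hn : IsBddSymbol n) :
    mulL2 (fun v => m v - n v) = mulL2 m - mulL2 n := by
  ext1 f
  refine mulL2_eq_of_ae (hm.sub hn) ?_
  filter_upwards [Lp.coeFn_sub (mulL2 m f) (mulL2 n f), mulL2_coe hm f, mulL2_coe hn f]
    with x h h1 h2
  rw [_root_.sub_apply, h, Pi.sub_apply, h1, h2, sub_mul]

theorem mulL2_const_mul (c : ℂ) (hm : IsBddSymbol m) :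
    mulL2 (fun v => c * m v) = c • mulL2 m := by
  ext1 f
  refine mulL2_eq_of_ae ((IsBddSymbol.const c).mul hm) ?_
  filter_upwards [Lp.coeFn_smul c (mulL2 m f), mulL2_coe hm f] with x h h1
  rw [_root_.smul_apply, h, Pi.smul_apply, h1, smul_eq_mul, mul_assoc]

theorem mulL2_one : mulL2 (fun _ => 1) = 1 := by
  ext1 f
  refine mulL2_eq_of_ae (IsBddSymbol.const 1) (ae_of_all _ fun x => ?_)
  simp

end MulL2

/-! ### Bounded Fourier multipliers on `L²(ℝ)` -/

/-- The `L²` Fourier transform as an isometry. -/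
abbrev fourierL2 : H2 ≃ₗᵢ[ℂ] H2 := Lp.fourierTransformₗᵢ ℝ ℂ

/-- The bounded Fourier multiplier `𝓕⁻¹ m 𝓕` on `L²(ℝ)`, in the frequency variable of Mathlib. -/
def fmul (m : ℝ → ℂ) : H2 →L[ℂ] H2 :=
  (fourierL2.symm.toContinuousLinearEquiv : H2 →L[ℂ] H2) ∘L mulL2 m ∘L
    (fourierL2.toContinuousLinearEquiv : H2 →L[ℂ] H2)

section Fmul

variable {m n : ℝ → ℂ}

theorem fmul_apply (m : ℝ → ℂ) (f : H2) :
    fmul m f = fourierL2.symm (mulL2 m (fourierL2 f)) := rfl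

theorem fourierL2_fmul (m : ℝ → ℂ) (f : H2) : fourierL2 (fmul m f) = mulL2 m (fourierL2 f) := by
  rw [fmul_apply, LinearIsometryEquiv.apply_symm_apply]

theorem norm_fmul_le {C : ℝ} (hC : ∀ v, ‖m v‖ ≤ C) : ‖fmul m‖ ≤ C := by
  refine ContinuousLinearMap.opNorm_le_bound _ ((norm_nonneg _).trans (hC 0)) fun f => ?_
  rw [fmul_apply, LinearIsometryEquiv.norm_map]
  exact ((mulL2 m).le_of_opNorm_le (norm_mulL2_le hC) _).trans_eq
    (by rw [LinearIsometryEquiv.norm_map])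

theorem fmul_mul (hm : IsBddSymbol m) (hn : IsBddSymbol n) :
    fmul (fun v => m v * n v) = fmul m * fmul n := by
  ext1 f
  apply fourierL2.injective
  rw [_root_.mul_apply_eq_comp, fourierL2_fmul, fourierL2_fmul, fourierL2_fmul,
    mulL2_mul hm hn]
  rfl

theorem fmul_add (hm : IsBddSymbol m) (hn : IsBddSymbol n) :
    fmul (fun v => m v + n v) = fmul m + fmul n := by
  ext1 f
  apply fourierL2.injective
  rw [_root_.add_apply, map_add, fourierL2_fmul, fourierL2_fmul, fourierL2_fmul,
    mulL2_add hm hn]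
  rfl

theorem fmul_sub (hm : IsBddSymbol m) (hn : IsBddSymbol n) :
    fmul (fun v => m v - n v) = fmul m - fmul n := by
  ext1 f
  apply fourierL2.injective
  rw [_root_.sub_apply, map_sub, fourierL2_fmul, fourierL2_fmul, fourierL2_fmul,
    mulL2_sub hm hn]
  rfl

theorem fmul_const_mul (c : ℂ) (hm : IsBddSymbol m) :
    fmul (fun v => c * m v) = c • fmul m := by
  ext1 f
  apply fourierL2.injective
  rw [_root_.smul_apply, map_smul, fourierL2_fmul, fourierL2_fmul,
    mulL2_const_mul c hm]
  rfl

theorem fmul_one : fmul (fun _ => 1) = 1 := by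
  ext1 f
  apply fourierL2.injective
  rw [fourierL2_fmul, mulL2_one]
  rfl

end Fmul

/-! ### Translation between the weighted spaces and `L²(ℝ)` -/

/-- The point `2πv + iα` of the line `Im ξ = α`. -/
def lineVar (α v : ℝ) : ℂ := ((2 * Real.pi * v : ℝ) : ℂ) + α * Complex.I

theorem lineVar_im (α v : ℝ) : (lineVar α v).im = α := by simp [lineVar]

theorem measurable_lineVar (α : ℝ) : Measurable (lineVar α) := by
  unfold lineVar
  fun_prop

theorem lineVar_mul (α ε v : ℝ) : lineVar (ε * α) (ε * v) = ε * lineVar α v := by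
  simp only [lineVar]
  push_cast
  ring

theorem maps_mulOp {μ : Measure ℝ} {m : ℝ → ℂ} {f g : Lp ℂ 2 μ}
    (h : g =ᵐ[μ] fun x => m x * f x) : Maps (mulOp μ m) f g := by
  have hf : MemLp (fun x => m x * f x) 2 μ := (Lp.memLp g).ae_eq h
  exact ⟨hf, Lp.ext ((MemLp.coeFn_toLp hf).trans h.symm)⟩

theorem ae_of_maps_mulOp {μ : Measure ℝ} {m : ℝ → ℂ} {f g : Lp ℂ 2 μ}
    (h : Maps (mulOp μ m) f g) : g =ᵐ[μ] fun x => m x * f x := by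
  obtain ⟨hf, rfl⟩ := h
  exact MemLp.coeFn_toLp hf

section Rules

variable {α : ℝ}

theorem lineFourier_weight_symm (h : H2) :
    lineFourier α ((weight α).symm h) = fourierL2 h := by
  simp [lineFourier]

theorem maps_fourierMul {m : ℂ → ℂ} {h k : H2}
    (hk : fourierL2 k =ᵐ[volume] fun v => m (lineVar α v) * fourierL2 h v) :
    Maps (fourierMul α m) ((weight α).symm h) ((weight α).symm k) := by
  refine Maps.conjOp _ ?_
  rw [lineFourier_weight_symm, lineFourier_weight_symm]
  exact maps_mulOp hk

/-- Domain questions reduce to boundedness of symbols: the range of the multiplier `n` lies in the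
domain of the possibly unbounded multiplier `m` as soon as `m n` is bounded. -/
theorem maps_fourierMul_fmul {m : ℂ → ℂ} {n n' : ℝ → ℂ} (hn : IsBddSymbol n)
    (hn' : IsBddSymbol n') (h : ∀ v, n' v = m (lineVar α v) * n v) (f : H2) :
    Maps (fourierMul α m) ((weight α).symm (fmul n f)) ((weight α).symm (fmul n' f)) := by
  refine maps_fourierMul ?_
  rw [fourierL2_fmul, fourierL2_fmul]
  filter_upwards [mulL2_coe hn (fourierL2 f), mulL2_coe hn' (fourierL2 f)] with v h1 h2
  rw [h1, h2, h, mul_assoc]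

theorem eq_zero_of_maps_fourierMul {m : ℂ → ℂ} (hm : ∀ v, m (lineVar α v) ≠ 0) (z : L2w α)
    (hz : Maps (fourierMul α m) z 0) : z = 0 := by
  have h := ae_of_maps_mulOp (maps_of_conjOp _ hz)
  rw [map_zero] at h
  apply (lineFourier α).injective
  rw [map_zero]
  refine Lp.ext ?_
  filter_upwards [h, Lp.coeFn_zero ℂ 2 (volume : Measure ℝ)] with v h1 h2
  rw [h2] at h1 ⊢
  exact (mul_eq_zero.1 h1.symm).resolve_left (hm v)

/-- The relation `m n = 1` makes `m` nonvanishing on the line, which gives injectivity, and exhibits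
`fmul n f` as the preimage of `f`. -/
theorem maps_inverseOp_fourierMul {m : ℂ → ℂ} {n : ℝ → ℂ} (hn : IsBddSymbol n)
    (h : ∀ v, m (lineVar α v) * n v = 1) (f : H2) :
    Maps (inverseOp (fourierMul α m)) ((weight α).symm f) ((weight α).symm (fmul n f)) := by
  refine Maps.inverseOp ?_ (eq_zero_of_maps_fourierMul fun v => left_ne_zero_of_mul_eq_one (h v))
  have h1 := maps_fourierMul_fmul (α := α) hn (IsBddSymbol.const 1) (fun v => (h v).symm) f
  rwa [fmul_one] at h1

theorem maps_mulBy {g : ℝ → ℝ} (hg : IsBddSymbol fun x => (g x : ℂ)) (f : H2) :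
    Maps (mulBy α g) ((weight α).symm f) ((weight α).symm (mulL2 (fun x => (g x : ℂ)) f)) := by
  refine maps_mulOp ((expMeasure_ac α).ae_le ?_)
  have h1 := weight_coe α ((weight α).symm f)
  have h2 := weight_coe α ((weight α).symm (mulL2 (fun x => (g x : ℂ)) f))
  rw [LinearEquiv.apply_symm_apply] at h1 h2
  filter_upwards [h1, h2, mulL2_coe hg f] with x h1 h2 h3
  have h0 : (Real.exp (α * x) : ℂ) ≠ 0 := by exact_mod_cast (Real.exp_pos _).ne'
  apply mul_left_cancel₀ h0
  rw [← h2, h3, h1]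
  ring

theorem norm_weight (g : L2w α) : ‖weight α g‖ = ‖g‖ := by
  rw [Lp.norm_def, Lp.norm_def, eLpNorm_congr_ae (weight_coe α g),
    eLpNorm_expWeight α ((aesm_expMeasure α).1 (Lp.aestronglyMeasurable g))]

variable (α) in
/-- The isometry `g ↦ e^{αx} g` from `L²_α` onto `L²(ℝ)`. -/
def weightIso : L2w α ≃ₗᵢ[ℂ] H2 := ⟨weight α, norm_weight⟩

variable (α) in
/-- The operator on `L²_α` that corresponds to the operator `V` on `L²(ℝ)`. -/
def weightConj (V : H2 →L[ℂ] H2) : L2w α →L[ℂ] L2w α :=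
  ((weightIso α).symm.toContinuousLinearEquiv : H2 →L[ℂ] L2w α) ∘L V ∘L
    ((weightIso α).toContinuousLinearEquiv : L2w α →L[ℂ] H2)

theorem weightConj_apply (V : H2 →L[ℂ] H2) (f : L2w α) :
    weightConj α V f = (weight α).symm (V (weight α f)) := rfl

theorem weightConj_sub (V W : H2 →L[ℂ] H2) :
    weightConj α (V - W) = weightConj α V - weightConj α W := by
  ext1 f
  rw [_root_.sub_apply, weightConj_apply, weightConj_apply, weightConj_apply, _root_.sub_apply,
    map_sub]

theorem norm_weightConj_le (V : H2 →L[ℂ] H2) : ‖weightConj α V‖ ≤ ‖V‖ := by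
  refine ContinuousLinearMap.opNorm_le_bound _ (norm_nonneg _) fun f => ?_
  change ‖(weightIso α).symm (V (weightIso α f))‖ ≤ _
  rw [LinearIsometryEquiv.norm_map]
  exact (V.le_opNorm _).trans_eq (by rw [LinearIsometryEquiv.norm_map])

end Rules

/-! ## Dilations -/

theorem ae_comp_mul_volume {ε : ℝ} (hε : ε ≠ 0) {p : ℝ → Prop}
    (h : ∀ᵐ x ∂(volume : Measure ℝ), p x) : ∀ᵐ x ∂(volume : Measure ℝ), p (ε * x) := by
  have h1 := ae_comp_mul hε (α := 0) (α' := 0) (p := p)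
  rw [ae_expMeasure] at h1
  exact h1 h

theorem eLpNorm_comp_mul {ε : ℝ} (hε : ε ≠ 0) {g : ℝ → ℂ} (hg : AEStronglyMeasurable g volume) :
    eLpNorm (fun x => g (ε * x)) 2 volume =
      ENNReal.ofReal |ε⁻¹| ^ (1 / 2 : ℝ) * eLpNorm g 2 volume := by
  have h := eLpNorm_map_measure (p := 2) (μ := (volume : Measure ℝ)) (f := fun x => ε * x) (g := g)
    (by
      rw [show (fun x : ℝ => ε * x) = (ε * ·) from rfl, Real.map_volume_mul_left hε]
      exact hg.smul_measure _) (by fun_prop)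
  rw [show (fun x : ℝ => ε * x) = (ε * ·) from rfl, Real.map_volume_mul_left hε,
    eLpNorm_smul_measure_of_ne_top ENNReal.ofNat_ne_top, smul_eq_mul] at h
  simpa [Function.comp_def] using h.symm

/-- The dilation `h ↦ h(ε ·)` on `L²(ℝ)`. -/
def dil (ε : ℝ) (hε : ε ≠ 0) : H2 →L[ℂ] H2 :=
  LinearMap.mkContinuousOfExistsBound
    { toFun := fun f => (memLp_comp_mul hε (Lp.memLp f)).toLp
      map_add' := fun f g => by
        rw [← MemLp.toLp_add]
        refine MemLp.toLp_congr _ _ ?_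
        filter_upwards [ae_comp_mul_volume hε (Lp.coeFn_add f g)] with x h
        rw [h, Pi.add_apply, Pi.add_apply]
      map_smul' := fun c f => by
        rw [RingHom.id_apply, ← MemLp.toLp_const_smul]
        refine MemLp.toLp_congr _ _ ?_
        filter_upwards [ae_comp_mul_volume hε (Lp.coeFn_smul c f)] with x h
        rw [h, Pi.smul_apply, Pi.smul_apply] } (by
    refine ⟨(ENNReal.ofReal |ε⁻¹| ^ (1 / 2 : ℝ)).toReal, fun f => ?_⟩
    simp only [LinearMap.coe_mk, AddHom.coe_mk]
    rw [Lp.norm_toLp, eLpNorm_comp_mul hε (Lp.aestronglyMeasurable f), ENNReal.toReal_mul,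
      Lp.norm_def])

theorem dil_coe {ε : ℝ} (hε : ε ≠ 0) (f : H2) : dil ε hε f =ᵐ[volume] fun x => f (ε * x) :=
  MemLp.coeFn_toLp (memLp_comp_mul hε (Lp.memLp f))

theorem mulL2_dil {ε : ℝ} (hε : ε ≠ 0) {m : ℝ → ℂ} (hm : IsBddSymbol m) (f : H2) :
    mulL2 (fun x => m (ε * x)) (dil ε hε f) = dil ε hε (mulL2 m f) := by
  refine mulL2_eq_of_ae (hm.comp_mul ε) ?_
  filter_upwards [dil_coe hε f, dil_coe hε (mulL2 m f),
    ae_comp_mul_volume hε (mulL2_coe hm f)] with x h1 h2 h3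
  rw [h2, h1, h3]

/-- The dilation `φ ↦ φ(ε ·)` of Schwartz functions. -/
def schwartzDil (ε : ℝ) (hε : ε ≠ 0) : SchwartzMap ℝ ℂ →L[ℂ] SchwartzMap ℝ ℂ :=
  SchwartzMap.compCLMOfContinuousLinearEquiv ℂ
    (ContinuousLinearEquiv.unitsEquivAut ℝ (Units.mk0 ε hε))

theorem schwartzDil_apply {ε : ℝ} (hε : ε ≠ 0) (φ : SchwartzMap ℝ ℂ) (x : ℝ) :
    schwartzDil ε hε φ x = φ (ε * x) := by
  simp [schwartzDil, mul_comm]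

theorem dil_toLp {ε : ℝ} (hε : ε ≠ 0) (φ : SchwartzMap ℝ ℂ) :
    dil ε hε (φ.toLp 2) = (schwartzDil ε hε φ).toLp 2 := by
  refine Lp.ext ?_
  filter_upwards [dil_coe hε (φ.toLp 2), (schwartzDil ε hε φ).coeFn_toLp 2,
    ae_comp_mul_volume hε (φ.coeFn_toLp 2 volume)] with x h1 h2 h3
  rw [h1, h2, h3, schwartzDil_apply]

theorem fourier_schwartzDil {ε : ℝ} (hε : 0 < ε) (φ : SchwartzMap ℝ ℂ) :
    𝓕 (schwartzDil ε hε.ne' φ) =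
      (ε⁻¹ : ℂ) • schwartzDil ε⁻¹ (inv_ne_zero hε.ne') (𝓕 φ) := by
  ext v
  rw [_root_.smul_apply, schwartzDil_apply, SchwartzMap.fourier_coe, SchwartzMap.fourier_coe,
    Real.fourier_real_eq, Real.fourier_real_eq]
  have h := Measure.integral_comp_mul_left
    (fun y : ℝ => Real.fourierChar (-(y * (ε⁻¹ * v))) • φ y) ε
  rw [abs_of_pos (inv_pos.2 hε)] at h
  rw [smul_eq_mul, ← Complex.ofReal_inv, ← Complex.real_smul, ← h]
  refine integral_congr_ae (ae_of_all _ fun x => ?_)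
  simp only [schwartzDil_apply]
  congr 3
  field_simp

theorem schwartz_dense_induction {p : H2 → Prop} (hp : IsClosed {f | p f})
    (h : ∀ φ : SchwartzMap ℝ ℂ, p (φ.toLp 2)) (f : H2) : p f :=
  DenseRange.induction_on (SchwartzMap.denseRange_toLpCLM (p := 2) ENNReal.ofNat_ne_top) f hp h

theorem fourierL2_toLp (φ : SchwartzMap ℝ ℂ) : fourierL2 (φ.toLp 2) = (𝓕 φ).toLp 2 :=
  SchwartzMap.toLp_fourier_eq φ

/-- Both sides are continuous in `f`, so it suffices to substitute in the Fourier integral of a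
Schwartz function. -/
theorem fourierL2_dil {ε : ℝ} (hε : 0 < ε) (f : H2) :
    fourierL2 (dil ε hε.ne' f) = (ε⁻¹ : ℂ) • dil ε⁻¹ (inv_ne_zero hε.ne') (fourierL2 f) := by
  refine schwartz_dense_induction (p := fun f => fourierL2 (dil ε hε.ne' f) =
    (ε⁻¹ : ℂ) • dil ε⁻¹ (inv_ne_zero hε.ne') (fourierL2 f)) (isClosed_eq ?_ ?_) (fun φ => ?_) f
  · exact fourierL2.continuous.comp (dil ε hε.ne').continuous
  · exact ((ε⁻¹ : ℂ) • dil ε⁻¹ (inv_ne_zero hε.ne')).continuous.comp fourierL2.continuous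
  · rw [dil_toLp, fourierL2_toLp, fourierL2_toLp, dil_toLp, fourier_schwartzDil hε]
    rfl

theorem fmul_dil {ε : ℝ} (hε : 0 < ε) {m : ℝ → ℂ} (hm : IsBddSymbol m) (f : H2) :
    fmul m (dil ε hε.ne' f) = dil ε hε.ne' (fmul (fun v => m (ε * v)) f) := by
  apply fourierL2.injective
  rw [fourierL2_fmul, fourierL2_dil hε, fourierL2_dil hε, fourierL2_fmul, map_smul]
  congr 1
  rw [← mulL2_dil (inv_ne_zero hε.ne') (hm.comp_mul ε)]
  simp_rw [mul_inv_cancel_left₀ hε.ne']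

/-- Since `e^{εαx} = e^{α(εx)}`, the weights on the two sides match under dilation, and `I_ε`
becomes `√ε` times an unweighted dilation. -/
theorem scaling_weight_symm (α : ℝ) {ε : ℝ} (hε : 0 < ε) (f : L2w α) :
    scaling α ε hε f =
      (weight (ε * α)).symm ((Real.sqrt ε : ℂ) • dil ε hε.ne' (weight α f)) := by
  rw [LinearEquiv.eq_symm_apply]
  refine Lp.ext ?_
  filter_upwards [weight_coe (ε * α) (scaling α ε hε f),
    (ac_expMeasure (ε * α)).ae_le (scaling_coe α ε hε f),
    Lp.coeFn_smul (Real.sqrt ε : ℂ) (dil ε hε.ne' (weight α f)), dil_coe hε.ne' (weight α f),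
    ae_comp_mul_volume hε.ne' (weight_coe α f)] with x h1 h2 h3 h4 h5
  rw [h1, h2, h3, Pi.smul_apply, h4, h5, smul_eq_mul, show ε * α * x = α * (ε * x) by ring]
  ring

/-! ## The product rule -/

/-! ### Temperate growth from a polynomial differential equation -/

section Polynomial

open Polynomial

variable {u : ℝ → ℂ} {P : ℂ[X]}

theorem hasDerivAt_eval_of_deriv_eq (hu : ∀ x, HasDerivAt u (P.eval (u x)) x) (Q : ℂ[X]) (x : ℝ) :
    HasDerivAt (fun x => Q.eval (u x)) ((derivative Q * P).eval (u x)) x := by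
  rw [eval_mul]
  exact (Q.hasDerivAt (u x)).comp x (hu x)

/-- Polynomials in `u` are closed under differentiation because `(Q(u))' = (Q'P)(u)`. If `u` is
bounded, all derivatives are therefore bounded. The method serves both `1/(iξ)` and `tanh`. -/
theorem iteratedDeriv_eval_of_deriv_eq (hu : ∀ x, HasDerivAt u (P.eval (u x)) x) (n : ℕ) :
    ∀ Q : ℂ[X], ∃ R : ℂ[X], iteratedDeriv n (fun x => Q.eval (u x)) = fun x => R.eval (u x) := by
  induction n with
  | zero => exact fun Q => ⟨Q, iteratedDeriv_zero⟩
  | succ n ih =>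
    intro Q
    obtain ⟨R, hR⟩ := ih (derivative Q * P)
    refine ⟨R, ?_⟩
    rw [iteratedDeriv_succ', ← hR]
    congr 1
    funext x
    exact (hasDerivAt_eval_of_deriv_eq hu Q x).deriv

theorem exists_norm_eval_le {M : ℝ} (hM : ∀ x, ‖u x‖ ≤ M) (Q : ℂ[X]) :
    ∃ C, ∀ x, ‖Q.eval (u x)‖ ≤ C := by
  obtain ⟨C, hC⟩ := (isCompact_closedBall (0 : ℂ) M).exists_bound_of_continuousOn
    Q.continuous.continuousOn
  exact ⟨C, fun x => hC _ (by simpa using hM x)⟩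

/-- A polynomial in a bounded function `u` that satisfies `u' = P(u)` for a polynomial `P` has
temperate growth. -/
theorem hasTemperateGrowth_eval_of_deriv_eq (hu : ∀ x, HasDerivAt u (P.eval (u x)) x) {M : ℝ}
    (hM : ∀ x, ‖u x‖ ≤ M) (Q : ℂ[X]) : Function.HasTemperateGrowth fun x => Q.eval (u x) := by
  constructor
  · refine contDiff_of_differentiable_iteratedDeriv fun n _ => ?_
    obtain ⟨R, hR⟩ := iteratedDeriv_eval_of_deriv_eq hu n Q
    rw [hR]
    exact fun x => (hasDerivAt_eval_of_deriv_eq hu R x).differentiableAt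
  · intro n
    obtain ⟨R, hR⟩ := iteratedDeriv_eval_of_deriv_eq hu n Q
    obtain ⟨C, hC⟩ := exists_norm_eval_le hM R
    refine ⟨0, C, fun x => ?_⟩
    rw [norm_iteratedFDeriv_eq_norm_iteratedDeriv, hR, pow_zero, mul_one]
    exact hC x

end Polynomial

/-- The symbol `iξ` of the derivative on the line `ξ = 2πv + iα`. -/
def derivSym (α v : ℝ) : ℂ := Complex.I * lineVar α v

theorem derivSym_eq (α v : ℝ) : derivSym α v = 2 * Real.pi * Complex.I * v - α := by
  have h := Complex.I_mul_I
  simp only [derivSym, lineVar]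
  push_cast
  linear_combination (α : ℂ) * h

theorem norm_derivSym (α v : ℝ) : ‖derivSym α v‖ = ‖lineVar α v‖ := by simp [derivSym]

theorem le_norm_lineVar (α v : ℝ) : α ≤ ‖lineVar α v‖ := by
  have h := Complex.abs_im_le_norm (lineVar α v)
  rw [lineVar_im] at h
  exact (le_abs_self α).trans h

section Product

variable {α : ℝ}

theorem derivSym_ne_zero (hα : 0 < α) (v : ℝ) : derivSym α v ≠ 0 := by
  rw [← norm_pos_iff, norm_derivSym]
  exact hα.trans_le (le_norm_lineVar α v)

theorem measurable_derivSym (α : ℝ) : Measurable (derivSym α) :=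
  (measurable_lineVar α).const_mul _

theorem norm_derivSym_inv_le (hα : 0 < α) (v : ℝ) : ‖(derivSym α v)⁻¹‖ ≤ α⁻¹ := by
  rw [norm_inv, norm_derivSym]
  exact inv_anti₀ hα (le_norm_lineVar α v)

theorem isBddSymbol_derivSym_inv (hα : 0 < α) : IsBddSymbol fun v => (derivSym α v)⁻¹ :=
  ⟨(measurable_derivSym α).inv, α⁻¹, norm_derivSym_inv_le hα⟩

/-- The function `u = 1/(iξ)` solves `u' = -2πi u²` in the variable `v` and is bounded by `1/α`. -/
theorem hasTemperateGrowth_derivSym_inv (hα : 0 < α) :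
    Function.HasTemperateGrowth fun v => (derivSym α v)⁻¹ := by
  have h := hasTemperateGrowth_eval_of_deriv_eq (u := fun v => (derivSym α v)⁻¹)
    (P := Polynomial.C (-(2 * Real.pi * Complex.I)) * Polynomial.X ^ 2) (fun v => ?_)
    (norm_derivSym_inv_le hα) Polynomial.X
  · simpa using h
  · have h1 : HasDerivAt (derivSym α) (2 * Real.pi * Complex.I) v := by
      have h2 : HasDerivAt (fun v : ℝ => 2 * Real.pi * Complex.I * (v : ℂ) - (α : ℂ))
          (2 * Real.pi * Complex.I * 1) v :=
        ((Complex.ofRealCLM.hasDerivAt (x := v)).const_mul _).sub_const _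
      rw [mul_one] at h2
      exact h2.congr_of_eventuallyEq (Eventually.of_forall (derivSym_eq α))
    have h3 := h1.fun_inv (derivSym_ne_zero hα v)
    have h4 : (Polynomial.C (-(2 * Real.pi * Complex.I)) * Polynomial.X ^ 2 : Polynomial ℂ).eval
        (derivSym α v)⁻¹ = -(2 * Real.pi * Complex.I) / derivSym α v ^ 2 := by
      rw [Polynomial.eval_mul, Polynomial.eval_C, Polynomial.eval_pow, Polynomial.eval_X]
      ring
    rw [h4]
    exact h3

theorem fourier_derivCLM_apply (ψ : SchwartzMap ℝ ℂ) (v : ℝ) :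
    (𝓕 (SchwartzMap.derivCLM ℂ ℂ ψ)) v = 2 * Real.pi * Complex.I * v * (𝓕 ψ) v := by
  rw [SchwartzMap.fourier_coe, SchwartzMap.fourier_coe]
  have h := congrFun (Real.fourier_deriv ψ.integrable ψ.differentiable
    (SchwartzMap.derivCLM ℂ ℂ ψ).integrable) v
  rw [smul_eq_mul] at h
  exact h

/-- The operator `∂ - α` on Schwartz functions. -/
def schwartzDeriv (α : ℝ) (ψ : SchwartzMap ℝ ℂ) : SchwartzMap ℝ ℂ :=
  SchwartzMap.derivCLM ℂ ℂ ψ - (α : ℂ) • ψ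

theorem schwartzDeriv_apply (α : ℝ) (ψ : SchwartzMap ℝ ℂ) (x : ℝ) :
    schwartzDeriv α ψ x = deriv ψ x - α * ψ x := rfl

theorem fourier_schwartzDeriv (ψ : SchwartzMap ℝ ℂ) (v : ℝ) :
    (𝓕 (schwartzDeriv α ψ)) v = derivSym α v * (𝓕 ψ) v := by
  have h : 𝓕 (schwartzDeriv α ψ) = 𝓕 (SchwartzMap.derivCLM ℂ ℂ ψ) - (α : ℂ) • 𝓕 ψ := by
    rw [schwartzDeriv, sub_eq_add_neg, FourierTransform.fourier_add, ← neg_smul, FourierTransform.fourier_smul,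
      neg_smul, ← sub_eq_add_neg]
  rw [h, _root_.sub_apply, _root_.smul_apply, fourier_derivCLM_apply, derivSym_eq, smul_eq_mul]
  ring

theorem fmul_derivSym_inv_toLp (hα : 0 < α) (ψ : SchwartzMap ℝ ℂ) :
    fmul (fun v => (derivSym α v)⁻¹) ((schwartzDeriv α ψ).toLp 2) = ψ.toLp 2 := by
  apply fourierL2.injective
  rw [fourierL2_fmul, fourierL2_toLp, fourierL2_toLp]
  refine mulL2_eq_of_ae (isBddSymbol_derivSym_inv hα) ?_
  filter_upwards [(𝓕 ψ).coeFn_toLp 2 volume, (𝓕 (schwartzDeriv α ψ)).coeFn_toLp 2 volume]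
    with v h1 h2
  rw [h1, h2, fourier_schwartzDeriv, inv_mul_cancel_left₀ (derivSym_ne_zero hα v)]

/-- On the Fourier side `∂ - α` is multiplication by `iξ`, which has no zero on the line when `α >
0`, and `1/(iξ)` preserves the Schwartz space. Hence identities for `∂⁻¹` can be tested on functions
`(∂ - α)ψ`. -/
theorem exists_schwartzDeriv_eq (hα : 0 < α) (φ : SchwartzMap ℝ ℂ) :
    ∃ ψ, schwartzDeriv α ψ = φ := by
  refine ⟨𝓕⁻ (SchwartzMap.smulLeftCLM ℂ (fun v => (derivSym α v)⁻¹) (𝓕 φ)), ?_⟩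
  apply (FourierTransform.fourierEquiv ℂ (SchwartzMap ℝ ℂ)).injective
  ext v
  change (𝓕 (schwartzDeriv α _)) v = (𝓕 φ) v
  rw [fourier_schwartzDeriv, FourierTransform.fourier_fourierInv_eq,
    SchwartzMap.smulLeftCLM_apply_apply (hasTemperateGrowth_derivSym_inv hα), smul_eq_mul,
    mul_inv_cancel_left₀ (derivSym_ne_zero hα v)]

/-- A multiplier that the product rule applies to: a bounded function of temperate growth with a
bounded derivative. -/
structure IsMultiplier (θ θ' : ℝ → ℂ) : Prop where
  growth : Function.HasTemperateGrowth θ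
  bdd : IsBddSymbol θ
  bdd_deriv : IsBddSymbol θ'
  hasDerivAt : ∀ x, HasDerivAt θ (θ' x) x

variable {θ θ' : ℝ → ℂ}

/-- The product rule in integrated form, `θ∂⁻¹ = ∂⁻¹(θ'∂⁻¹ + θ)`, where `∂` stands for the
conjugated derivative `∂ - α`. Only bounded operators occur, so it extends by density from `f = (∂ -
α)ψ`, where it is the ordinary Leibniz rule for `θψ`. -/
theorem mulL2_mul_fmul_derivSym_inv (hα : 0 < α) (hθ : IsMultiplier θ θ') :
    mulL2 θ * fmul (fun v => (derivSym α v)⁻¹) = fmul (fun v => (derivSym α v)⁻¹) *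
      (mulL2 θ' * fmul (fun v => (derivSym α v)⁻¹) + mulL2 θ) := by
  ext1 f
  refine schwartz_dense_induction (p := fun f => (mulL2 θ * fmul fun v => (derivSym α v)⁻¹) f =
    (fmul (fun v => (derivSym α v)⁻¹) *
      (mulL2 θ' * fmul (fun v => (derivSym α v)⁻¹) + mulL2 θ)) f)
    (isClosed_eq (ContinuousLinearMap.continuous _) (ContinuousLinearMap.continuous _))
    (fun φ => ?_) f
  obtain ⟨ψ, rfl⟩ := exists_schwartzDeriv_eq hα φ
  rw [_root_.mul_apply_eq_comp, _root_.mul_apply_eq_comp, _root_.add_apply,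
    _root_.mul_apply_eq_comp, fmul_derivSym_inv_toLp hα]
  have h1 : mulL2 θ (ψ.toLp 2) = (SchwartzMap.smulLeftCLM ℂ θ ψ).toLp 2 := by
    refine mulL2_eq_of_ae hθ.bdd ?_
    filter_upwards [(SchwartzMap.smulLeftCLM ℂ θ ψ).coeFn_toLp 2 volume,
      ψ.coeFn_toLp 2 volume] with x h1 h2
    rw [h1, h2, SchwartzMap.smulLeftCLM_apply_apply hθ.growth, smul_eq_mul]
  have h2 : mulL2 θ' (ψ.toLp 2) + mulL2 θ ((schwartzDeriv α ψ).toLp 2) =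
      (schwartzDeriv α (SchwartzMap.smulLeftCLM ℂ θ ψ)).toLp 2 := by
    refine Lp.ext ?_
    filter_upwards [Lp.coeFn_add (mulL2 θ' (ψ.toLp 2)) (mulL2 θ ((schwartzDeriv α ψ).toLp 2)),
      mulL2_coe hθ.bdd_deriv (ψ.toLp 2), mulL2_coe hθ.bdd ((schwartzDeriv α ψ).toLp 2),
      ψ.coeFn_toLp 2 volume, (schwartzDeriv α ψ).coeFn_toLp 2 volume,
      (schwartzDeriv α (SchwartzMap.smulLeftCLM ℂ θ ψ)).coeFn_toLp 2 volume]
      with x h3 h4 h5 h6 h7 h8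
    rw [h3, Pi.add_apply, h4, h5, h6, h7, h8, schwartzDeriv_apply, schwartzDeriv_apply,
      SchwartzMap.smulLeftCLM_apply hθ.growth]
    simp only [smul_eq_mul]
    rw [((hθ.hasDerivAt x).fun_mul (ψ.differentiableAt.hasDerivAt (x := x))).deriv]
    ring
  rw [h1, h2, fmul_derivSym_inv_toLp hα]

/-- The product rule `∂(θ N) = θ' N + θ ∂N` for a multiplier `N` with values in the domain of
`∂`. -/
theorem mulL2_mul_fmul (hα : 0 < α) (hθ : IsMultiplier θ θ') {n : ℝ → ℂ}
    (hdn : IsBddSymbol fun v => derivSym α v * n v) :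
    mulL2 θ * fmul n = fmul (fun v => (derivSym α v)⁻¹) *
      (mulL2 θ' * fmul n + mulL2 θ * fmul fun v => derivSym α v * n v) := by
  have h : fmul n = fmul (fun v => (derivSym α v)⁻¹) * fmul fun v => derivSym α v * n v := by
    rw [← fmul_mul (isBddSymbol_derivSym_inv hα) hdn]
    congr 1
    funext v
    rw [inv_mul_cancel_left₀ (derivSym_ne_zero hα v)]
  rw [h, ← mul_assoc, mulL2_mul_fmul_derivSym_inv hα hθ]
  simp only [mul_assoc, add_mul]

/-- Integration by parts: the derivative leaves `N` on the right of `θ` and falls on the smoothing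
factor `B` on its left. This pays for the missing decay of `∂N` at high frequencies. -/
theorem fmul_mul_mulL2_mul_fmul (hα : 0 < α) (hθ : IsMultiplier θ θ') {n B : ℝ → ℂ}
    (hdn : IsBddSymbol fun v => derivSym α v * n v)
    (hdB : IsBddSymbol fun v => derivSym α v * B v) :
    fmul B * (mulL2 θ * fmul fun v => derivSym α v * n v) =
      fmul (fun v => derivSym α v * B v) * (mulL2 θ * fmul n) -
        fmul B * (mulL2 θ' * fmul n) := by
  have h : (fun v => derivSym α v * B v * (derivSym α v)⁻¹) = B := by
    funext v
    rw [mul_right_comm, mul_inv_cancel₀ (derivSym_ne_zero hα v), one_mul]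
  rw [mulL2_mul_fmul hα hθ hdn, ← mul_assoc (fmul fun v => derivSym α v * B v),
    ← fmul_mul hdB (isBddSymbol_derivSym_inv hα), h, mul_add]
  abel

end Product

/-! ## Quantitative convergence of products of multipliers and Fourier multipliers -/

theorem norm_mul_mul_le {a b c : ℝ} {R S T : H2 →L[ℂ] H2} (hR : ‖R‖ ≤ a) (hS : ‖S‖ ≤ b)
    (hT : ‖T‖ ≤ c) : ‖R * (S * T)‖ ≤ a * (b * c) := by
  have ha := (norm_nonneg _).trans hR
  have hb := (norm_nonneg _).trans hS
  refine (norm_mul_le _ _).trans (mul_le_mul hR ?_ (norm_nonneg _) ha)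
  exact (norm_mul_le _ _).trans (mul_le_mul hS hT (norm_nonneg _) hb)

theorem le_sqrt_self {x : ℝ} (h0 : 0 ≤ x) (h1 : x ≤ 1) : x ≤ √x :=
  Real.le_sqrt_of_sq_le (by nlinarith)

/-- A symbol that behaves like `(1 + ε²|ξ|²)⁻¹` on the line `Im ξ = α`. -/
structure IsDamping (α ε K : ℝ) (B : ℝ → ℂ) : Prop where
  meas : Measurable B
  norm_le : ∀ v, ‖B v‖ ≤ K
  norm_deriv_le : ∀ v, ‖derivSym α v * B v‖ ≤ K / ε
  norm_sub_one_le : ∀ v, ‖B v - 1‖ ≤ K * ε * ‖lineVar α v‖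

theorem IsDamping.isBddSymbol {α ε K : ℝ} {B : ℝ → ℂ} (hB : IsDamping α ε K B) : IsBddSymbol B :=
  ⟨hB.meas, K, hB.norm_le⟩

theorem IsDamping.isBddSymbol_deriv {α ε K : ℝ} {B : ℝ → ℂ} (hB : IsDamping α ε K B) :
    IsBddSymbol fun v => derivSym α v * B v :=
  ⟨(measurable_derivSym α).mul hB.meas, K / ε, hB.norm_deriv_le⟩

/-- The three terms come from replacing `θ` by `θ₀`, then `n` by `n₀`, then `B` by `1`. The last
replacement costs a derivative: `(B - 1)θ₀N₀ = ((B - 1)∂⁻¹) ∂(θ₀N₀)`, where the first factor is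
`O(ε)` and the second is bounded by the product rule. -/
theorem norm_fmul_mul_sub_le {α ε K M τ C δ : ℝ} (hα : 0 < α) {B θ θ₀ θ₀' n n₀ : ℝ → ℂ}
    (hB : IsDamping α ε K B) (h₀ : IsMultiplier θ₀ θ₀') (hM : ‖mulL2 θ₀‖ ≤ M)
    (hM' : ‖mulL2 θ₀'‖ ≤ M) (hτ : ‖mulL2 θ - mulL2 θ₀‖ ≤ τ) (hn : Measurable n)
    (hn₀ : Measurable n₀) (hnC : ∀ v, ‖n v‖ ≤ C) (hn₀C : ∀ v, ‖n₀ v‖ ≤ C)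
    (hdn₀ : ∀ v, ‖derivSym α v * n₀ v‖ ≤ C) (hδ : ∀ v, ‖n v - n₀ v‖ ≤ δ) :
    ‖fmul B * (mulL2 θ * fmul n) - mulL2 θ₀ * fmul n₀‖ ≤
      K * (τ * C) + K * (M * δ) + K * ε * (2 * (M * C)) := by
  have bn : IsBddSymbol n := ⟨hn, C, hnC⟩
  have bn₀ : IsBddSymbol n₀ := ⟨hn₀, C, hn₀C⟩
  have bdn₀ : IsBddSymbol fun v => derivSym α v * n₀ v :=
    ⟨(measurable_derivSym α).mul hn₀, C, hdn₀⟩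
  have hM0 : 0 ≤ M := (norm_nonneg _).trans hM
  have bB1 := hB.isBddSymbol.sub (IsBddSymbol.const 1)
  have e1 : (fmul B - 1) * (mulL2 θ₀ * fmul n₀) =
      fmul (fun v => (B v - 1) * (derivSym α v)⁻¹) *
        (mulL2 θ₀' * fmul n₀ + mulL2 θ₀ * fmul fun v => derivSym α v * n₀ v) := by
    rw [mulL2_mul_fmul hα h₀ bdn₀, fmul_mul bB1 (isBddSymbol_derivSym_inv hα),
      fmul_sub hB.isBddSymbol (IsBddSymbol.const 1), fmul_one, mul_assoc]
  have e2 : fmul B * (mulL2 θ * fmul n) - mulL2 θ₀ * fmul n₀ =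
      fmul B * ((mulL2 θ - mulL2 θ₀) * fmul n) + fmul B * (mulL2 θ₀ * fmul fun v => n v - n₀ v) +
        (fmul B - 1) * (mulL2 θ₀ * fmul n₀) := by
    rw [fmul_sub bn bn₀]
    noncomm_ring
  have b1 : ‖fmul fun v => (B v - 1) * (derivSym α v)⁻¹‖ ≤ K * ε := by
    refine norm_fmul_le fun v => ?_
    have hx : 0 < ‖derivSym α v‖ := norm_pos_iff.2 (derivSym_ne_zero hα v)
    rw [norm_mul, norm_inv, ← div_eq_mul_inv, div_le_iff₀ hx, norm_derivSym]
    exact hB.norm_sub_one_le v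
  have b2 : ‖mulL2 θ₀' * fmul n₀ + mulL2 θ₀ * fmul fun v => derivSym α v * n₀ v‖ ≤
      2 * (M * C) := by
    rw [two_mul]
    refine (norm_add_le _ _).trans (add_le_add ?_ ?_)
    · exact (norm_mul_le _ _).trans (mul_le_mul hM' (norm_fmul_le hn₀C) (norm_nonneg _) hM0)
    · exact (norm_mul_le _ _).trans (mul_le_mul hM (norm_fmul_le hdn₀) (norm_nonneg _) hM0)
  rw [e2, e1]
  refine (norm_add₃_le).trans (add_le_add (add_le_add ?_ ?_) ?_)
  · exact norm_mul_mul_le (norm_fmul_le hB.norm_le) hτ (norm_fmul_le hnC)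
  · exact norm_mul_mul_le (norm_fmul_le hB.norm_le) hM (norm_fmul_le hδ)
  · exact (norm_mul_le _ _).trans
      (mul_le_mul b1 b2 (norm_nonneg _) ((norm_nonneg _).trans b1))

/-- Two nearby profiles `θ` and `θ₀` with their derivatives. -/
structure AreClose (M τ : ℝ) (θ θ' θ₀ θ₀' θ₀'' : ℝ → ℂ) : Prop where
  mult : IsMultiplier θ θ'
  mult₀ : IsMultiplier θ₀ θ₀'
  mult₀' : IsMultiplier θ₀' θ₀''
  norm_le : ‖mulL2 θ‖ ≤ M
  norm_le' : ‖mulL2 θ'‖ ≤ M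
  norm₀_le : ‖mulL2 θ₀‖ ≤ M
  norm₀'_le : ‖mulL2 θ₀'‖ ≤ M
  norm₀''_le : ‖mulL2 θ₀''‖ ≤ M
  norm_sub_le : ‖mulL2 θ - mulL2 θ₀‖ ≤ τ
  norm_sub_le' : ‖mulL2 θ' - mulL2 θ₀'‖ ≤ τ

/-- Two nearby symbols of order `-2`; the first one stops decaying at frequencies `1/ε`. -/
structure AreCloseSymbols (α ε C : ℝ) (n n₀ : ℝ → ℂ) : Prop where
  meas : Measurable n
  meas₀ : Measurable n₀
  bdd_deriv : IsBddSymbol fun v => derivSym α v * n v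
  norm_le : ∀ v, ‖n v‖ ≤ C * (1 + ε ^ 2 * ‖lineVar α v‖ ^ 2) / ‖lineVar α v‖ ^ 2
  norm₀_le : ∀ v, ‖n₀ v‖ ≤ C / ‖lineVar α v‖ ^ 2
  norm_sub_le : ∀ v, ‖n v - n₀ v‖ ≤ C * ε ^ 2 * ‖lineVar α v‖

section Convergence

variable {α ε K M τ C : ℝ} {B θ θ' θ₀ θ₀' θ₀'' n n₀ : ℝ → ℂ}

/-- The single factor `(1 + α⁻¹)²` absorbs every negative power of `|ξ| ≥ α` needed below. -/
theorem div_le_mul_of_le {x : ℝ} (hα : 0 < α) (hx : α ≤ x) (hC : 0 ≤ C) :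
    C / x ≤ C * (1 + α⁻¹) ^ 2 ∧ C / x ^ 2 ≤ C * (1 + α⁻¹) ^ 2 ∧
      C / x ^ 2 + C ≤ C * (1 + α⁻¹) ^ 2 := by
  have hi : x⁻¹ ≤ α⁻¹ := inv_anti₀ hα hx
  have hi0 : 0 < x⁻¹ := inv_pos.2 (hα.trans_le hx)
  have hi2 : (x ^ 2)⁻¹ ≤ (α⁻¹) ^ 2 := by
    rw [← inv_pow]
    exact pow_le_pow_left₀ hi0.le hi 2
  have ha0 : 0 < α⁻¹ := inv_pos.2 hα
  simp only [div_eq_mul_inv]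
  refine ⟨mul_le_mul_of_nonneg_left (by nlinarith) hC,
    mul_le_mul_of_nonneg_left (by nlinarith) hC, ?_⟩
  nlinarith [mul_le_mul_of_nonneg_left hi2 hC, mul_nonneg hC ha0.le]

/-- The cases split at `x = 1/ε`. Below it the difference bound `Cε²x` is at most `Cε`; above it
both symbols are separately `O(ε)`. The rate `ε` is weakened to `√ε` to match the estimate with a
derivative. -/
theorem norm_sub_le_sqrt {x p p₀ q : ℝ} (hε : 0 < ε) (hε1 : ε ≤ 1) (hx : 0 < x) (hC : 0 ≤ C)
    (hp : p ≤ C * (1 + ε ^ 2 * x ^ 2) / x ^ 2) (hp₀ : p₀ ≤ C / x ^ 2) (hq : q ≤ C * ε ^ 2 * x)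
    (hq' : q ≤ p + p₀) : q ≤ 3 * C * √ε := by
  have he : ε ≤ √ε := le_sqrt_self hε.le hε1
  suffices h : q ≤ 3 * C * ε from h.trans (mul_le_mul_of_nonneg_left he (by positivity))
  rcases le_or_gt (ε * x) 1 with h | h
  · have h1 : C * ε * (ε * x) ≤ C * ε * 1 := mul_le_mul_of_nonneg_left h (by positivity)
    nlinarith [mul_nonneg hC hε.le]
  · have h1 : C / x ^ 2 ≤ C * ε := by
      rw [div_le_iff₀ (by positivity)]
      have h2 : 1 ≤ ε * x ^ 2 := by nlinarith
      nlinarith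
    have h2 : C * (1 + ε ^ 2 * x ^ 2) / x ^ 2 = C / x ^ 2 + C * ε ^ 2 := by
      field_simp
    have h3 : C * ε ^ 2 ≤ C * ε := mul_le_mul_of_nonneg_left (by nlinarith) hC
    linarith

theorem AreCloseSymbols.norm_le_const (hα : 0 < α) (hε : 0 < ε) (hε1 : ε ≤ 1) (hC : 0 ≤ C)
    (hn : AreCloseSymbols α ε C n n₀) (v : ℝ) : ‖n v‖ ≤ C * (1 + α⁻¹) ^ 2 := by
  have hx := le_norm_lineVar α v
  have hx0 := hα.trans_le hx
  refine (hn.norm_le v).trans (le_trans ?_ (div_le_mul_of_le hα hx hC).2.2)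
  rw [show C * (1 + ε ^ 2 * ‖lineVar α v‖ ^ 2) / ‖lineVar α v‖ ^ 2 =
    C / ‖lineVar α v‖ ^ 2 + C * ε ^ 2 by field_simp]
  have : C * ε ^ 2 ≤ C * 1 := mul_le_mul_of_nonneg_left (by nlinarith) hC
  linarith

theorem AreCloseSymbols.norm₀_le_const (hα : 0 < α) (hC : 0 ≤ C)
    (hn : AreCloseSymbols α ε C n n₀) (v : ℝ) : ‖n₀ v‖ ≤ C * (1 + α⁻¹) ^ 2 :=
  (hn.norm₀_le v).trans (div_le_mul_of_le hα (le_norm_lineVar α v) hC).2.1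

theorem AreCloseSymbols.norm_deriv₀_le (hα : 0 < α)
    (hn : AreCloseSymbols α ε C n n₀) (v : ℝ) :
    ‖derivSym α v * n₀ v‖ ≤ C / ‖lineVar α v‖ := by
  have hx0 := hα.trans_le (le_norm_lineVar α v)
  rw [norm_mul, norm_derivSym]
  refine (mul_le_mul_of_nonneg_left (hn.norm₀_le v) hx0.le).trans_eq ?_
  field_simp

/-- The factor `1/(1 + ε²|ξ|²)` that separates low from high frequencies. -/
def cutSym (α ε v : ℝ) : ℂ := ((1 + ε ^ 2 * ‖lineVar α v‖ ^ 2)⁻¹ : ℝ)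

theorem measurable_cutSym (α ε : ℝ) : Measurable (cutSym α ε) := by
  have := measurable_lineVar α
  unfold cutSym
  fun_prop

theorem norm_cutSym (α ε v : ℝ) : ‖cutSym α ε v‖ = (1 + ε ^ 2 * ‖lineVar α v‖ ^ 2)⁻¹ := by
  rw [cutSym, Complex.norm_real, Real.norm_of_nonneg (by positivity)]

theorem norm_one_sub_cutSym (α ε v : ℝ) : ‖1 - cutSym α ε v‖ =
    ε ^ 2 * ‖lineVar α v‖ ^ 2 / (1 + ε ^ 2 * ‖lineVar α v‖ ^ 2) := by
  have h : 0 < 1 + ε ^ 2 * ‖lineVar α v‖ ^ 2 := by positivity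
  rw [cutSym, ← Complex.ofReal_one, ← Complex.ofReal_sub, Complex.norm_real,
    show 1 - (1 + ε ^ 2 * ‖lineVar α v‖ ^ 2)⁻¹ =
      ε ^ 2 * ‖lineVar α v‖ ^ 2 / (1 + ε ^ 2 * ‖lineVar α v‖ ^ 2) by field_simp; ring]
  exact Real.norm_of_nonneg (by positivity)

/-- Convergence without derivative. -/
theorem norm_damped_sub_le (hα : 0 < α) (hε : 0 < ε) (hε1 : ε ≤ 1) (hK : 0 ≤ K) (hC : 0 ≤ C)
    (hB : IsDamping α ε K B) (hθ : ‖mulL2 θ - mulL2 θ₀‖ ≤ τ) (h₀ : IsMultiplier θ₀ θ₀')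
    (hM : ‖mulL2 θ₀‖ ≤ M) (hM' : ‖mulL2 θ₀'‖ ≤ M) (hn : AreCloseSymbols α ε C n n₀) :
    ‖fmul B * (mulL2 θ * fmul n) - mulL2 θ₀ * fmul n₀‖ ≤
      7 * (K * (1 + M) * C * (1 + α⁻¹) ^ 2) * (√ε + τ) := by
  have hM0 : 0 ≤ M := (norm_nonneg _).trans hM
  have hτ0 : 0 ≤ τ := (norm_nonneg _).trans hθ
  have hA : 1 ≤ (1 + α⁻¹) ^ 2 := one_le_pow₀ (by linarith [inv_pos.2 hα])
  have he : ε ≤ √ε := le_sqrt_self hε.le hε1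
  have hδ : ∀ v, ‖n v - n₀ v‖ ≤ 3 * C * √ε := fun v =>
    norm_sub_le_sqrt hε hε1 (hα.trans_le (le_norm_lineVar α v)) hC (hn.norm_le v) (hn.norm₀_le v)
      (hn.norm_sub_le v) (_root_.norm_sub_le _ _)
  refine (norm_fmul_mul_sub_le hα hB h₀ hM hM' hθ hn.meas hn.meas₀
    (hn.norm_le_const hα hε hε1 hC) (hn.norm₀_le_const hα hC) (fun v =>
      (hn.norm_deriv₀_le hα v).trans (div_le_mul_of_le hα (le_norm_lineVar α v) hC).1)
    hδ).trans ?_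
  -- With `X = K(1 + M)CA` the three terms are at most `Xτ`, `3X√ε` and `2X√ε`; the factor 7 is not
  -- sharp.
  set A := (1 + α⁻¹) ^ 2
  have hKC : 0 ≤ K * C := mul_nonneg hK hC
  have hKCM : 0 ≤ K * C * M := mul_nonneg hKC hM0
  have hs := Real.sqrt_nonneg ε
  have t1 : K * C * τ * A ≤ K * C * (1 + M) * A * τ := by
    have : 0 ≤ K * C * M * A * τ := by positivity
    nlinarith
  have t2 : K * C * M * √ε ≤ K * C * (1 + M) * A * √ε := by
    have : K * C * M * √ε * 1 ≤ K * C * M * √ε * A :=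
      mul_le_mul_of_nonneg_left hA (by positivity)
    have : 0 ≤ K * C * A * √ε := by positivity
    nlinarith
  have t3 : K * C * M * A * ε ≤ K * C * (1 + M) * A * √ε := by
    have : K * C * M * A * ε ≤ K * C * M * A * √ε := mul_le_mul_of_nonneg_left he (by positivity)
    have : 0 ≤ K * C * A * √ε := by positivity
    nlinarith
  have t4 : 0 ≤ K * C * (1 + M) * A * τ := by positivity
  have t5 : 0 ≤ K * C * (1 + M) * A * √ε := by positivity
  nlinarith

/-- Here `r` stands for the error `|iξ(χn - n₀)|`, with `χ` the cutoff `1/(1 + ε²x²)` and `x = |ξ|`.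
The cases split at `x = ε^{-1/2}`. Below it, `h2` combines `n - n₀ = O(ε²x)` with `1 - χ ≤ ε²x²`;
above it, `h1` bounds each term by `C/x ≤ C√ε`. This split produces the rate `√ε`. -/
theorem norm_cut_sub_le {x p p₀ q : ℝ} (hε : 0 < ε) (hε1 : ε ≤ 1) (hx : 0 < x) (hC : 0 ≤ C)
    (hp : p ≤ C * (1 + ε ^ 2 * x ^ 2) / x ^ 2) (hp₀ : p₀ ≤ C / x ^ 2) (hq : q ≤ C * ε ^ 2 * x)
    (hq0 : 0 ≤ q) (hp₀0 : 0 ≤ p₀) {r : ℝ}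
    (h1 : r ≤ x * (1 + ε ^ 2 * x ^ 2)⁻¹ * p + x * p₀)
    (h2 : r ≤ x * (1 + ε ^ 2 * x ^ 2)⁻¹ * q + ε ^ 2 * x ^ 2 / (1 + ε ^ 2 * x ^ 2) * (x * p₀)) :
    r ≤ 3 * C * √ε := by
  have he : ε ≤ √ε := le_sqrt_self hε.le hε1
  have hs0 : 0 < √ε := Real.sqrt_pos.2 hε
  have hss : √ε * √ε = ε := Real.mul_self_sqrt hε.le
  have hY : 0 < 1 + ε ^ 2 * x ^ 2 := by positivity
  have hY1 : 1 ≤ 1 + ε ^ 2 * x ^ 2 := by nlinarith [sq_nonneg (ε * x)]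
  rcases le_or_gt (√ε * x) 1 with h | h
  · have hεx : ε * x ≤ √ε := by nlinarith
    have a1 : x * (1 + ε ^ 2 * x ^ 2)⁻¹ * q ≤ C * √ε := by
      calc x * (1 + ε ^ 2 * x ^ 2)⁻¹ * q ≤ x * 1 * (C * ε ^ 2 * x) := by
            gcongr
            exact inv_le_one_of_one_le₀ hY1
        _ = C * ((ε * x) * (ε * x)) := by ring
        _ ≤ C * (√ε * √ε) := by gcongr
        _ ≤ C * √ε := by rw [hss]; gcongr
    have a2 : ε ^ 2 * x ^ 2 / (1 + ε ^ 2 * x ^ 2) * (x * p₀) ≤ C * √ε := by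
      calc ε ^ 2 * x ^ 2 / (1 + ε ^ 2 * x ^ 2) * (x * p₀)
          ≤ ε ^ 2 * x ^ 2 * (x * (C / x ^ 2)) := by
            gcongr
            exact div_le_self (by positivity) hY1
        _ = C * (ε * (ε * x)) := by field_simp
        _ ≤ C * (1 * √ε) := by gcongr
        _ = C * √ε := by ring
    nlinarith [mul_nonneg hC hs0.le]
  · have hx1 : C / x ≤ C * √ε := by
      rw [div_le_iff₀ hx]
      nlinarith
    have a1 : x * (1 + ε ^ 2 * x ^ 2)⁻¹ * p ≤ C / x := by
      calc x * (1 + ε ^ 2 * x ^ 2)⁻¹ * p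
          ≤ x * (1 + ε ^ 2 * x ^ 2)⁻¹ * (C * (1 + ε ^ 2 * x ^ 2) / x ^ 2) := by gcongr
        _ = C / x := by field_simp
    have a2 : x * p₀ ≤ C / x := by
      calc x * p₀ ≤ x * (C / x ^ 2) := by gcongr
        _ = C / x := by field_simp
    nlinarith [mul_nonneg hC hs0.le]

/-- Convergence with a derivative. -/
theorem norm_damped_deriv_sub_le (hα : 0 < α) (hε : 0 < ε) (hε1 : ε ≤ 1) (hK : 0 ≤ K)
    (hC : 0 ≤ C) (hB : IsDamping α ε K B) (hθ : AreClose M τ θ θ' θ₀ θ₀' θ₀'')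
    (hn : AreCloseSymbols α ε C n n₀) :
    ‖fmul B * (mulL2 θ * fmul fun v => derivSym α v * n v) -
      mulL2 θ₀ * fmul fun v => derivSym α v * n₀ v‖ ≤
      9 * (K * (1 + M) * C * (1 + α⁻¹) ^ 2) * (√ε + τ) := by
  have hM0 : 0 ≤ M := (norm_nonneg _).trans hθ.norm_le
  have hτ0 : 0 ≤ τ := (norm_nonneg _).trans hθ.norm_sub_le
  have hA : 1 ≤ (1 + α⁻¹) ^ 2 := one_le_pow₀ (by linarith [inv_pos.2 hα])
  have he : ε ≤ √ε := le_sqrt_self hε.le hε1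
  have hx0 : ∀ v, 0 < ‖lineVar α v‖ := fun v => hα.trans_le (le_norm_lineVar α v)
  have hY : ∀ v, 0 < 1 + ε ^ 2 * ‖lineVar α v‖ ^ 2 := fun v => by positivity
  have md := measurable_derivSym α
  have mc := measurable_cutSym α ε
  -- The cutoff `1 - χ` supplies `ε²|ξ|²/(1 + ε²|ξ|²)`, which cancels the bound for `n` up to `Cε²`.
  have hhigh : ∀ v, ‖(1 - cutSym α ε v) * n v‖ ≤ C * ε ^ 2 := fun v => by
    rw [norm_mul, norm_one_sub_cutSym]
    calc ε ^ 2 * ‖lineVar α v‖ ^ 2 / (1 + ε ^ 2 * ‖lineVar α v‖ ^ 2) * ‖n v‖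
        ≤ ε ^ 2 * ‖lineVar α v‖ ^ 2 / (1 + ε ^ 2 * ‖lineVar α v‖ ^ 2) *
          (C * (1 + ε ^ 2 * ‖lineVar α v‖ ^ 2) / ‖lineVar α v‖ ^ 2) := by
          have := hn.norm_le v
          gcongr
      _ = C * ε ^ 2 := by
          have h1 := (hx0 v).ne'
          have h2 := (hY v).ne'
          field_simp
  have hlow : ∀ v, ‖derivSym α v * (cutSym α ε v * n v)‖ ≤ C / ‖lineVar α v‖ := fun v => by
    rw [norm_mul, norm_mul, norm_cutSym, norm_derivSym]
    calc ‖lineVar α v‖ * ((1 + ε ^ 2 * ‖lineVar α v‖ ^ 2)⁻¹ * ‖n v‖)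
        ≤ ‖lineVar α v‖ * ((1 + ε ^ 2 * ‖lineVar α v‖ ^ 2)⁻¹ *
          (C * (1 + ε ^ 2 * ‖lineVar α v‖ ^ 2) / ‖lineVar α v‖ ^ 2)) := by
          have := hn.norm_le v
          gcongr
      _ = C / ‖lineVar α v‖ := by
          have h1 := (hx0 v).ne'
          have h2 := (hY v).ne'
          field_simp
  have hlowA : ∀ v, ‖derivSym α v * (cutSym α ε v * n v)‖ ≤ C * (1 + α⁻¹) ^ 2 := fun v =>
    (hlow v).trans (div_le_mul_of_le hα (le_norm_lineVar α v) hC).1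
  have blow : IsBddSymbol fun v => derivSym α v * (cutSym α ε v * n v) :=
    ⟨md.mul (mc.mul hn.meas), _, hlowA⟩
  -- Only qualitative boundedness is used here: the bound for `iξ n` may depend on `ε` and `Λ`, but
  -- it never enters the estimate.
  have bdhigh : IsBddSymbol fun v => derivSym α v * ((1 - cutSym α ε v) * n v) := by
    convert hn.bdd_deriv.sub blow using 2 with v
    ring
  have hsplit : (fmul fun v => derivSym α v * n v) =
      (fmul fun v => derivSym α v * (cutSym α ε v * n v)) +
        fmul fun v => derivSym α v * ((1 - cutSym α ε v) * n v) := by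
    rw [← fmul_add blow bdhigh]
    congr 1
    funext v
    ring
  -- After integration by parts the bound `K/ε` for `∂B` meets the bound `Cε²` for the
  -- high-frequency part of `N`.
  have hrem : ‖fmul B * (mulL2 θ * fmul fun v => derivSym α v * ((1 - cutSym α ε v) * n v))‖ ≤
      2 * (K * M * C) * ε := by
    rw [fmul_mul_mulL2_mul_fmul hα hθ.mult bdhigh hB.isBddSymbol_deriv]
    refine (norm_sub_le _ _).trans ?_
    have h1 := norm_mul_mul_le (norm_fmul_le hB.norm_deriv_le) hθ.norm_le (norm_fmul_le hhigh)
    have h2 := norm_mul_mul_le (norm_fmul_le hB.norm_le) hθ.norm_le' (norm_fmul_le hhigh)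
    have h3 : K / ε * (M * (C * ε ^ 2)) = K * M * C * ε := by field_simp
    have h4 : K * (M * (C * ε ^ 2)) ≤ K * M * C * ε := by
      have : K * M * C * (ε * ε) ≤ K * M * C * (1 * ε) := by gcongr
      nlinarith
    linarith
  have hδ : ∀ v, ‖derivSym α v * (cutSym α ε v * n v) - derivSym α v * n₀ v‖ ≤
      3 * C * √ε := fun v => by
    refine norm_cut_sub_le hε hε1 (hx0 v) hC (hn.norm_le v) (hn.norm₀_le v) (hn.norm_sub_le v)
      (norm_nonneg _) (norm_nonneg _) ?_ ?_
    · refine (norm_sub_le _ _).trans_eq ?_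
      rw [norm_mul, norm_mul, norm_mul, norm_cutSym, norm_derivSym, mul_assoc]
    · rw [show derivSym α v * (cutSym α ε v * n v) - derivSym α v * n₀ v =
        derivSym α v * cutSym α ε v * (n v - n₀ v) -
          (1 - cutSym α ε v) * (derivSym α v * n₀ v) by ring]
      refine (norm_sub_le _ _).trans_eq ?_
      rw [norm_mul, norm_mul, norm_mul, norm_mul, norm_cutSym, norm_derivSym, norm_one_sub_cutSym]
  -- Removing `B` costs one more derivative on `∂N₀`; order `-2` of `n₀` is exactly enough.
  have hd2 : ∀ v, ‖derivSym α v * (derivSym α v * n₀ v)‖ ≤ C * (1 + α⁻¹) ^ 2 := fun v => by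
    rw [norm_mul, norm_derivSym]
    calc ‖lineVar α v‖ * ‖derivSym α v * n₀ v‖ ≤ ‖lineVar α v‖ * (C / ‖lineVar α v‖) := by
          have := hn.norm_deriv₀_le hα v
          gcongr
      _ = C * 1 := by
          have h1 := (hx0 v).ne'
          field_simp
      _ ≤ C * (1 + α⁻¹) ^ 2 := mul_le_mul_of_nonneg_left hA hC
  have hmain := norm_fmul_mul_sub_le hα hB hθ.mult₀ hθ.norm₀_le hθ.norm₀'_le hθ.norm_sub_le
    blow.1 (md.mul hn.meas₀) hlowA (fun v => (hn.norm_deriv₀_le hα v).trans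
      (div_le_mul_of_le hα (le_norm_lineVar α v) hC).1) hd2 hδ
  rw [hsplit, mul_add, mul_add, add_sub_right_comm]
  refine (norm_add_le _ _).trans ((add_le_add hmain hrem).trans ?_)
  set A := (1 + α⁻¹) ^ 2
  have hKC : 0 ≤ K * C := mul_nonneg hK hC
  have hKCM : 0 ≤ K * C * M := mul_nonneg hKC hM0
  have hs := Real.sqrt_nonneg ε
  have t1 : K * C * τ * A ≤ K * C * (1 + M) * A * τ := by
    have : 0 ≤ K * C * M * A * τ := by positivity
    nlinarith
  have t2 : K * C * M * √ε ≤ K * C * (1 + M) * A * √ε := by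
    have : K * C * M * √ε * 1 ≤ K * C * M * √ε * A :=
      mul_le_mul_of_nonneg_left hA (by positivity)
    have : 0 ≤ K * C * A * √ε := by positivity
    nlinarith
  have t3 : K * C * M * A * ε ≤ K * C * (1 + M) * A * √ε := by
    have : K * C * M * A * ε ≤ K * C * M * A * √ε := mul_le_mul_of_nonneg_left he (by positivity)
    have : 0 ≤ K * C * A * √ε := by positivity
    nlinarith
  have t6 : K * C * M * ε ≤ K * C * M * √ε := mul_le_mul_of_nonneg_left he hKCM
  have t4 : 0 ≤ K * C * (1 + M) * A * τ := by positivity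
  have t5 : 0 ≤ K * C * (1 + M) * A * √ε := by positivity
  nlinarith

end Convergence

/-! ## Estimates for the symbol `Ŝ` near the real axis -/

theorem complexSqrt_sq (w : ℂ) : Complex.sqrt w ^ 2 = w := by
  rw [Complex.sqrt]
  exact Complex.cpow_nat_inv_pow w two_ne_zero

theorem complexSqrt_re_nonneg (w : ℂ) : 0 ≤ (Complex.sqrt w).re := by
  rw [Complex.sqrt, Complex.cpow_inv_two_re]
  exact Real.sqrt_nonneg _

/-- The strip in which the symbol `Ŝ` is controlled. -/
structure InStrip (a b : ℝ) (ζ : ℂ) : Prop where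
  pos : 0 < a
  lt : a < b
  im_pos : 0 < ζ.im
  small : b * ζ.im ^ 2 ≤ 1 / 4
  small' : (b - a) * ζ.im ^ 2 ≤ √(a / b)

namespace InStrip

variable {a b : ℝ} {ζ : ℂ}

theorem b_pos (h : InStrip a b ζ) : 0 < b := h.pos.trans h.lt

theorem den_re (ζ : ℂ) (b : ℝ) : (1 + b * ζ ^ 2 : ℂ).re = 1 + b * (ζ.re ^ 2 - ζ.im ^ 2) := by
  simp [sq]

theorem den_im (ζ : ℂ) (b : ℝ) : (1 + b * ζ ^ 2 : ℂ).im = 2 * b * ζ.re * ζ.im := by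
  simp [sq]
  ring

theorem le_den_re (h : InStrip a b ζ) : 1 / 2 + b * ‖ζ‖ ^ 2 ≤ (1 + b * ζ ^ 2 : ℂ).re := by
  rw [den_re, Complex.sq_norm, Complex.normSq_apply]
  nlinarith [h.small]

theorem le_norm_den (h : InStrip a b ζ) : 1 / 2 + b * ‖ζ‖ ^ 2 ≤ ‖(1 + b * ζ ^ 2 : ℂ)‖ :=
  h.le_den_re.trans (Complex.re_le_norm _)

theorem den_ne_zero (h : InStrip a b ζ) : (1 + b * ζ ^ 2 : ℂ) ≠ 0 := by
  rw [← norm_pos_iff]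
  have := h.le_norm_den
  have := h.b_pos
  have : 0 ≤ b * ‖ζ‖ ^ 2 := by positivity
  linarith

theorem symS_sq (a b : ℝ) (ζ : ℂ) : symS a b ζ ^ 2 = (1 + a * ζ ^ 2) / (1 + b * ζ ^ 2) :=
  complexSqrt_sq _

theorem symS_sq_mul (h : InStrip a b ζ) :
    symS a b ζ ^ 2 * (1 + b * ζ ^ 2) = 1 + a * ζ ^ 2 := by
  rw [symS_sq, div_mul_cancel₀ _ h.den_ne_zero]

theorem sqrt_pos (h : InStrip a b ζ) : 0 < √(a / b) :=
  Real.sqrt_pos.2 (div_pos h.pos h.b_pos)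

/-- Algebraic relations between `Ŝ = u + iv`, `D = Re (1 + bζ²)` and `P = |1 + bζ²|²`. -/
theorem exists_parts (h : InStrip a b ζ) : ∃ u v D P : ℝ, u = (symS a b ζ).re ∧
    v = (symS a b ζ).im ∧ 3 / 4 + b * ζ.re ^ 2 ≤ D ∧ D ≤ 1 + b * ζ.re ^ 2 ∧
    1 - b * ζ.im ^ 2 ≤ D ∧ D ^ 2 ≤ P ∧ P ≤ 7 / 3 * D ^ 2 ∧ √(a / b) ≤ u ∧
    b * ((u ^ 2 - v ^ 2) * P) = a * P + (b - a) * D ∧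
    u * v * P = -((b - a) * ζ.re * ζ.im) ∧
    (b - a) * (D * (ζ.re ^ 2 - ζ.im ^ 2)) ≤ (1 - (u ^ 2 - v ^ 2)) * P := by
  have hb := h.b_pos
  have hg := sub_pos.2 h.lt
  have hsm := h.small
  have hmul := h.symS_sq_mul
  have hre := congrArg Complex.re hmul
  have him := congrArg Complex.im hmul
  rw [Complex.mul_re, den_re, den_im, den_re, sq (symS a b ζ), Complex.mul_re,
    Complex.mul_im] at hre
  rw [Complex.mul_im, den_re, den_im, den_im, sq (symS a b ζ), Complex.mul_re,
    Complex.mul_im] at him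
  have hu0 : 0 ≤ (symS a b ζ).re := complexSqrt_re_nonneg _
  set u := (symS a b ζ).re
  set v := (symS a b ζ).im
  set η := ζ.re
  set σ := ζ.im
  have hbη : 0 ≤ b * η ^ 2 := by positivity
  have hbσ : 0 ≤ b * σ ^ 2 := by positivity
  obtain ⟨D, hD⟩ : ∃ D, D = 1 + b * (η ^ 2 - σ ^ 2) := ⟨_, rfl⟩
  obtain ⟨P, hP⟩ : ∃ P, P = D ^ 2 + (2 * b * η * σ) ^ 2 := ⟨_, rfl⟩
  rw [← hD] at hre him
  have hD' : 3 / 4 + b * η ^ 2 ≤ D := by rw [hD]; linarith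
  have e1 : b * ((u ^ 2 - v ^ 2) * P) = a * P + (b - a) * D := by
    rw [hP]
    linear_combination (b * D) * hre + (b * (2 * b * η * σ)) * him - (a * D) * hD
  have e2 : u * v * P = -((b - a) * η * σ) := by
    rw [hP]
    linear_combination (D / 2) * him - ((2 * b * η * σ) / 2) * hre +
      (a * η * σ) * hD
  have hDP : D ^ 2 ≤ P := by rw [hP]; linarith [sq_nonneg (2 * b * η * σ)]
  have hPpos : 0 < P := lt_of_lt_of_le (by nlinarith) hDP
  have e3 : P - D = b * (D * (η ^ 2 - σ ^ 2) + 4 * b * η ^ 2 * σ ^ 2) := by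
    rw [hP]
    linear_combination D * hD
  refine ⟨u, v, D, P, rfl, rfl, hD', by rw [hD]; linarith, by rw [hD]; linarith, hDP, ?_, ?_, e1,
    e2, ?_⟩
  -- Since `bσ² ≤ 1/4`, one has `(Im (1 + bζ²))² ≤ bη²`, and this is at most `(4/3)D²` because `D ≥
  -- 3/4 + bη²`.
  · have h1 : (b * η ^ 2) * (b * σ ^ 2) ≤ (b * η ^ 2) * (1 / 4) :=
      mul_le_mul_of_nonneg_left hsm hbη
    have h2 : (2 * b * η * σ) ^ 2 = 4 * ((b * η ^ 2) * (b * σ ^ 2)) := by ring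
    rw [hP, h2]
    nlinarith
  -- As `D > 0`, relation `e1` gives `Re Ŝ² ≥ a/b`; the principal branch has `u ≥ 0`, so `u ≥
  -- √(a/b)`.
  · have hp : a / b ≤ u ^ 2 - v ^ 2 := by
      rw [div_le_iff₀ hb]
      have h1 : 0 < (b - a) * D := mul_pos hg (by linarith)
      by_contra hc
      push Not at hc
      nlinarith [mul_lt_mul_of_pos_right hc hPpos]
    rw [Real.sqrt_le_left hu0]
    nlinarith [sq_nonneg v]
  · have h1 : b * ((1 - (u ^ 2 - v ^ 2)) * P) =
        b * ((b - a) * (D * (η ^ 2 - σ ^ 2) + 4 * b * η ^ 2 * σ ^ 2)) := by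
      linear_combination (b - a) * e3 - e1
    rw [mul_left_cancel₀ hb.ne' h1]
    apply mul_le_mul_of_nonneg_left _ hg.le
    have : 0 ≤ 4 * b * η ^ 2 * σ ^ 2 := by positivity
    linarith

theorem sqrt_le_re (h : InStrip a b ζ) : √(a / b) ≤ (symS a b ζ).re := by
  obtain ⟨u, v, D, P, rfl, -, -, -, -, -, -, hu, -⟩ := h.exists_parts
  exact hu

theorem sqrt_le_norm (h : InStrip a b ζ) : √(a / b) ≤ ‖symS a b ζ‖ :=
  h.sqrt_le_re.trans (Complex.re_le_norm _)

theorem symS_ne_zero (h : InStrip a b ζ) : symS a b ζ ≠ 0 :=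
  norm_pos_iff.1 (h.sqrt_pos.trans_le h.sqrt_le_norm)

/-- In the notation of `exists_parts`, multiplying `Im (ζŜ)` by `uP > 0` gives `Im ζ · (u²P - (b -
a)(Re ζ)²)`. The bracket is nonnegative because `b u²P ≥ (b - a)D ≥ (b - a) b (Re ζ)²`. -/
theorem im_mul_symS_nonneg (h : InStrip a b ζ) : 0 ≤ (ζ * symS a b ζ).im := by
  obtain ⟨u, v, D, P, hu, hv, hD, -, -, hP, -, hu0, e1, e2, -⟩ := h.exists_parts
  rw [Complex.mul_im, ← hu, ← hv]
  have hb := h.b_pos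
  have hupos : 0 < u := h.sqrt_pos.trans_le hu0
  have hbη : 0 ≤ b * ζ.re ^ 2 := by positivity
  have hPpos : 0 < P := lt_of_lt_of_le (by nlinarith) hP
  have hg := sub_pos.2 h.lt
  have h1 : (b - a) * ζ.re ^ 2 ≤ u ^ 2 * P := by
    have h2 : (b - a) * (b * ζ.re ^ 2) ≤ (b - a) * D :=
      mul_le_mul_of_nonneg_left (by linarith) hg.le
    have h3 : 0 ≤ b * (v ^ 2 * P) := by positivity
    have h4 : 0 ≤ a * P := mul_nonneg h.pos.le hPpos.le
    have h5 : b * ((b - a) * ζ.re ^ 2) ≤ b * (u ^ 2 * P) := by nlinarith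
    exact le_of_mul_le_mul_left h5 hb
  have h6 : 0 ≤ (u * P) * (ζ.re * v + ζ.im * u) := by
    have : (u * P) * (ζ.re * v + ζ.im * u) = ζ.im * (u ^ 2 * P - (b - a) * ζ.re ^ 2) := by
      linear_combination ζ.re * e2
    rw [this]
    exact mul_nonneg h.im_pos.le (sub_nonneg.2 h1)
  exact nonneg_of_mul_nonneg_right h6 (mul_pos hupos hPpos)

/-- Drop the nonnegative term in `(Re ζ)²` from the last relation of `exists_parts` and use `P ≥ D²
≥ D(1 - b(Im ζ)²)`. -/
theorem one_sub_re_sq_ge (h : InStrip a b ζ) :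
    -((b - a) * ζ.im ^ 2 / (1 - b * ζ.im ^ 2)) ≤ 1 - (symS a b ζ ^ 2).re := by
  obtain ⟨u, v, D, P, hu, hv, hD, -, hD2, hP, -, hu0, -, -, hY⟩ := h.exists_parts
  rw [sq (symS a b ζ), Complex.mul_re, ← hu, ← hv, ← sq, ← sq]
  have hb := h.b_pos
  have hbη : 0 ≤ b * ζ.re ^ 2 := by positivity
  have hPpos : 0 < P := lt_of_lt_of_le (by nlinarith) hP
  have hg := sub_pos.2 h.lt
  have hden : 0 < 1 - b * ζ.im ^ 2 := by linarith [h.small]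
  obtain ⟨k, hk⟩ : ∃ k, k = (b - a) * ζ.im ^ 2 / (1 - b * ζ.im ^ 2) := ⟨_, rfl⟩
  have hk0 : 0 ≤ k := by rw [hk]; positivity
  have hk1 : k * (1 - b * ζ.im ^ 2) = (b - a) * ζ.im ^ 2 := by rw [hk, div_mul_cancel₀ _ hden.ne']
  rw [← hk]
  have h2 : D * (1 - b * ζ.im ^ 2) ≤ P := by
    have : D * (1 - b * ζ.im ^ 2) ≤ D * D := mul_le_mul_of_nonneg_left hD2 (by linarith)
    linarith
  have h3 := mul_le_mul_of_nonneg_left h2 hk0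
  have h4 : 0 ≤ (b - a) * (D * ζ.re ^ 2) :=
    mul_nonneg hg.le (mul_nonneg (by linarith) (sq_nonneg _))
  refine le_of_mul_le_mul_right ?_ hPpos
  linear_combination h3 + hY + h4 - D * hk1

/-- With `Ŝ = u + iv` the left factor `1 - u` equals `½ Re(1 - Ŝ²) + ½(1 - u)² - ½v²`. The negative
term `½v² Im ζ` is absorbed by `-v Re ζ ≥ 0`, and `Re(1 - Ŝ²)` is bounded below through `1 - Ŝ² = (b
- a)ζ²/(1 + bζ²)`. The term in `(Re ζ)²` is the source of coercivity; the term in `(Im ζ)²` becomes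
the loss `(b - a)α³` in the KdV rate `β`. -/
theorem im_mul_one_sub_symS_ge (h : InStrip a b ζ) :
    ζ.im * ((b - a) * ζ.re ^ 2 / (9 * (1 + b * ζ.re ^ 2)) -
      (b - a) * ζ.im ^ 2 / (2 * (1 - b * ζ.im ^ 2))) ≤ (ζ * (1 - symS a b ζ)).im := by
  obtain ⟨u, v, D, P, hu, hv, hD, hD1, hD2, hP, hP2, hu0, -, e2, hY⟩ := h.exists_parts
  rw [Complex.mul_im, Complex.sub_im, Complex.sub_re, Complex.one_re, Complex.one_im, ← hu, ← hv]
  have hb := h.b_pos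
  have hs := h.im_pos
  have hbη : 0 ≤ b * ζ.re ^ 2 := by positivity
  have hPge : 1 / 2 ≤ P := le_trans (by nlinarith) hP
  have hupos : 0 < u := h.sqrt_pos.trans_le hu0
  have hPpos : 0 < P := by linarith
  have hg := sub_pos.2 h.lt
  have hden : 0 < 1 - b * ζ.im ^ 2 := by linarith [h.small]
  have hden' : 0 < 1 + b * ζ.re ^ 2 := by linarith
  obtain ⟨k, hk⟩ : ∃ k, k = (b - a) * ζ.im ^ 2 / (1 - b * ζ.im ^ 2) := ⟨_, rfl⟩
  have hk0 : 0 ≤ k := by rw [hk]; positivity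
  have hk1 : k * (1 - b * ζ.im ^ 2) = (b - a) * ζ.im ^ 2 := by rw [hk, div_mul_cancel₀ _ hden.ne']
  obtain ⟨j, hj⟩ : ∃ j, j = (b - a) * ζ.re ^ 2 / (1 + b * ζ.re ^ 2) := ⟨_, rfl⟩
  have hj0 : 0 ≤ j := by rw [hj]; positivity
  have hj1 : j * (1 + b * ζ.re ^ 2) = (b - a) * ζ.re ^ 2 := by
    rw [hj, div_mul_cancel₀ _ hden'.ne']
  have hj2 : (b - a) * ζ.re ^ 2 / (9 * (1 + b * ζ.re ^ 2)) = j / 9 := by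
    rw [hj, div_div, mul_comm 9]
  have hk2 : (b - a) * ζ.im ^ 2 / (2 * (1 - b * ζ.im ^ 2)) = k / 2 := by
    rw [hk, div_div, mul_comm 2]
  rw [hj2, hk2]
  have hDpos : 0 < D := by linarith
  -- The coefficient `3/7` is the reciprocal of the factor in `P ≤ 7/3 D²`.
  have hYge : 3 / 7 * j - k ≤ 1 - (u ^ 2 - v ^ 2) := by
    refine le_of_mul_le_mul_right ?_ hPpos
    have h2 : D * (1 - b * ζ.im ^ 2) ≤ P := by
      have : D * (1 - b * ζ.im ^ 2) ≤ D * D := mul_le_mul_of_nonneg_left hD2 hDpos.le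
      linarith
    have h3 := mul_le_mul_of_nonneg_left h2 hk0
    have h4 : P ≤ 7 / 3 * (D * (1 + b * ζ.re ^ 2)) := by
      have : D * D ≤ D * (1 + b * ζ.re ^ 2) := mul_le_mul_of_nonneg_left hD1 hDpos.le
      linarith
    have h5 := mul_le_mul_of_nonneg_left h4 hj0
    linear_combination (3 / 7) * h5 + h3 + hY + D * hj1 - D * hk1
  obtain ⟨t, ht⟩ : ∃ t, t = -(ζ.re * v) := ⟨_, rfl⟩
  have ht1 : (u * P) * t = ζ.im * ((b - a) * ζ.re ^ 2) := by
    rw [ht]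
    linear_combination (-ζ.re) * e2
  have hup : 0 < u * P := mul_pos hupos hPpos
  have ht0 : 0 ≤ t := by
    refine nonneg_of_mul_nonneg_right (a := u * P) ?_ hup
    rw [ht1]
    positivity
  -- From `uvP = -(b - a) Re ζ Im ζ` follows `uP v² = (b - a) (Im ζ) t`; the strip condition
  -- `small'` with `u ≥ √(a/b)` and `P ≥ 1/2` bounds the coefficient.
  have hv2 : v ^ 2 * ζ.im ≤ 2 * t := by
    have h1 : (u * P) * v ^ 2 = (b - a) * ζ.im * t := by
      rw [ht]
      linear_combination v * e2
    refine le_of_mul_le_mul_left (a := u * P) ?_ hup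
    have h2 : (b - a) * ζ.im ^ 2 ≤ 2 * (u * P) := by
      have h3 := h.small'
      have h4 : u * (1 / 2) ≤ u * P := mul_le_mul_of_nonneg_left hPge hupos.le
      linarith
    have h3 := mul_le_mul_of_nonneg_right h2 ht0
    linear_combination ζ.im * h1 + h3
  have hfin : 0 ≤ ζ.im * (1 - u) ^ 2 := by positivity
  have h7 := mul_le_mul_of_nonneg_left hYge hs.le
  have h8 := mul_nonneg hs.le hj0
  rw [show ζ.re * (0 - v) = t by rw [ht]; ring]
  linear_combination (1 / 2) * h7 + (1 / 2) * hv2 + (1 / 2) * hfin + (3 / 14 - 1 / 9) * h8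

theorem one_le_norm_one_add (h : InStrip a b ζ) : 1 ≤ ‖1 + symS a b ζ‖ := by
  refine le_trans ?_ (Complex.re_le_norm _)
  rw [Complex.add_re, Complex.one_re]
  linarith [h.sqrt_pos, h.sqrt_le_re]

/-- Writing `1 - Ŝ = (1 - Ŝ²)/(1 + Ŝ)` avoids all branch questions; the factor `1 + Ŝ` has norm at
least 1. -/
theorem one_sub_symS_mul (h : InStrip a b ζ) :
    (1 - symS a b ζ) * ((1 + symS a b ζ) * (1 + b * ζ ^ 2)) = ((b - a : ℝ) : ℂ) * ζ ^ 2 := by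
  have := h.symS_sq_mul
  push_cast
  linear_combination -this

theorem half_add_pos (h : InStrip a b ζ) : 0 < 1 / 2 + b * ‖ζ‖ ^ 2 := by
  have := h.b_pos
  positivity

theorem norm_one_sub_symS_le (h : InStrip a b ζ) :
    ‖1 - symS a b ζ‖ ≤ (b - a) * ‖ζ‖ ^ 2 / (1 / 2 + b * ‖ζ‖ ^ 2) := by
  have h1 := congrArg norm h.one_sub_symS_mul
  have hg := sub_pos.2 h.lt
  rw [norm_mul, norm_mul, norm_mul, norm_pow, Complex.norm_real, Real.norm_of_nonneg hg.le] at h1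
  rw [le_div_iff₀ h.half_add_pos, ← h1]
  refine mul_le_mul_of_nonneg_left ?_ (norm_nonneg _)
  calc 1 / 2 + b * ‖ζ‖ ^ 2 ≤ 1 * ‖(1 + b * ζ ^ 2 : ℂ)‖ := by
        rw [one_mul]
        exact h.le_norm_den
    _ ≤ _ := mul_le_mul_of_nonneg_right h.one_le_norm_one_add (norm_nonneg _)

theorem norm_symS_le (h : InStrip a b ζ) : ‖symS a b ζ‖ ≤ 2 := by
  have h1 : ‖1 - symS a b ζ‖ ≤ 1 := by
    refine h.norm_one_sub_symS_le.trans ?_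
    rw [div_le_one h.half_add_pos]
    have : 0 ≤ a * ‖ζ‖ ^ 2 := mul_nonneg h.pos.le (sq_nonneg _)
    linarith
  have h2 := norm_sub_norm_le (symS a b ζ) 1
  rw [norm_sub_rev, norm_one] at h2
  linarith

/-- Multiplying the remainder by `(1 + Ŝ)(1 + bζ²)` leaves `(b - a)ζ²/2` times `(1 - Ŝ) - bζ²(1 +
Ŝ)`, which is again `O(|ζ|²)`. Keeping the denominator limits the growth at infinity to `|ζ|²`. -/
theorem norm_one_sub_symS_sub_le (h : InStrip a b ζ) :
    ‖1 - symS a b ζ - ((b - a : ℝ) : ℂ) * ζ ^ 2 / 2‖ ≤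
      5 * b * (b - a) * ‖ζ‖ ^ 4 / (1 / 2 + b * ‖ζ‖ ^ 2) := by
  have hg := sub_pos.2 h.lt
  have hb := h.b_pos
  have h1 : (1 - symS a b ζ - ((b - a : ℝ) : ℂ) * ζ ^ 2 / 2) *
      ((1 + symS a b ζ) * (1 + b * ζ ^ 2)) = ((b - a : ℝ) : ℂ) * ζ ^ 2 / 2 *
        ((1 - symS a b ζ) - b * ζ ^ 2 * (1 + symS a b ζ)) := by
    linear_combination h.one_sub_symS_mul
  have h2 : ‖(1 - symS a b ζ) - b * ζ ^ 2 * (1 + symS a b ζ)‖ ≤ 5 * b * ‖ζ‖ ^ 2 := by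
    refine (norm_sub_le _ _).trans ?_
    rw [norm_mul, norm_mul, norm_pow, Complex.norm_real, Real.norm_of_nonneg hb.le]
    have h3 : ‖1 - symS a b ζ‖ ≤ 2 * b * ‖ζ‖ ^ 2 := by
      refine h.norm_one_sub_symS_le.trans ?_
      rw [div_le_iff₀ h.half_add_pos]
      have : 0 ≤ a * ‖ζ‖ ^ 2 := mul_nonneg h.pos.le (sq_nonneg _)
      have : 0 ≤ 2 * b * ‖ζ‖ ^ 2 * (b * ‖ζ‖ ^ 2) := by positivity
      linarith
    have h4 : ‖1 + symS a b ζ‖ ≤ 3 := by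
      refine (norm_add_le _ _).trans ?_
      rw [norm_one]
      linarith [h.norm_symS_le]
    have h5 := mul_le_mul_of_nonneg_left h4 (show 0 ≤ b * ‖ζ‖ ^ 2 by positivity)
    linarith
  have h6 := congrArg norm h1
  rw [norm_mul, norm_mul, norm_mul, norm_div, norm_mul, norm_pow, Complex.norm_real,
    Real.norm_of_nonneg hg.le, RCLike.norm_ofNat] at h6
  rw [le_div_iff₀ h.half_add_pos]
  calc ‖1 - symS a b ζ - ((b - a : ℝ) : ℂ) * ζ ^ 2 / 2‖ * (1 / 2 + b * ‖ζ‖ ^ 2)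
      ≤ ‖1 - symS a b ζ - ((b - a : ℝ) : ℂ) * ζ ^ 2 / 2‖ *
        (‖1 + symS a b ζ‖ * ‖(1 + b * ζ ^ 2 : ℂ)‖) := by
        refine mul_le_mul_of_nonneg_left ?_ (norm_nonneg _)
        calc 1 / 2 + b * ‖ζ‖ ^ 2 ≤ 1 * ‖(1 + b * ζ ^ 2 : ℂ)‖ := by
              rw [one_mul]
              exact h.le_norm_den
          _ ≤ _ := mul_le_mul_of_nonneg_right h.one_le_norm_one_add (norm_nonneg _)
    _ ≤ (b - a) * ‖ζ‖ ^ 2 / 2 * (5 * b * ‖ζ‖ ^ 2) := by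
        rw [h6]
        exact mul_le_mul_of_nonneg_left h2 (by positivity)
    _ ≤ 5 * b * (b - a) * ‖ζ‖ ^ 4 := by
        have : 0 ≤ b * (b - a) * ‖ζ‖ ^ 4 := by positivity
        linarith

/-- Factor `c² - Ŝ² = (c - Ŝ)(c + Ŝ)`, bound the product below by its real part and the second
factor above by `c + 2`. -/
theorem le_norm_sub_symS (h : InStrip a b ζ) {c : ℝ} (hc : 0 ≤ c) :
    (c ^ 2 - 1 - (b - a) * ζ.im ^ 2 / (1 - b * ζ.im ^ 2)) / (c + 2) ≤ ‖c - symS a b ζ‖ := by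
  have h1 : c ^ 2 - (symS a b ζ ^ 2).re ≤ ‖c - symS a b ζ‖ * ‖c + symS a b ζ‖ := by
    rw [← norm_mul]
    refine le_trans (le_of_eq ?_) (Complex.re_le_norm _)
    rw [show (c - symS a b ζ) * (c + symS a b ζ) = ((c ^ 2 : ℝ) : ℂ) - symS a b ζ ^ 2 by
      push_cast; ring, Complex.sub_re, Complex.ofReal_re]
  have h2 : ‖c + symS a b ζ‖ ≤ c + 2 := by
    refine (norm_add_le _ _).trans ?_
    rw [Complex.norm_real, Real.norm_of_nonneg hc]
    linarith [h.norm_symS_le]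
  rw [div_le_iff₀ (by linarith)]
  have h3 := mul_le_mul_of_nonneg_left h2 (norm_nonneg (c - symS a b ζ))
  linarith [h.one_sub_re_sq_ge]

theorem le_norm_add_symS (h : InStrip a b ζ) (c : ℝ) :
    c ≤ ‖c + symS a b ζ‖ := by
  refine le_trans ?_ (Complex.re_le_norm _)
  rw [Complex.add_re, Complex.ofReal_re]
  linarith [h.sqrt_pos, h.sqrt_le_re]

end InStrip

/-! ## The rescaled resolvent symbols -/

/-- The symbol of `Λ - 2ε⁻³ 𝒬₋` at the frequency `εξ`, for `c = 1 + ε²/2`. -/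
def denMinus (a b ε : ℝ) (Lam ξ : ℂ) : ℂ :=
  Lam - 2 / (ε : ℂ) ^ 3 * symQminus a b (1 + ε ^ 2 / 2) (ε * ξ)

/-- The symbol of `Λ - 2ε⁻³ 𝒬₊` at the frequency `εξ`, for `c = 1 + ε²/2`. -/
def denPlus (a b ε : ℝ) (Lam ξ : ℂ) : ℂ :=
  Lam - 2 / (ε : ℂ) ^ 3 * symQplus a b (1 + ε ^ 2 / 2) (ε * ξ)

/-- The symbol of `Λ - ∂ + (b - a)∂³`. -/
def denKdV (a b : ℝ) (Lam ξ : ℂ) : ℂ :=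
  Lam - Complex.I * ξ + ((b - a : ℝ) : ℂ) * (Complex.I * ξ) ^ 3

theorem measurable_symS (a b : ℝ) : Measurable (symS a b) := by
  unfold symS Complex.sqrt
  fun_prop

theorem measurable_denMinus (a b ε : ℝ) (Lam : ℂ) : Measurable (denMinus a b ε Lam) := by
  have := measurable_symS a b
  unfold denMinus symQminus
  fun_prop

theorem measurable_denPlus (a b ε : ℝ) (Lam : ℂ) : Measurable (denPlus a b ε Lam) := by
  have := measurable_symS a b
  unfold denPlus symQplus
  fun_prop

theorem measurable_denKdV (a b : ℝ) (Lam : ℂ) : Measurable (denKdV a b Lam) := by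
  unfold denKdV
  fun_prop

/-- Standing assumptions: the weight is subcritical and `ε` is small. -/
structure SmallParam (a b α β ε : ℝ) : Prop where
  a_pos : 0 < a
  lt : a < b
  α_pos : 0 < α
  subcritical : (b - a) * α ^ 2 < 1
  β_eq : β = α * (1 - (b - a) * α ^ 2)
  ε_pos : 0 < ε
  ε_le : ε ≤ 1
  small : b * (ε * α) ^ 2 ≤ 1 / 4
  small' : (b - a) * (ε * α) ^ 2 ≤ √(a / b)
  small'' : b * (ε * α) ^ 2 * ((b - a) * α ^ 3 + β / 4) ≤ β / 4

namespace SmallParam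

variable {a b α β ε : ℝ} {Lam ξ : ℂ}

theorem b_pos (h : SmallParam a b α β ε) : 0 < b := h.a_pos.trans h.lt

theorem β_pos (h : SmallParam a b α β ε) : 0 < β := by
  rw [h.β_eq]
  exact mul_pos h.α_pos (sub_pos.2 h.subcritical)

theorem inStrip (h : SmallParam a b α β ε) (hξ : ξ.im = α) : InStrip a b (ε * ξ) := by
  have hi : ((ε : ℂ) * ξ).im = ε * α := by simp [hξ]
  refine ⟨h.a_pos, h.lt, ?_, ?_, ?_⟩ <;> rw [hi]
  · exact mul_pos h.ε_pos h.α_pos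
  · exact h.small
  · exact h.small'

theorem sq_norm_eq (hξ : ξ.im = α) : ‖ξ‖ ^ 2 = ξ.re ^ 2 + α ^ 2 := by
  rw [Complex.sq_norm, Complex.normSq_apply, hξ]
  ring

theorem norm_scaled (h : SmallParam a b α β ε) : ‖(ε : ℂ) * ξ‖ = ε * ‖ξ‖ := by
  rw [norm_mul, Complex.norm_real, Real.norm_of_nonneg h.ε_pos.le]

theorem div_one_sub_le (h : SmallParam a b α β ε) :
    (b - a) * α ^ 3 / (1 - b * (ε * α) ^ 2) ≤ (b - a) * α ^ 3 + β / 4 := by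
  have h1 : 0 < 1 - b * (ε * α) ^ 2 := by linarith [h.small]
  rw [div_le_iff₀ h1]
  linarith [h.small'']

/-- The real part is `Re Λ + α + 2ε⁻³ Im(εξ(1 - Ŝ(εξ)))`. The strip estimate costs `(b - a)α³/(1 -
b(εα)²)`, at most `(b - a)α³ + β/4` for small `ε`. Since `α - (b - a)α³ = β` and `Re Λ ≥ -β/2`, the
remaining constant is `β/4`. -/
theorem re_denMinus_ge (h : SmallParam a b α β ε) (hξ : ξ.im = α) (hL : -β / 2 ≤ Lam.re) :
    β / 4 + 2 * α * (b - a) / 9 * (ξ.re ^ 2 / (1 + b * (ε * ξ.re) ^ 2)) ≤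
      (denMinus a b ε Lam ξ).re := by
  have hε := h.ε_pos
  have hi : ((ε : ℂ) * ξ).im = ε * α := by simp [hξ]
  have hr : ((ε : ℂ) * ξ).re = ε * ξ.re := by simp
  have hE := (h.inStrip hξ).im_mul_one_sub_symS_ge
  rw [hi, hr] at hE
  set S := symS a b (ε * ξ) with hS
  have e1 : denMinus a b ε Lam ξ = Lam - (Complex.I * ξ +
      ((2 / ε ^ 3 : ℝ) : ℂ) * (Complex.I * ((ε * ξ) * (1 - S)))) := by
    have : (ε : ℂ) ≠ 0 := by exact_mod_cast hε.ne'
    rw [denMinus, symQminus, ← hS]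
    push_cast
    field_simp
    ring
  have e2 : (denMinus a b ε Lam ξ).re = Lam.re + α + 2 / ε ^ 3 * ((ε * ξ) * (1 - S)).im := by
    rw [e1, Complex.sub_re, Complex.add_re, Complex.re_ofReal_mul, Complex.I_mul_re,
      Complex.I_mul_re, hξ]
    ring
  have e3 : 2 / ε ^ 3 * (ε * α * ((b - a) * (ε * ξ.re) ^ 2 / (9 * (1 + b * (ε * ξ.re) ^ 2)) -
      (b - a) * (ε * α) ^ 2 / (2 * (1 - b * (ε * α) ^ 2)))) =
      2 * α * (b - a) / 9 * (ξ.re ^ 2 / (1 + b * (ε * ξ.re) ^ 2)) -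
        (b - a) * α ^ 3 / (1 - b * (ε * α) ^ 2) := by
    have hb := h.b_pos
    have h1 : 1 - b * (ε * α) ^ 2 ≠ 0 := by linarith [h.small]
    have h2 : 1 + b * (ε * ξ.re) ^ 2 ≠ 0 := by positivity
    field_simp
  have e4 := mul_le_mul_of_nonneg_left hE (show 0 ≤ 2 / ε ^ 3 by positivity)
  rw [e3] at e4
  rw [e2]
  have h5 := h.div_one_sub_le
  have h6 : α - (b - a) * α ^ 3 = β := by rw [h.β_eq]; ring
  linarith

/-- A lower bound for the resolvent denominators, up to the frequency weight. -/
def coerc (a b α β : ℝ) : ℝ := min (β / (4 * α ^ 2)) (2 * α * (b - a) / (9 * (1 + b)))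

theorem coerc_pos (h : SmallParam a b α β ε) : 0 < coerc a b α β := by
  have := h.β_pos
  have := h.α_pos
  have := h.b_pos
  have := sub_pos.2 h.lt
  exact lt_min (by positivity) (by positivity)

theorem norm_denMinus_ge (h : SmallParam a b α β ε) (hξ : ξ.im = α) (hL : -β / 2 ≤ Lam.re) :
    coerc a b α β * ‖ξ‖ ^ 2 / (1 + ε ^ 2 * ‖ξ‖ ^ 2) ≤ ‖denMinus a b ε Lam ξ‖ := by
  refine le_trans ?_ ((h.re_denMinus_ge hξ hL).trans (Complex.re_le_norm _))
  have hc := h.coerc_pos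
  have hβ := h.β_pos
  have hα := h.α_pos
  have hb := h.b_pos
  have hg := sub_pos.2 h.lt
  have hε := h.ε_pos
  -- On the line `|ξ|² = (Re ξ)² + α²`. The two entries of the minimum in `coerc` pay for the two
  -- summands: the constant `β/4` covers `α²`, the dispersive term covers `(Re ξ)²`.
  have c1 : coerc a b α β * α ^ 2 ≤ β / 4 := by
    calc coerc a b α β * α ^ 2 ≤ β / (4 * α ^ 2) * α ^ 2 := by
          gcongr
          exact min_le_left _ _
      _ = β / 4 := by field_simp
  have c2 : coerc a b α β * (1 + b) ≤ 2 * α * (b - a) / 9 := by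
    calc coerc a b α β * (1 + b) ≤ 2 * α * (b - a) / (9 * (1 + b)) * (1 + b) := by
          gcongr
          exact min_le_right _ _
      _ = 2 * α * (b - a) / 9 := by field_simp
  have hY : 1 ≤ 1 + ε ^ 2 * ‖ξ‖ ^ 2 := le_add_of_nonneg_right (by positivity)
  have hZ : 0 < 1 + b * (ε * ξ.re) ^ 2 := by positivity
  have d1 : coerc a b α β * α ^ 2 / (1 + ε ^ 2 * ‖ξ‖ ^ 2) ≤ β / 4 :=
    (div_le_self (by positivity) hY).trans c1
  have d2 : coerc a b α β * ξ.re ^ 2 / (1 + ε ^ 2 * ‖ξ‖ ^ 2) ≤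
      2 * α * (b - a) / 9 * (ξ.re ^ 2 / (1 + b * (ε * ξ.re) ^ 2)) := by
    calc coerc a b α β * ξ.re ^ 2 / (1 + ε ^ 2 * ‖ξ‖ ^ 2)
        ≤ coerc a b α β * (1 + b) * (ξ.re ^ 2 / (1 + b * (ε * ξ.re) ^ 2)) := by
          rw [div_le_iff₀ (by linarith), mul_assoc, mul_assoc]
          refine mul_le_mul_of_nonneg_left ?_ hc.le
          rw [div_mul_eq_mul_div, ← mul_div_assoc, le_div_iff₀ hZ,
            show (1 + b) * (ξ.re ^ 2 * (1 + ε ^ 2 * ‖ξ‖ ^ 2)) =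
              ξ.re ^ 2 * ((1 + b) * (1 + ε ^ 2 * ‖ξ‖ ^ 2)) by ring]
          refine mul_le_mul_of_nonneg_left ?_ (sq_nonneg _)
          rw [sq_norm_eq hξ]
          have : 0 ≤ ε ^ 2 * ξ.re ^ 2 := by positivity
          have : 0 ≤ (1 + b) * (ε ^ 2 * α ^ 2) := by positivity
          nlinarith
      _ ≤ _ := mul_le_mul_of_nonneg_right c2 (by positivity)
  have e : coerc a b α β * ‖ξ‖ ^ 2 / (1 + ε ^ 2 * ‖ξ‖ ^ 2) =
      coerc a b α β * α ^ 2 / (1 + ε ^ 2 * ‖ξ‖ ^ 2) +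
        coerc a b α β * ξ.re ^ 2 / (1 + ε ^ 2 * ‖ξ‖ ^ 2) := by
    rw [← add_div]
    congr 1
    rw [sq_norm_eq hξ]
    ring
  rw [e]
  exact add_le_add d1 d2

theorem le_norm_denMinus (h : SmallParam a b α β ε) (hξ : ξ.im = α) (hL : -β / 2 ≤ Lam.re) :
    β / 4 ≤ ‖denMinus a b ε Lam ξ‖ := by
  refine le_trans ?_ ((h.re_denMinus_ge hξ hL).trans (Complex.re_le_norm _))
  have := h.α_pos
  have := h.b_pos
  have := sub_pos.2 h.lt
  have : 0 ≤ 2 * α * (b - a) / 9 * (ξ.re ^ 2 / (1 + b * (ε * ξ.re) ^ 2)) := by positivity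
  linarith

/-- The waves of `𝒬₊` and the term `c∂` travel in the same direction, so `Im(ζŜ) ≥ 0` has the
favourable sign and the real part is at least `Re Λ + (2/ε² + 1)α`. -/
theorem le_norm_denPlus (h : SmallParam a b α β ε) (hξ : ξ.im = α) (hL : -β / 2 ≤ Lam.re) :
    α / ε ^ 2 ≤ ‖denPlus a b ε Lam ξ‖ := by
  refine le_trans ?_ (Complex.re_le_norm _)
  have hε := h.ε_pos
  have hα := h.α_pos
  have hE := (h.inStrip hξ).im_mul_symS_nonneg
  set S := symS a b (ε * ξ) with hS
  have e1 : denPlus a b ε Lam ξ = Lam - (((2 / ε ^ 2 + 1 : ℝ) : ℂ) * (Complex.I * ξ) +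
      ((2 / ε ^ 3 : ℝ) : ℂ) * (Complex.I * ((ε * ξ) * S))) := by
    have : (ε : ℂ) ≠ 0 := by exact_mod_cast hε.ne'
    rw [denPlus, symQplus, ← hS]
    push_cast
    field_simp
  have e2 : (denPlus a b ε Lam ξ).re =
      Lam.re + (2 / ε ^ 2 + 1) * α + 2 / ε ^ 3 * ((ε * ξ) * S).im := by
    rw [e1, Complex.sub_re, Complex.add_re, Complex.re_ofReal_mul, Complex.re_ofReal_mul,
      Complex.I_mul_re, Complex.I_mul_re, hξ]
    ring
  have h1 : 0 ≤ 2 / ε ^ 3 * ((ε * ξ) * S).im := mul_nonneg (by positivity) hE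
  have h2 : β ≤ α := by
    rw [h.β_eq]
    have := sub_pos.2 h.lt
    have : 0 ≤ α * ((b - a) * α ^ 2) := by positivity
    linarith
  have h3 : 0 ≤ α / ε ^ 2 := by positivity
  have h4 : (2 / ε ^ 2 + 1) * α = 2 * (α / ε ^ 2) + α := by ring
  rw [e2, h4]
  linarith

theorem re_denKdV (hξ : ξ.im = α) :
    (denKdV a b Lam ξ).re = Lam.re + α * (1 - (b - a) * α ^ 2) + 3 * (b - a) * α * ξ.re ^ 2 := by
  obtain ⟨k, hk⟩ : ∃ k, k = ξ.re := ⟨_, rfl⟩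
  have e : ξ = k + α * Complex.I := by
    rw [hk, ← hξ]
    exact (Complex.re_add_im ξ).symm
  have h2 : Complex.I * ξ = ((-α : ℝ) : ℂ) + (k : ℝ) * Complex.I := by
    rw [e]
    push_cast
    linear_combination (α : ℂ) * Complex.I_mul_I
  rw [denKdV, h2, ← hk]
  simp [pow_succ]
  ring

theorem norm_denKdV_ge (h : SmallParam a b α β ε) (hξ : ξ.im = α) (hL : -β / 2 ≤ Lam.re) :
    coerc a b α β * ‖ξ‖ ^ 2 ≤ ‖denKdV a b Lam ξ‖ := by
  refine le_trans ?_ (Complex.re_le_norm _)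
  rw [re_denKdV hξ, ← h.β_eq, sq_norm_eq hξ]
  have hα := h.α_pos
  have hb := h.b_pos
  have hβ := h.β_pos
  have hg := sub_pos.2 h.lt
  have c1 : coerc a b α β * α ^ 2 ≤ β / 4 := by
    calc coerc a b α β * α ^ 2 ≤ β / (4 * α ^ 2) * α ^ 2 := by
          gcongr
          exact min_le_left _ _
      _ = β / 4 := by field_simp
  have c2 : coerc a b α β ≤ 2 * α * (b - a) / 9 := by
    refine (min_le_right _ _).trans ?_
    gcongr
    linarith
  have c3 : coerc a b α β * ξ.re ^ 2 ≤ 2 * α * (b - a) / 9 * ξ.re ^ 2 := by gcongr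
  have : 0 ≤ α * (b - a) * ξ.re ^ 2 := by positivity
  nlinarith

/-- `Λ` cancels. The quadratic Taylor term of `1 - Ŝ(εξ)` reproduces the dispersion `(b - a)∂³`, and
the quartic remainder is multiplied by `2ε⁻²|ξ|`. -/
theorem norm_denMinus_sub_le (h : SmallParam a b α β ε) (hξ : ξ.im = α) :
    ‖denMinus a b ε Lam ξ - denKdV a b Lam ξ‖ ≤
      10 * b * (b - a) / min (1 / 2) b * (ε ^ 2 * ‖ξ‖ ^ 5 / (1 + ε ^ 2 * ‖ξ‖ ^ 2)) := by
  have hε := h.ε_pos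
  have hb := h.b_pos
  have hg := sub_pos.2 h.lt
  have hS := (h.inStrip hξ).norm_one_sub_symS_sub_le
  have e1 : denMinus a b ε Lam ξ - denKdV a b Lam ξ = -(((2 / ε ^ 2 : ℝ) : ℂ) * (Complex.I * ξ) *
      (1 - symS a b (ε * ξ) - ((b - a : ℝ) : ℂ) * (ε * ξ) ^ 2 / 2)) := by
    have h0 : (ε : ℂ) ≠ 0 := by exact_mod_cast hε.ne'
    have hI : Complex.I ^ 3 = -Complex.I := Complex.I_pow_three
    rw [denMinus, denKdV, symQminus, mul_pow Complex.I ξ 3, hI]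
    push_cast
    field_simp
    ring
  rw [h.norm_scaled] at hS
  have hm : 0 < min (1 / 2) b := lt_min (by norm_num) hb
  have hden : min (1 / 2) b * (1 + ε ^ 2 * ‖ξ‖ ^ 2) ≤ 1 / 2 + b * (ε * ‖ξ‖) ^ 2 := by
    have h1 : min (1 / 2) b ≤ 1 / 2 := min_le_left _ _
    have h2 : min (1 / 2) b * (ε ^ 2 * ‖ξ‖ ^ 2) ≤ b * (ε ^ 2 * ‖ξ‖ ^ 2) := by
      gcongr
      exact min_le_right _ _
    nlinarith
  rw [e1, norm_neg, norm_mul, norm_mul, norm_mul, Complex.norm_I, one_mul, Complex.norm_real,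
    Real.norm_of_nonneg (by positivity)]
  calc 2 / ε ^ 2 * ‖ξ‖ * ‖1 - symS a b (ε * ξ) - ((b - a : ℝ) : ℂ) * (ε * ξ) ^ 2 / 2‖
      ≤ 2 / ε ^ 2 * ‖ξ‖ * (5 * b * (b - a) * (ε * ‖ξ‖) ^ 4 /
        (min (1 / 2) b * (1 + ε ^ 2 * ‖ξ‖ ^ 2))) := by
        refine mul_le_mul_of_nonneg_left (hS.trans ?_) (by positivity)
        gcongr
    _ = _ := by field_simp; ring

theorem norm_one_sub_symS_scaled_le (h : SmallParam a b α β ε) (hξ : ξ.im = α) :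
    ‖1 - symS a b (ε * ξ)‖ ≤
      (b - a) / min (1 / 2) b * (ε ^ 2 * ‖ξ‖ ^ 2 / (1 + ε ^ 2 * ‖ξ‖ ^ 2)) := by
  have hb := h.b_pos
  have hg := sub_pos.2 h.lt
  have hS := (h.inStrip hξ).norm_one_sub_symS_le
  rw [h.norm_scaled] at hS
  have hm : 0 < min (1 / 2) b := lt_min (by norm_num) hb
  have hden : min (1 / 2) b * (1 + ε ^ 2 * ‖ξ‖ ^ 2) ≤ 1 / 2 + b * (ε * ‖ξ‖) ^ 2 := by
    have h1 : min (1 / 2) b ≤ 1 / 2 := min_le_left _ _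
    have h2 : min (1 / 2) b * (ε ^ 2 * ‖ξ‖ ^ 2) ≤ b * (ε ^ 2 * ‖ξ‖ ^ 2) := by
      gcongr
      exact min_le_right _ _
    nlinarith
  refine hS.trans ?_
  calc (b - a) * (ε * ‖ξ‖) ^ 2 / (1 / 2 + b * (ε * ‖ξ‖) ^ 2)
      ≤ (b - a) * (ε * ‖ξ‖) ^ 2 / (min (1 / 2) b * (1 + ε ^ 2 * ‖ξ‖ ^ 2)) := by gcongr
    _ = _ := by field_simp

/-- A lower bound, for fixed `ε`, for the growth of the resolvent denominators. -/
theorem exists_norm_denMinus_ge_mul (h : SmallParam a b α β ε) :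
    ∃ κ > 0, ∀ (Lam ξ : ℂ), ξ.im = α → κ * ‖ξ‖ - ‖Lam‖ ≤ ‖denMinus a b ε Lam ξ‖ := by
  have hε := h.ε_pos
  have hα := h.α_pos
  have hg := sub_pos.2 h.lt
  have hc0 : 0 ≤ 1 + ε ^ 2 / 2 := by positivity
  have h1 : 0 < 1 - b * (ε * α) ^ 2 := by linarith [h.small]
  have h2 : 0 < ((1 + ε ^ 2 / 2) ^ 2 - 1 - (b - a) * (ε * α) ^ 2 / (1 - b * (ε * α) ^ 2)) /
      (1 + ε ^ 2 / 2 + 2) := by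
    refine div_pos ?_ (by positivity)
    -- Subcriticality enters here: `(b - a)α³ + β/4 < α` because `α - (b - a)α³ = β > 0`. It keeps
    -- `Re Ŝ²` below `c²`, as `c² - 1 > ε²`.
    have h3 : (b - a) * α ^ 3 / (1 - b * (ε * α) ^ 2) < α := by
      refine h.div_one_sub_le.trans_lt ?_
      have := h.β_pos
      have h6 : α - (b - a) * α ^ 3 = β := by rw [h.β_eq]; ring
      linarith
    have h4 : (b - a) * (ε * α) ^ 2 / (1 - b * (ε * α) ^ 2) < ε ^ 2 := by
      rw [div_lt_iff₀ h1] at h3 ⊢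
      have h5 : (b - a) * α ^ 2 < 1 - b * (ε * α) ^ 2 := by
        refine lt_of_mul_lt_mul_left (a := α) ?_ hα.le
        linarith
      have := mul_lt_mul_of_pos_left h5 (show 0 < ε ^ 2 by positivity)
      linarith
    nlinarith [sq_nonneg (ε ^ 2)]
  refine ⟨2 / ε ^ 2 * (((1 + ε ^ 2 / 2) ^ 2 - 1 - (b - a) * (ε * α) ^ 2 / (1 - b * (ε * α) ^ 2)) /
      (1 + ε ^ 2 / 2 + 2)), by positivity, fun Lam ξ hξ => ?_⟩
  have hi : ((ε : ℂ) * ξ).im = ε * α := by simp [hξ]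
  have h3 := (h.inStrip hξ).le_norm_sub_symS hc0
  rw [hi] at h3
  have e1 : denMinus a b ε Lam ξ = Lam - ((2 / ε ^ 2 : ℝ) : ℂ) * (Complex.I * ξ) *
      (((1 + ε ^ 2 / 2 : ℝ) : ℂ) - symS a b (ε * ξ)) := by
    have h0 : (ε : ℂ) ≠ 0 := by exact_mod_cast hε.ne'
    rw [denMinus, symQminus]
    push_cast
    field_simp
  rw [e1, norm_sub_rev]
  refine le_trans ?_ (norm_sub_norm_le _ _)
  rw [norm_mul, norm_mul, norm_mul, Complex.norm_I, one_mul, Complex.norm_real,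
    Real.norm_of_nonneg (by positivity)]
  have := mul_le_mul_of_nonneg_left h3 (show 0 ≤ 2 / ε ^ 2 * ‖ξ‖ by positivity)
  linarith

theorem norm_denPlus_ge_mul (h : SmallParam a b α β ε) (Lam : ℂ) (hξ : ξ.im = α) :
    2 / ε ^ 2 * ‖ξ‖ - ‖Lam‖ ≤ ‖denPlus a b ε Lam ξ‖ := by
  have hε := h.ε_pos
  have h3 := (h.inStrip hξ).le_norm_add_symS (1 + ε ^ 2 / 2)
  have e1 : denPlus a b ε Lam ξ = Lam - ((2 / ε ^ 2 : ℝ) : ℂ) * (Complex.I * ξ) *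
      (((1 + ε ^ 2 / 2 : ℝ) : ℂ) + symS a b (ε * ξ)) := by
    have h0 : (ε : ℂ) ≠ 0 := by exact_mod_cast hε.ne'
    rw [denPlus, symQplus]
    push_cast
    field_simp
  rw [e1, norm_sub_rev]
  refine le_trans ?_ (norm_sub_norm_le _ _)
  rw [norm_mul, norm_mul, norm_mul, Complex.norm_I, one_mul, Complex.norm_real,
    Real.norm_of_nonneg (by positivity)]
  have h4 : 1 ≤ ‖((1 + ε ^ 2 / 2 : ℝ) : ℂ) + symS a b (ε * ξ)‖ := by
    refine le_trans ?_ h3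
    linarith [sq_nonneg ε]
  have := mul_le_mul_of_nonneg_left h4 (show 0 ≤ 2 / ε ^ 2 * ‖ξ‖ by positivity)
  linarith

end SmallParam

/-! ### Bounds and convergence of the inverse symbols -/

/-- The symbol of `(1 - bε²∂²)⁻¹` on the line `Im ξ = α`. -/
def dampSym (b α ε v : ℝ) : ℂ := (1 + b * (ε * lineVar α v) ^ 2)⁻¹

/-- The symbol of `c S_ε⁻¹`, `c = 1 + ε²/2`, on the line `Im ξ = α`. -/
def speedSym (a b α ε v : ℝ) : ℂ := (1 + ε ^ 2 / 2 : ℝ) * (symS a b (ε * lineVar α v))⁻¹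

/-- The resolvent symbol `1/(Λ - 2ε⁻³ Q₋)` on the line `Im ξ = α`. -/
def resMinus (a b α ε : ℝ) (Lam : ℂ) (v : ℝ) : ℂ := (denMinus a b ε Lam (lineVar α v))⁻¹

/-- The resolvent symbol `1/(Λ - 2ε⁻³ Q₊)` on the line `Im ξ = α`. -/
def resPlus (a b α ε : ℝ) (Lam : ℂ) (v : ℝ) : ℂ := (denPlus a b ε Lam (lineVar α v))⁻¹

/-- The resolvent symbol of the KdV equation on the line `Im ξ = α`. -/
def resKdVSym (a b α : ℝ) (Lam : ℂ) (v : ℝ) : ℂ := (denKdV a b Lam (lineVar α v))⁻¹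

theorem AreCloseSymbols.mono {α ε C C' : ℝ} {n n₀ : ℝ → ℂ} (h : AreCloseSymbols α ε C n n₀)
    (hC : C ≤ C') : AreCloseSymbols α ε C' n n₀ where
  meas := h.meas
  meas₀ := h.meas₀
  bdd_deriv := h.bdd_deriv
  norm_le v := (h.norm_le v).trans (by gcongr)
  norm₀_le v := (h.norm₀_le v).trans (by gcongr)
  norm_sub_le v := (h.norm_sub_le v).trans (by gcongr)

/-- Combining the two lower bounds, `κ|ξ| ≤ |D| + L ≤ (1 + L/m)|D|`. In the applications `L = ‖Λ‖`,
so the bound is not uniform in `Λ`; it serves only domain questions and the product rule. -/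
theorem isBddSymbol_derivSym_mul_inv {α m κ L : ℝ} {D : ℝ → ℂ} (hD : Measurable D) (hm : 0 < m)
    (hκ : 0 < κ) (hL : 0 ≤ L) (h1 : ∀ v, m ≤ ‖D v‖)
    (h2 : ∀ v, κ * ‖lineVar α v‖ - L ≤ ‖D v‖) :
    IsBddSymbol fun v => derivSym α v * (D v)⁻¹ := by
  refine ⟨(measurable_derivSym α).mul hD.inv, (1 + L / m) / κ, fun v => ?_⟩
  have hp : 0 < ‖D v‖ := hm.trans_le (h1 v)
  rw [norm_mul, norm_inv, norm_derivSym, ← div_eq_mul_inv, div_le_div_iff₀ hp hκ]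
  have h3 : L ≤ L / m * ‖D v‖ := by
    rw [div_mul_eq_mul_div, le_div_iff₀ hm]
    exact mul_le_mul_of_nonneg_left (h1 v) hL
  linarith [h2 v]

/-- The growth `1 + ε²x²` allowed for `n` cancels the denominator in the bound for `1 - Ŝ`; the
remaining constants and negative powers of `x` are traded for multiples of `x` using `x ≥ α`. -/
theorem speed_error_le {α x ε γ C s : ℝ} (hα : 0 < α) (hx : α ≤ x) (hε : 0 < ε) (hε1 : ε ≤ 1)
    (hγ : 0 ≤ γ) (hC : 0 ≤ C) (hs : 0 < s) :
    (ε ^ 2 / 2 + γ * (ε ^ 2 * x ^ 2 / (1 + ε ^ 2 * x ^ 2))) / s *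
      (C * (1 + ε ^ 2 * x ^ 2) / x ^ 2) ≤
      C * ((2 + (α⁻¹ + α⁻¹ ^ 3) + γ * α⁻¹) / s) * ε ^ 2 * x := by
  have hx0 := hα.trans_le hx
  have h3 : (ε ^ 2 / 2 + γ * (ε ^ 2 * x ^ 2 / (1 + ε ^ 2 * x ^ 2))) / s *
      (C * (1 + ε ^ 2 * x ^ 2) / x ^ 2) =
      C * ε ^ 2 * (1 / (2 * x ^ 2) + ε ^ 2 / 2 + γ) / s := by
    have : 1 + ε ^ 2 * x ^ 2 ≠ 0 := by positivity
    field_simp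
  have hx1 : 1 ≤ α⁻¹ * x := by
    rw [inv_mul_eq_div, le_div_iff₀ hα]
    linarith
  have h4 : 1 / (2 * x ^ 2) + ε ^ 2 / 2 + γ ≤ (2 + (α⁻¹ + α⁻¹ ^ 3) + γ * α⁻¹) * x := by
    have h5 : 1 / (2 * x ^ 2) ≤ α⁻¹ ^ 3 * x := by
      rw [div_le_iff₀ (by positivity), show α⁻¹ ^ 3 * x * (2 * x ^ 2) = 2 * (α⁻¹ * x) ^ 3 by ring]
      have := one_le_pow₀ hx1 (n := 3)
      linarith
    have h6 : ε ^ 2 / 2 ≤ α⁻¹ * x := by nlinarith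
    have h7 := mul_le_mul_of_nonneg_left hx1 hγ
    linarith
  rw [h3]
  calc C * ε ^ 2 * (1 / (2 * x ^ 2) + ε ^ 2 / 2 + γ) / s
      ≤ C * ε ^ 2 * ((2 + (α⁻¹ + α⁻¹ ^ 3) + γ * α⁻¹) * x) / s := by gcongr
    _ = _ := by ring

namespace SmallParam

variable {a b α β ε : ℝ} {Lam : ℂ}

theorem strip (h : SmallParam a b α β ε) (v : ℝ) : InStrip a b (ε * lineVar α v) :=
  h.inStrip (lineVar_im α v)

theorem isDamping (h : SmallParam a b α β ε) :
    IsDamping α ε (2 + b + 1 / b) (dampSym b α ε) := by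
  have hb := h.b_pos
  have hε := h.ε_pos
  have hib : 0 < 1 / b := by positivity
  have hden : ∀ v, 1 / 2 + b * (ε * ‖lineVar α v‖) ^ 2 ≤
      ‖(1 + b * (ε * lineVar α v) ^ 2 : ℂ)‖ := fun v => by
    rw [← h.norm_scaled]
    exact (h.strip v).le_norm_den
  have hpos : ∀ v, 0 < ‖(1 + b * (ε * lineVar α v) ^ 2 : ℂ)‖ := fun v =>
    norm_pos_iff.2 (h.strip v).den_ne_zero
  refine ⟨?_, fun v => ?_, fun v => ?_, fun v => ?_⟩
  · have := measurable_lineVar α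
    unfold dampSym
    fun_prop
  · rw [dampSym, norm_inv, inv_le_comm₀ (hpos v) (by positivity)]
    refine le_trans ?_ (hden v)
    have h1 : (2 + b + 1 / b)⁻¹ ≤ 2⁻¹ := inv_anti₀ (by norm_num) (by linarith)
    have h2 : 0 ≤ b * (ε * ‖lineVar α v‖) ^ 2 := by positivity
    linarith
  · rw [dampSym, norm_mul, norm_inv, norm_derivSym, ← div_eq_mul_inv,
      div_le_div_iff₀ (hpos v) hε]
    refine le_trans ?_ (mul_le_mul_of_nonneg_left (hden v) (by positivity))
    obtain ⟨y, hy⟩ : ∃ y, y = ε * ‖lineVar α v‖ := ⟨_, rfl⟩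
    rw [mul_comm ‖lineVar α v‖, ← hy]
    have h1 : (2 + b + 1 / b) * (1 / 2 + b * y ^ 2) =
        1 + b / 2 + 1 / b / 2 + (2 * b + b ^ 2) * y ^ 2 + y ^ 2 := by
      field_simp
      ring
    have h2 : 0 ≤ (2 * b + b ^ 2) * y ^ 2 := by positivity
    rw [h1]
    nlinarith [sq_nonneg (y - 1)]
  · have e : dampSym b α ε v - 1 =
        -(b * (ε * lineVar α v) ^ 2) * (1 + b * (ε * lineVar α v) ^ 2 : ℂ)⁻¹ := by
      have := (h.strip v).den_ne_zero
      rw [dampSym]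
      linear_combination mul_inv_cancel₀ this
    rw [e, norm_mul, norm_inv, norm_neg, norm_mul, norm_pow, h.norm_scaled, Complex.norm_real,
      Real.norm_of_nonneg hb.le, ← div_eq_mul_inv, div_le_iff₀ (hpos v)]
    refine le_trans ?_ (mul_le_mul_of_nonneg_left (hden v) (by positivity))
    obtain ⟨y, hy⟩ : ∃ y, y = ε * ‖lineVar α v‖ := ⟨_, rfl⟩
    have hy0 : 0 ≤ y := by rw [hy]; positivity
    rw [mul_assoc (2 + b + 1 / b), ← hy]
    have h1 : b * y ≤ (2 + b + 1 / b) * (1 / 2 + b * y ^ 2) := by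
      have h3 : (2 + b + 1 / b) * (1 / 2 + b * y ^ 2) =
          1 + b / 2 + 1 / b / 2 + (2 * b + b ^ 2) * y ^ 2 + y ^ 2 := by
        field_simp
        ring
      have h4 : 0 ≤ b ^ 2 * y ^ 2 := by positivity
      rw [h3]
      nlinarith [sq_nonneg (y - 1), mul_nonneg hb.le (sq_nonneg (y - 1)), sq_nonneg y,
        mul_nonneg hb.le (sq_nonneg y)]
    have := mul_le_mul_of_nonneg_right h1 hy0
    linarith

theorem norm_resKdVSym_le (h : SmallParam a b α β ε) (hL : -β / 2 ≤ Lam.re) (v : ℝ) :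
    ‖resKdVSym a b α Lam v‖ ≤ (coerc a b α β)⁻¹ / ‖lineVar α v‖ ^ 2 := by
  have hx := h.α_pos.trans_le (le_norm_lineVar α v)
  have hc := h.coerc_pos
  rw [resKdVSym, norm_inv, div_eq_mul_inv, ← mul_inv]
  exact inv_anti₀ (by positivity) (h.norm_denKdV_ge (lineVar_im α v) hL)

theorem norm_resMinus_le (h : SmallParam a b α β ε) (hL : -β / 2 ≤ Lam.re) (v : ℝ) :
    ‖resMinus a b α ε Lam v‖ ≤
      (coerc a b α β)⁻¹ * (1 + ε ^ 2 * ‖lineVar α v‖ ^ 2) / ‖lineVar α v‖ ^ 2 := by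
  have hx := h.α_pos.trans_le (le_norm_lineVar α v)
  have hc := h.coerc_pos
  rw [resMinus, norm_inv]
  refine (inv_anti₀ (by positivity) (h.norm_denMinus_ge (lineVar_im α v) hL)).trans_eq ?_
  rw [inv_div]
  field_simp

theorem norm_resPlus_le (h : SmallParam a b α β ε) (hL : -β / 2 ≤ Lam.re) (v : ℝ) :
    ‖resPlus a b α ε Lam v‖ ≤ α⁻¹ * ε ^ 2 := by
  have hε := h.ε_pos
  have hα := h.α_pos
  rw [resPlus, norm_inv]
  refine (inv_anti₀ (by positivity) (h.le_norm_denPlus (lineVar_im α v) hL)).trans_eq ?_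
  rw [inv_div]
  field_simp

theorem isBddSymbol_deriv_resMinus (h : SmallParam a b α β ε) (hL : -β / 2 ≤ Lam.re) :
    IsBddSymbol fun v => derivSym α v * resMinus a b α ε Lam v := by
  obtain ⟨κ, hκ, h1⟩ := h.exists_norm_denMinus_ge_mul
  exact isBddSymbol_derivSym_mul_inv ((measurable_denMinus a b ε Lam).comp (measurable_lineVar α))
    (div_pos h.β_pos (by norm_num)) hκ (norm_nonneg Lam)
    (fun v => h.le_norm_denMinus (lineVar_im α v) hL) (fun v => h1 Lam _ (lineVar_im α v))

theorem isBddSymbol_deriv_resPlus (h : SmallParam a b α β ε) (hL : -β / 2 ≤ Lam.re) :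
    IsBddSymbol fun v => derivSym α v * resPlus a b α ε Lam v := by
  have hε := h.ε_pos
  have hα := h.α_pos
  exact isBddSymbol_derivSym_mul_inv ((measurable_denPlus a b ε Lam).comp (measurable_lineVar α))
    (m := α / ε ^ 2) (κ := 2 / ε ^ 2) (by positivity) (by positivity) (norm_nonneg Lam)
    (fun v => h.le_norm_denPlus (lineVar_im α v) hL)
    (fun v => h.norm_denPlus_ge_mul Lam (lineVar_im α v))

theorem measurable_resMinus (a b α ε : ℝ) (Lam : ℂ) : Measurable (resMinus a b α ε Lam) :=
  ((measurable_denMinus a b ε Lam).comp (measurable_lineVar α)).inv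

theorem measurable_resPlus (a b α ε : ℝ) (Lam : ℂ) : Measurable (resPlus a b α ε Lam) :=
  ((measurable_denPlus a b ε Lam).comp (measurable_lineVar α)).inv

theorem measurable_resKdVSym (a b α : ℝ) (Lam : ℂ) : Measurable (resKdVSym a b α Lam) :=
  ((measurable_denKdV a b Lam).comp (measurable_lineVar α)).inv

theorem norm_speedSym_le (h : SmallParam a b α β ε) (v : ℝ) :
    ‖speedSym a b α ε v‖ ≤ 2 / √(a / b) := by
  have hε := h.ε_pos
  rw [speedSym, norm_mul, norm_inv, Complex.norm_real, Real.norm_of_nonneg (by positivity),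
    ← div_eq_mul_inv]
  have h1 := (h.strip v).sqrt_pos
  have h2 := (h.strip v).sqrt_le_norm
  have h3 : 1 + ε ^ 2 / 2 ≤ 2 := by nlinarith [h.ε_le]
  gcongr

theorem isBddSymbol_speedSym (h : SmallParam a b α β ε) : IsBddSymbol (speedSym a b α ε) := by
  refine ⟨?_, _, h.norm_speedSym_le⟩
  have := measurable_lineVar α
  have := measurable_symS a b
  unfold speedSym
  fun_prop

theorem norm_speedSym_sub_one_le (h : SmallParam a b α β ε) (v : ℝ) :
    ‖speedSym a b α ε v - 1‖ ≤ (ε ^ 2 / 2 + (b - a) / min (1 / 2) b *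
      (ε ^ 2 * ‖lineVar α v‖ ^ 2 / (1 + ε ^ 2 * ‖lineVar α v‖ ^ 2))) / √(a / b) := by
  have e : speedSym a b α ε v - 1 = (((ε ^ 2 / 2 : ℝ) : ℂ) + (1 - symS a b (ε * lineVar α v))) *
      (symS a b (ε * lineVar α v))⁻¹ := by
    have := (h.strip v).symS_ne_zero
    rw [speedSym]
    push_cast
    field_simp
    ring
  have h1 := (h.strip v).sqrt_pos
  have h2 := (h.strip v).sqrt_le_norm
  rw [e, norm_mul, norm_inv, ← div_eq_mul_inv]
  have h3 : ‖((ε ^ 2 / 2 : ℝ) : ℂ) + (1 - symS a b (ε * lineVar α v))‖ ≤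
      ε ^ 2 / 2 + (b - a) / min (1 / 2) b *
      (ε ^ 2 * ‖lineVar α v‖ ^ 2 / (1 + ε ^ 2 * ‖lineVar α v‖ ^ 2)) := by
    refine (norm_add_le _ _).trans (add_le_add (le_of_eq ?_)
      (h.norm_one_sub_symS_scaled_le (lineVar_im α v)))
    rw [Complex.norm_real, Real.norm_of_nonneg (by positivity)]
  exact div_le_div₀ ((norm_nonneg _).trans h3) h3 h1 h2

/-- Resolvent identity: the factor `1 + ε²|ξ|²` in the bound for `n` cancels the denominator of the
symbol difference, and the powers `|ξ|⁵/|ξ|⁴` leave `|ξ|`. -/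
theorem norm_resMinus_sub_le (h : SmallParam a b α β ε) (hL : -β / 2 ≤ Lam.re) (v : ℝ) :
    ‖resMinus a b α ε Lam v - resKdVSym a b α Lam v‖ ≤
      10 * b * (b - a) / min (1 / 2) b * (coerc a b α β)⁻¹ ^ 2 * ε ^ 2 * ‖lineVar α v‖ := by
  have hx := h.α_pos.trans_le (le_norm_lineVar α v)
  have hc := h.coerc_pos
  have hb := h.b_pos
  have hg := sub_pos.2 h.lt
  have hm : 0 < min (1 / 2) b := lt_min (by norm_num) hb
  have h1 : 0 < ‖denMinus a b ε Lam (lineVar α v)‖ :=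
    lt_of_lt_of_le (by positivity) (h.norm_denMinus_ge (lineVar_im α v) hL)
  have h2 : 0 < ‖denKdV a b Lam (lineVar α v)‖ :=
    lt_of_lt_of_le (by positivity) (h.norm_denKdV_ge (lineVar_im α v) hL)
  have e : resMinus a b α ε Lam v - resKdVSym a b α Lam v =
      resMinus a b α ε Lam v * (-(denMinus a b ε Lam (lineVar α v) -
        denKdV a b Lam (lineVar α v))) * resKdVSym a b α Lam v := by
    have h3 := norm_pos_iff.1 h1
    have h4 := norm_pos_iff.1 h2
    rw [resMinus, resKdVSym]
    field_simp
    ring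
  rw [e, norm_mul, norm_mul, norm_neg]
  have h5 := h.norm_resMinus_le hL v
  have h6 := h.norm_resKdVSym_le hL v
  have h7 := h.norm_denMinus_sub_le (Lam := Lam) (lineVar_im α v)
  calc ‖resMinus a b α ε Lam v‖ * ‖denMinus a b ε Lam (lineVar α v) -
        denKdV a b Lam (lineVar α v)‖ * ‖resKdVSym a b α Lam v‖
      ≤ (coerc a b α β)⁻¹ * (1 + ε ^ 2 * ‖lineVar α v‖ ^ 2) / ‖lineVar α v‖ ^ 2 *
        (10 * b * (b - a) / min (1 / 2) b *
          (ε ^ 2 * ‖lineVar α v‖ ^ 5 / (1 + ε ^ 2 * ‖lineVar α v‖ ^ 2))) *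
        ((coerc a b α β)⁻¹ / ‖lineVar α v‖ ^ 2) := by gcongr
    _ = _ := by field_simp

theorem areClose_resMinus (h : SmallParam a b α β ε) (hL : -β / 2 ≤ Lam.re) :
    AreCloseSymbols α ε
      ((coerc a b α β)⁻¹ + 10 * b * (b - a) / min (1 / 2) b * (coerc a b α β)⁻¹ ^ 2)
      (resMinus a b α ε Lam) (resKdVSym a b α Lam) := by
  have hc := h.coerc_pos
  have hb := h.b_pos
  have hg := sub_pos.2 h.lt
  have hm : 0 < min (1 / 2) b := lt_min (by norm_num) hb
  refine ⟨measurable_resMinus _ _ _ _ _, measurable_resKdVSym _ _ _ _,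
    h.isBddSymbol_deriv_resMinus hL, fun v => (h.norm_resMinus_le hL v).trans ?_,
    fun v => (h.norm_resKdVSym_le hL v).trans ?_, fun v => (h.norm_resMinus_sub_le hL v).trans ?_⟩
  · gcongr
    exact le_add_of_nonneg_right (by positivity)
  · gcongr
    exact le_add_of_nonneg_right (by positivity)
  · gcongr
    exact le_add_of_nonneg_left (by positivity)

/-- Taking `n₀ = 0` lets the same convergence estimates show that the `𝒬₊` contribution vanishes in
the limit. -/
theorem areClose_resPlus (h : SmallParam a b α β ε) (hL : -β / 2 ≤ Lam.re) :
    AreCloseSymbols α ε (α⁻¹ + α⁻¹ ^ 2) (resPlus a b α ε Lam) (fun _ => 0) := by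
  have hα := h.α_pos
  refine ⟨measurable_resPlus _ _ _ _ _, measurable_const, h.isBddSymbol_deriv_resPlus hL,
    fun v => (h.norm_resPlus_le hL v).trans ?_, fun v => ?_, fun v => ?_⟩
  · have hx := hα.trans_le (le_norm_lineVar α v)
    rw [le_div_iff₀ (by positivity)]
    have h1 : 0 ≤ α⁻¹ ^ 2 * (1 + ε ^ 2 * ‖lineVar α v‖ ^ 2) := by positivity
    have h2 : 0 < α⁻¹ := by positivity
    linarith
  · rw [norm_zero]
    positivity
  · rw [sub_zero]
    refine (h.norm_resPlus_le hL v).trans ?_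
    have h1 : α⁻¹ ≤ α⁻¹ ^ 2 * ‖lineVar α v‖ := by
      calc α⁻¹ = α⁻¹ ^ 2 * α := by field_simp
        _ ≤ _ := by
          have := le_norm_lineVar α v
          gcongr
    have h2 : 0 ≤ α⁻¹ * ‖lineVar α v‖ := by positivity
    calc α⁻¹ * ε ^ 2 ≤ (α⁻¹ * ‖lineVar α v‖ + α⁻¹ ^ 2 * ‖lineVar α v‖) * ε ^ 2 := by
          gcongr
          linarith
      _ = _ := by ring

/-- Multiplication by `c S_ε⁻¹` preserves closeness. -/
theorem areClose_speed_mul (h : SmallParam a b α β ε) {C : ℝ} (hC : 0 ≤ C) {n n₀ : ℝ → ℂ}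
    (hn : AreCloseSymbols α ε C n n₀) :
    AreCloseSymbols α ε (C * (1 + (2 + (α⁻¹ + α⁻¹ ^ 3) + (b - a) / min (1 / 2) b * α⁻¹) / √(a / b)))
      (fun v => speedSym a b α ε v * n v) n₀ := by
  have hα := h.α_pos
  have hε := h.ε_pos
  have hb := h.b_pos
  have hg := sub_pos.2 h.lt
  have hm : 0 < min (1 / 2) b := lt_min (by norm_num) hb
  have hs := (h.strip 0).sqrt_pos
  have hbs := h.isBddSymbol_speedSym
  refine ⟨hbs.1.mul hn.meas, hn.meas₀, ?_, fun v => ?_, fun v => ?_, fun v => ?_⟩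
  · convert hbs.mul hn.bdd_deriv using 2 with v
    ring
  · rw [norm_mul]
    calc ‖speedSym a b α ε v‖ * ‖n v‖ ≤ 2 / √(a / b) *
          (C * (1 + ε ^ 2 * ‖lineVar α v‖ ^ 2) / ‖lineVar α v‖ ^ 2) := by
          have := h.norm_speedSym_le v
          have := hn.norm_le v
          gcongr
      _ = C * (2 / √(a / b)) * (1 + ε ^ 2 * ‖lineVar α v‖ ^ 2) / ‖lineVar α v‖ ^ 2 := by ring
      _ ≤ _ := by
          gcongr
          rw [add_div, add_div]
          have : 0 ≤ (α⁻¹ + α⁻¹ ^ 3) / √(a / b) := by positivity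
          have : 0 ≤ (b - a) / min (1 / 2) b * α⁻¹ / √(a / b) := by positivity
          linarith
  · refine (hn.norm₀_le v).trans ?_
    gcongr
    have : 0 ≤ (2 + (α⁻¹ + α⁻¹ ^ 3) + (b - a) / min (1 / 2) b * α⁻¹) / √(a / b) := by positivity
    nlinarith
  · have hx := hα.trans_le (le_norm_lineVar α v)
    have hxα := le_norm_lineVar α v
    have e : speedSym a b α ε v * n v - n₀ v = (n v - n₀ v) + (speedSym a b α ε v - 1) * n v := by
      ring
    have h1 : ‖(speedSym a b α ε v - 1) * n v‖ ≤ (ε ^ 2 / 2 + (b - a) / min (1 / 2) b *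
        (ε ^ 2 * ‖lineVar α v‖ ^ 2 / (1 + ε ^ 2 * ‖lineVar α v‖ ^ 2))) / √(a / b) *
          (C * (1 + ε ^ 2 * ‖lineVar α v‖ ^ 2) / ‖lineVar α v‖ ^ 2) := by
      rw [norm_mul]
      exact mul_le_mul (h.norm_speedSym_sub_one_le v) (hn.norm_le v) (norm_nonneg _)
        (by positivity)
    have h3 := speed_error_le hα hxα hε h.ε_le (div_pos hg hm).le hC hs
    rw [e]
    refine (norm_add_le _ _).trans ((add_le_add (hn.norm_sub_le v) (h1.trans h3)).trans_eq ?_)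
    ring

end SmallParam

/-! ## The soliton profiles -/

theorem hasDerivAt_real_tanh (x : ℝ) : HasDerivAt Real.tanh (1 - Real.tanh x ^ 2) x := by
  have h := (Real.hasDerivAt_sinh x).div (Real.hasDerivAt_cosh x) (Real.cosh_pos x).ne'
  have e : Real.tanh = Real.sinh / Real.cosh := by
    funext y
    exact Real.tanh_eq_sinh_div_cosh y
  rw [e]
  refine h.congr_deriv ?_
  have := (Real.cosh_pos x).ne'
  rw [Pi.div_apply]
  field_simp

theorem inv_cosh_sq_eq (x : ℝ) : (1 / Real.cosh x) ^ 2 = 1 - Real.tanh x ^ 2 := by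
  have := (Real.cosh_pos x).ne'
  rw [Real.tanh_eq_sinh_div_cosh]
  field_simp
  linarith [Real.cosh_sq x]

theorem tanh_sq_le_one (x : ℝ) : Real.tanh x ^ 2 ≤ 1 := by
  have h1 := Real.tanh_lt_one x
  have h2 := Real.neg_one_lt_tanh x
  nlinarith

/-- This is `|x| ≤ cosh² x`, from `|x| ≤ |sinh x|` and `cosh² = 1 + sinh²`. -/
theorem abs_mul_one_sub_tanh_sq_le (x : ℝ) : |x| * (1 - Real.tanh x ^ 2) ≤ 1 := by
  rw [← inv_cosh_sq_eq, one_div, inv_pow, ← div_eq_mul_inv, div_le_one (by positivity),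
    Real.cosh_sq]
  have h : |x| ≤ |Real.sinh x| := by
    rw [Real.abs_sinh]
    exact Real.self_le_sinh_iff.2 (abs_nonneg x)
  have h2 : |Real.sinh x| ^ 2 = Real.sinh x ^ 2 := sq_abs _
  nlinarith [sq_nonneg (|Real.sinh x| - 1)]

/-- A differentiable function with `|y g'(y)| ≤ K` depends uniformly Lipschitz continuously on its
dilation parameter. -/
theorem abs_comp_mul_sub_le {g g' : ℝ → ℝ} (hg : ∀ y, HasDerivAt g (g' y) y) {K s₀ s : ℝ}
    (hK : ∀ y, |y| * |g' y| ≤ K) (hs₀ : 0 < s₀) (hs : s₀ / 2 ≤ s) (x : ℝ) :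
    |g (s * x) - g (s₀ * x)| ≤ 2 * K / s₀ * |s - s₀| := by
  have hK0 : 0 ≤ K := le_trans (by positivity) (hK 0)
  have hd : ∀ t ∈ Ici (s₀ / 2), HasDerivWithinAt (fun t => g (t * x)) (g' (t * x) * x)
      (Ici (s₀ / 2)) t := fun t _ => by
    have h := (hg (t * x)).comp t ((hasDerivAt_id t).mul_const x)
    simp only [id, one_mul] at h
    exact h.hasDerivWithinAt
  -- With `y = tx` the derivative in the dilation parameter is `y g'(y)/t`, and `t ≥ s₀/2`.
  have hb : ∀ t ∈ Ici (s₀ / 2), ‖g' (t * x) * x‖ ≤ 2 * K / s₀ := fun t ht => by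
    have ht0 : 0 < t := lt_of_lt_of_le (by positivity) (mem_Ici.1 ht)
    have h1 := hK (t * x)
    rw [abs_mul, abs_of_pos ht0] at h1
    rw [Real.norm_eq_abs, abs_mul, le_div_iff₀ hs₀]
    have h2 : 0 ≤ |g' (t * x)| * |x| := by positivity
    have h3 := mul_le_mul_of_nonneg_left (mem_Ici.1 ht) h2
    linarith
  exact Convex.norm_image_sub_le_of_norm_hasDerivWithin_le hd hb (convex_Ici _)
    (mem_Ici.2 (by linarith)) (mem_Ici.2 hs)

section Profile

open Polynomial

/-- The function `tanh(sx)`. -/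
def tanhFun (s x : ℝ) : ℂ := (Real.tanh (s * x) : ℝ)

theorem hasDerivAt_tanhFun (s x : ℝ) :
    HasDerivAt (tanhFun s) ((C (s : ℂ) * (1 - X ^ 2) : ℂ[X]).eval (tanhFun s x)) x := by
  have h := ((hasDerivAt_real_tanh (s * x)).comp x ((hasDerivAt_id x).const_mul s)).ofReal_comp
  refine h.congr_deriv ?_
  simp only [eval_mul, eval_C, eval_sub, eval_one, eval_pow, eval_X, tanhFun]
  push_cast
  ring

theorem norm_tanhFun_le (s x : ℝ) : ‖tanhFun s x‖ ≤ 1 := by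
  rw [tanhFun, Complex.norm_real, Real.norm_eq_abs, abs_le]
  exact ⟨(Real.neg_one_lt_tanh _).le, (Real.tanh_lt_one _).le⟩

/-- The differential equation `u' = s(1 - u²)` of `u = tanh(sx)` supplies smoothness and all bounds;
the profile and its derivative are polynomials in `u`. -/
theorem isMultiplier_eval_tanhFun (s : ℝ) (Q : ℂ[X]) :
    IsMultiplier (fun x => Q.eval (tanhFun s x))
      (fun x => (derivative Q * (C (s : ℂ) * (1 - X ^ 2))).eval (tanhFun s x)) := by
  have hm : Measurable (tanhFun s) := by
    have h : Continuous (tanhFun s) :=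
      continuous_iff_continuousAt.2 fun x => (hasDerivAt_tanhFun s x).continuousAt
    exact h.measurable
  have hb : ∀ R : ℂ[X], IsBddSymbol fun x => R.eval (tanhFun s x) := fun R =>
    ⟨R.continuous.measurable.comp hm, exists_norm_eval_le (norm_tanhFun_le s) R⟩
  exact ⟨hasTemperateGrowth_eval_of_deriv_eq (hasDerivAt_tanhFun s) (norm_tanhFun_le s) Q, hb _,
    hb _, hasDerivAt_eval_of_deriv_eq (hasDerivAt_tanhFun s) Q⟩

/-- The profile `κ sech²(sx)`. -/
def profile (κ s x : ℝ) : ℝ := κ * (1 - Real.tanh (s * x) ^ 2)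

/-- The derivative of the profile `κ sech²(sx)`. -/
def profileDeriv (κ s x : ℝ) : ℝ :=
  -(2 * (κ * s)) * (Real.tanh (s * x) * (1 - Real.tanh (s * x) ^ 2))

theorem hasDerivAt_profile (κ s x : ℝ) : HasDerivAt (profile κ s) (profileDeriv κ s x) x := by
  have h := ((((hasDerivAt_real_tanh (s * x)).comp x ((hasDerivAt_id x).const_mul s)).pow
    2).const_sub 1).const_mul κ
  refine h.congr_deriv ?_
  simp only [profileDeriv, Function.comp]
  push_cast
  ring

theorem exists_isMultiplier_profile (κ s : ℝ) : ∃ p'' : ℝ → ℂ,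
    IsMultiplier (fun x => (profile κ s x : ℂ)) (fun x => (profileDeriv κ s x : ℂ)) ∧
      IsMultiplier (fun x => (profileDeriv κ s x : ℂ)) p'' := by
  have e1 : (fun x => (profile κ s x : ℂ)) =
      fun x => (C (κ : ℂ) * (1 - X ^ 2) : ℂ[X]).eval (tanhFun s x) := by
    funext x
    simp [profile, tanhFun]
  have e2 : (fun x => (profileDeriv κ s x : ℂ)) = fun x =>
      (derivative (C (κ : ℂ) * (1 - X ^ 2)) * (C (s : ℂ) * (1 - X ^ 2)) : ℂ[X]).eval
        (tanhFun s x) := by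
    funext x
    simp [profileDeriv, tanhFun]
    ring
  have h := isMultiplier_eval_tanhFun s
    (derivative (C (κ : ℂ) * (1 - X ^ 2)) * (C (s : ℂ) * (1 - X ^ 2)))
  rw [← e2] at h
  refine ⟨_, ?_, h⟩
  rw [e1, e2]
  exact isMultiplier_eval_tanhFun s _

theorem abs_profile_le (κ s x : ℝ) : |profile κ s x| ≤ |κ| := by
  rw [profile, abs_mul]
  have h1 := tanh_sq_le_one (s * x)
  have h2 := sq_nonneg (Real.tanh (s * x))
  refine mul_le_of_le_one_right (abs_nonneg κ) ?_
  rw [abs_le]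
  constructor <;> linarith

theorem abs_tanh_mul_le (y : ℝ) : |Real.tanh y * (1 - Real.tanh y ^ 2)| ≤ 1 := by
  have h1 := tanh_sq_le_one y
  have h2 := sq_nonneg (Real.tanh y)
  rw [abs_mul]
  refine mul_le_one₀ ?_ (abs_nonneg _) ?_
  · exact abs_le.2 ⟨(Real.neg_one_lt_tanh _).le, (Real.tanh_lt_one _).le⟩
  · rw [abs_le]
    constructor <;> linarith

theorem abs_profileDeriv_le (κ s x : ℝ) : |profileDeriv κ s x| ≤ 2 * |κ * s| := by
  rw [profileDeriv, abs_mul, abs_neg, abs_mul 2, abs_two]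
  exact mul_le_of_le_one_right (by positivity) (abs_tanh_mul_le _)

theorem abs_profile_sub_le {κ s s₀ : ℝ} (hs₀ : 0 < s₀) (hs : s₀ / 2 ≤ s) (x : ℝ) :
    |profile κ s x - profile 1 s₀ x| ≤ |κ - 1| + 4 / s₀ * |s - s₀| := by
  have h1 := abs_comp_mul_sub_le (g := fun y => 1 - Real.tanh y ^ 2)
    (g' := fun y => -(2 * (Real.tanh y * (1 - Real.tanh y ^ 2)))) (K := 2) (fun y => by
      refine (((hasDerivAt_real_tanh y).pow 2).const_sub 1).congr_deriv ?_
      push_cast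
      ring) (fun y => by
      have h2 := abs_mul_one_sub_tanh_sq_le y
      have h3 : |Real.tanh y| ≤ 1 :=
        abs_le.2 ⟨(Real.neg_one_lt_tanh _).le, (Real.tanh_lt_one _).le⟩
      have h4 : 0 ≤ 1 - Real.tanh y ^ 2 := by linarith [tanh_sq_le_one y]
      rw [abs_neg, abs_mul, abs_two, abs_mul, abs_of_nonneg h4]
      have h5 := mul_le_mul_of_nonneg_right h3 (mul_nonneg (abs_nonneg y) h4)
      nlinarith) hs₀ hs x
  have e : profile κ s x - profile 1 s₀ x = profile (κ - 1) s x +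
      ((1 - Real.tanh (s * x) ^ 2) - (1 - Real.tanh (s₀ * x) ^ 2)) := by
    simp only [profile]
    ring
  rw [e]
  refine (abs_add_le _ _).trans (add_le_add (abs_profile_le _ _ _) (h1.trans_eq ?_))
  ring

theorem abs_profileDeriv_sub_le {κ s s₀ : ℝ} (hs₀ : 0 < s₀) (hs : s₀ / 2 ≤ s) (x : ℝ) :
    |profileDeriv κ s x - profileDeriv 1 s₀ x| ≤ 2 * |κ * s - s₀| + 8 * |s - s₀| := by
  have h1 := abs_comp_mul_sub_le (g := fun y => Real.tanh y * (1 - Real.tanh y ^ 2))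
    (g' := fun y => (1 - 3 * Real.tanh y ^ 2) * (1 - Real.tanh y ^ 2)) (K := 2) (fun y => by
      have h := (hasDerivAt_real_tanh y).mul (((hasDerivAt_real_tanh y).pow 2).const_sub 1)
      refine h.congr_deriv ?_
      simp only [Pi.pow_apply]
      push_cast
      ring) (fun y => by
      have h2 := abs_mul_one_sub_tanh_sq_le y
      have h1 := tanh_sq_le_one y
      have h3 : |1 - 3 * Real.tanh y ^ 2| ≤ 2 := by
        rw [abs_le]
        constructor <;> linarith [sq_nonneg (Real.tanh y)]
      have h4 : 0 ≤ 1 - Real.tanh y ^ 2 := by linarith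
      rw [abs_mul, abs_of_nonneg h4]
      have h5 := mul_le_mul_of_nonneg_right h3 (mul_nonneg (abs_nonneg y) h4)
      nlinarith) hs₀ hs x
  obtain ⟨g, hg⟩ : ∃ g, g = fun y => Real.tanh y * (1 - Real.tanh y ^ 2) := ⟨_, rfl⟩
  have hgx : ∀ y, Real.tanh y * (1 - Real.tanh y ^ 2) = g y := fun y => by rw [hg]
  have h2 := abs_tanh_mul_le (s * x)
  simp only [profileDeriv, hgx] at h1 h2 ⊢
  have e : -(2 * (κ * s)) * g (s * x) - -(2 * (1 * s₀)) * g (s₀ * x) =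
      -(2 * (κ * s - s₀)) * g (s * x) + -(2 * s₀) * (g (s * x) - g (s₀ * x)) := by ring
  rw [e]
  refine (abs_add_le _ _).trans (add_le_add ?_ ?_)
  · rw [abs_mul, abs_neg, abs_mul, abs_two]
    exact mul_le_of_le_one_right (by positivity) h2
  · rw [abs_mul, abs_neg, abs_mul, abs_two, abs_of_pos hs₀]
    refine (mul_le_mul_of_nonneg_left h1 (by positivity)).trans_eq ?_
    field_simp
    ring

theorem norm_mulL2_ofReal_le {g : ℝ → ℝ} {M : ℝ} (h : ∀ x, |g x| ≤ M) :
    ‖mulL2 fun x => (g x : ℂ)‖ ≤ M :=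
  norm_mulL2_le fun x => by
    rw [Complex.norm_real]
    exact h x

/-- `M` and `p''` are chosen before `κ` and `s`, so one bound serves all nearby profiles; the error
is the sum of the bounds for the profile and for its derivative. -/
theorem exists_areClose {s₀ : ℝ} (hs₀ : 0 < s₀) : ∃ (M : ℝ) (p'' : ℝ → ℂ), ∀ κ s : ℝ, |κ| ≤ 2 →
    s₀ / 2 ≤ s → s ≤ 2 * s₀ →
    AreClose M (|κ - 1| + 4 / s₀ * |s - s₀| + (2 * |κ * s - s₀| + 8 * |s - s₀|))
      (fun x => (profile κ s x : ℂ)) (fun x => (profileDeriv κ s x : ℂ))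
      (fun x => (profile 1 s₀ x : ℂ)) (fun x => (profileDeriv 1 s₀ x : ℂ)) p'' := by
  obtain ⟨p'', hp1, hp2⟩ := exists_isMultiplier_profile 1 s₀
  refine ⟨2 + 8 * s₀ + ‖mulL2 p''‖, p'', fun κ s hκ hs hs' => ?_⟩
  obtain ⟨_, hq1, -⟩ := exists_isMultiplier_profile κ s
  have hn := norm_nonneg (mulL2 p'')
  have hκs : |κ * s| ≤ 4 * s₀ := by
    rw [abs_mul, abs_of_pos (show 0 < s by linarith)]
    nlinarith [abs_nonneg κ]
  have n1 : 0 ≤ |κ - 1| + 4 / s₀ * |s - s₀| := by positivity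
  have n2 : 0 ≤ 2 * |κ * s - s₀| + 8 * |s - s₀| := by positivity
  have h1s : |1 * s₀| = s₀ := by rw [one_mul, abs_of_pos hs₀]
  refine ⟨hq1, hp1, hp2, norm_mulL2_ofReal_le fun x => (abs_profile_le κ s x).trans ?_,
    norm_mulL2_ofReal_le fun x => (abs_profileDeriv_le κ s x).trans ?_,
    norm_mulL2_ofReal_le fun x => (abs_profile_le 1 s₀ x).trans ?_,
    norm_mulL2_ofReal_le fun x => (abs_profileDeriv_le 1 s₀ x).trans ?_, ?_, ?_, ?_⟩
  · linarith
  · linarith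
  · rw [abs_one]
    linarith
  · rw [h1s]
    linarith
  · linarith
  · rw [← mulL2_sub hq1.bdd hp1.bdd]
    simp only [← Complex.ofReal_sub]
    exact norm_mulL2_ofReal_le fun x => (abs_profile_sub_le hs₀ hs x).trans (by linarith)
  · rw [← mulL2_sub hq1.bdd_deriv hp1.bdd_deriv]
    simp only [← Complex.ofReal_sub]
    exact norm_mulL2_ofReal_le fun x => (abs_profileDeriv_sub_le hs₀ hs x).trans (by linarith)

end Profile

/-! ## Action of the rescaled operators -/

theorem Maps.congr_right {E F : Type*} [AddCommGroup E] [Module ℂ E] [AddCommGroup F] [Module ℂ F]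
    {T : E →ₗ.[ℂ] F} {x : E} {y z : F} (h : Maps T x y) (e : y = z) : Maps T x z := e ▸ h

theorem Maps.const_smul {E F : Type*} [AddCommGroup E] [Module ℂ E] [AddCommGroup F] [Module ℂ F]
    {T : E →ₗ.[ℂ] F} {x : E} {y : F} (k : ℂ) (h : Maps T x y) : Maps T (k • x) (k • y) := by
  obtain ⟨hx, rfl⟩ := h
  exact ⟨T.domain.smul_mem k hx, T.map_smul k ⟨x, hx⟩⟩

/-- The map `h ↦ e^{-εαx} h(εx)` from `L²(ℝ)` to `L²_{εα}`. -/
def dilWeight (α ε : ℝ) (hε : 0 < ε) : H2 →ₗ[ℂ] L2w (ε * α) :=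
  (weight (ε * α)).symm.toLinearMap ∘ₗ (dil ε hε.ne').toLinearMap

section Rules

variable {α ε : ℝ} (hε : 0 < ε)

theorem dilWeight_apply (f : H2) :
    dilWeight α ε hε f = (weight (ε * α)).symm (dil ε hε.ne' f) := rfl

theorem dilWeight_fmul {n : ℝ → ℂ} (hn : IsBddSymbol n) (f : H2) :
    dilWeight α ε hε (fmul n f) =
      (weight (ε * α)).symm (fmul (fun v => n (ε⁻¹ * v)) (dil ε hε.ne' f)) := by
  rw [dilWeight_apply, fmul_dil hε (hn.comp_mul ε⁻¹)]
  simp_rw [inv_mul_cancel_left₀ hε.ne']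

theorem lineVar_eq_mul {α ε : ℝ} (hε : 0 < ε) (v : ℝ) : lineVar (ε * α) v = ε * lineVar α (ε⁻¹ * v) := by
  rw [← lineVar_mul, mul_inv_cancel_left₀ hε.ne']

/-- Dilation turns the frequency `v` into `ε⁻¹v`, and the line `Im ξ = εα` is `ε` times the line `Im
ξ = α`. Unscaled symbols are therefore evaluated at `ε` times a point of the fixed line. -/
theorem maps_fourierMul_dilWeight {m : ℂ → ℂ} {n n' : ℝ → ℂ} {k : ℂ} (hn : IsBddSymbol n)
    (hn' : IsBddSymbol n') (h : ∀ v, m (ε * lineVar α v) * n v = k * n' v) (f : H2) :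
    Maps (fourierMul (ε * α) m) (dilWeight α ε hε (fmul n f))
      (k • dilWeight α ε hε (fmul n' f)) := by
  rw [dilWeight_fmul hε hn, dilWeight_fmul hε hn', ← map_smul, ← _root_.smul_apply,
    ← fmul_const_mul k (hn'.comp_mul ε⁻¹)]
  refine maps_fourierMul_fmul (hn.comp_mul ε⁻¹) ((IsBddSymbol.const k).mul (hn'.comp_mul ε⁻¹))
    (fun v => ?_) _
  rw [lineVar_eq_mul hε, h]

theorem maps_inverseOp_dilWeight {m : ℂ → ℂ} {n : ℝ → ℂ} (hn : IsBddSymbol n)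
    (h : ∀ v, m (ε * lineVar α v) * n v = 1) (f : H2) :
    Maps (inverseOp (fourierMul (ε * α) m)) (dilWeight α ε hε f)
      (dilWeight α ε hε (fmul n f)) := by
  rw [dilWeight_fmul hε hn, dilWeight_apply]
  refine maps_inverseOp_fourierMul (hn.comp_mul ε⁻¹) (fun v => ?_) _
  rw [lineVar_eq_mul hε, h]

theorem maps_mulBy_dilWeight {g θ : ℝ → ℝ} {k : ℝ} (hθ : IsBddSymbol fun x => (θ x : ℂ))
    (h : ∀ x, g (ε⁻¹ * x) = k * θ x) (f : H2) :
    Maps (mulBy (ε * α) g) (dilWeight α ε hε f)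
      ((k : ℂ) • dilWeight α ε hε (mulL2 (fun x => (θ x : ℂ)) f)) := by
  have e : (fun x => (g x : ℂ)) = fun x => (k : ℂ) * (θ (ε * x) : ℂ) := by
    funext x
    rw [← Complex.ofReal_mul, ← h, inv_mul_cancel_left₀ hε.ne']
  have hd := hθ.comp_mul ε
  refine (maps_mulBy (by rw [e]; exact (IsBddSymbol.const (k : ℂ)).mul hd) _).congr_right ?_
  rw [e, mulL2_const_mul _ hd, _root_.smul_apply, map_smul]
  exact congrArg (fun z => (k : ℂ) • (weight (ε * α)).symm z) (mulL2_dil hε.ne' hθ f)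

theorem maps_derivOp_dilWeight {n : ℝ → ℂ} (hn : IsBddSymbol n)
    (hdn : IsBddSymbol fun v => derivSym α v * n v) (f : H2) :
    Maps (derivOp (ε * α)) (dilWeight α ε hε (fmul n f))
      ((ε : ℂ) • dilWeight α ε hε (fmul (fun v => derivSym α v * n v) f)) := by
  refine maps_fourierMul_dilWeight hε hn hdn (fun v => ?_) f
  rw [derivSym]
  ring

end Rules

/-- `θ' N + 2 θ ∂N` with `N` the multiplier with symbol `n`. -/
def blockQ (α : ℝ) (θ θ' n : ℝ → ℂ) : H2 →L[ℂ] H2 :=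
  mulL2 θ' * fmul n + (2 : ℂ) • (mulL2 θ * fmul fun v => derivSym α v * n v)

/-- `θ ∂N + 2 θ' N` with `N` the multiplier with symbol `n`. -/
def blockR (α : ℝ) (θ θ' n : ℝ → ℂ) : H2 →L[ℂ] H2 :=
  (mulL2 θ * fmul fun v => derivSym α v * n v) + (2 : ℂ) • (mulL2 θ' * fmul n)

theorem norm_damped_blockQ_sub_le {α ε K M τ C : ℝ} {B θ θ' θ₀ θ₀' θ₀'' n n₀ : ℝ → ℂ}
    (hα : 0 < α) (hε : 0 < ε) (hε1 : ε ≤ 1) (hK : 0 ≤ K) (hC : 0 ≤ C) (hB : IsDamping α ε K B)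
    (hθ : AreClose M τ θ θ' θ₀ θ₀' θ₀'') (hn : AreCloseSymbols α ε C n n₀) :
    ‖fmul B * blockQ α θ θ' n - blockQ α θ₀ θ₀' n₀‖ ≤
      25 * (K * (1 + M) * C * (1 + α⁻¹) ^ 2) * (√ε + τ) := by
  have h1 := norm_damped_sub_le hα hε hε1 hK hC hB hθ.norm_sub_le' hθ.mult₀' hθ.norm₀'_le
    hθ.norm₀''_le hn
  have h2 := norm_damped_deriv_sub_le hα hε hε1 hK hC hB hθ hn
  have e : fmul B * blockQ α θ θ' n - blockQ α θ₀ θ₀' n₀ =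
      (fmul B * (mulL2 θ' * fmul n) - mulL2 θ₀' * fmul n₀) +
      (2 : ℂ) • (fmul B * (mulL2 θ * fmul fun v => derivSym α v * n v) -
        mulL2 θ₀ * fmul fun v => derivSym α v * n₀ v) := by
    rw [blockQ, blockQ, mul_add, mul_smul_comm, smul_sub]
    abel
  rw [e]
  refine (norm_add_le _ _).trans ?_
  rw [norm_smul, Complex.norm_ofNat]
  linarith

theorem norm_damped_blockR_sub_le {α ε K M τ C : ℝ} {B θ θ' θ₀ θ₀' θ₀'' n n₀ : ℝ → ℂ}
    (hα : 0 < α) (hε : 0 < ε) (hε1 : ε ≤ 1) (hK : 0 ≤ K) (hC : 0 ≤ C) (hB : IsDamping α ε K B)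
    (hθ : AreClose M τ θ θ' θ₀ θ₀' θ₀'') (hn : AreCloseSymbols α ε C n n₀) :
    ‖fmul B * blockR α θ θ' n - blockR α θ₀ θ₀' n₀‖ ≤
      23 * (K * (1 + M) * C * (1 + α⁻¹) ^ 2) * (√ε + τ) := by
  have h1 := norm_damped_sub_le hα hε hε1 hK hC hB hθ.norm_sub_le' hθ.mult₀' hθ.norm₀'_le
    hθ.norm₀''_le hn
  have h2 := norm_damped_deriv_sub_le hα hε hε1 hK hC hB hθ hn
  have e : fmul B * blockR α θ θ' n - blockR α θ₀ θ₀' n₀ =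
      (fmul B * (mulL2 θ * fmul fun v => derivSym α v * n v) -
        mulL2 θ₀ * fmul fun v => derivSym α v * n₀ v) +
      (2 : ℂ) • (fmul B * (mulL2 θ' * fmul n) - mulL2 θ₀' * fmul n₀) := by
    rw [blockR, blockR, mul_add, mul_smul_comm, smul_sub]
    abel
  rw [e]
  refine (norm_add_le _ _).trans ?_
  rw [norm_smul, Complex.norm_ofNat]
  linarith

theorem fmul_zero : fmul (fun _ => 0) = 0 :=
  norm_le_zero_iff.1 (norm_fmul_le fun _ => norm_zero.le)

theorem blockQ_zero (α : ℝ) (θ θ' : ℝ → ℂ) : blockQ α θ θ' (fun _ => 0) = 0 := by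
  simp [blockQ, fmul_zero]

theorem blockR_zero (α : ℝ) (θ θ' : ℝ → ℂ) : blockR α θ θ' (fun _ => 0) = 0 := by
  simp [blockR, fmul_zero]

/-- The pointwise relations between the solitary wave `q` of speed `1 + ε²/2` and its rescaling
`θ`. -/
structure IsRescaling (a b ε : ℝ) (θ θ' : ℝ → ℝ) : Prop where
  eq : ∀ x, qWave a b (1 + ε ^ 2 / 2) (ε⁻¹ * x) = ε ^ 2 * θ x
  deriv_eq : ∀ x, deriv (qWave a b (1 + ε ^ 2 / 2)) (ε⁻¹ * x) = ε ^ 3 * θ' x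
  bdd : IsBddSymbol fun x => (θ x : ℂ)
  bdd_deriv : IsBddSymbol fun x => (θ' x : ℂ)

section Bundle

variable {a b α β ε : ℝ} {θ θ' : ℝ → ℝ} {Lam : ℂ}

theorem maps_Binv_dilWeight (h : SmallParam a b α β ε) (f : H2) :
    Maps (Binv b (ε * α)) (dilWeight α ε h.ε_pos f)
      (dilWeight α ε h.ε_pos (fmul (dampSym b α ε) f)) :=
  maps_inverseOp_dilWeight (m := fun ξ => 1 + b * ξ ^ 2) h.ε_pos h.isDamping.isBddSymbol
    (fun v => by rw [dampSym, mul_inv_cancel₀ (h.strip v).den_ne_zero]) f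

theorem maps_Sinv_dilWeight (h : SmallParam a b α β ε) {n : ℝ → ℂ} (hn : IsBddSymbol n) (f : H2) :
    Maps (Sinv a b (ε * α)) (dilWeight α ε h.ε_pos (fmul n f))
      (((1 + ε ^ 2 / 2 : ℝ) : ℂ)⁻¹ •
        dilWeight α ε h.ε_pos (fmul (fun v => speedSym a b α ε v * n v) f)) := by
  have hs := h.isBddSymbol_speedSym
  have hc : ((1 + ε ^ 2 / 2 : ℝ) : ℂ) ≠ 0 := Complex.ofReal_ne_zero.2 (by positivity)
  refine (maps_inverseOp_dilWeight h.ε_pos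
    (n := fun v => ((1 + ε ^ 2 / 2 : ℝ) : ℂ)⁻¹ * speedSym a b α ε v)
    ((IsBddSymbol.const _).mul hs) (fun v => ?_) _).congr_right ?_
  · rw [speedSym, inv_mul_cancel_left₀ hc, mul_inv_cancel₀ (h.strip v).symS_ne_zero]
  · rw [fmul_const_mul _ hs, fmul_mul hs hn, _root_.smul_apply, map_smul]
    rfl

/-- Both terms carry `ε³`: `q'` scales like `ε³`, while `q` gives `ε²` and `∂` gives `ε`. The factor
`1/2` is that of `R_q`. -/
theorem maps_Rq_dilWeight (h : SmallParam a b α β ε) (hθ : IsRescaling a b ε θ θ') {n : ℝ → ℂ}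
    (hn : IsBddSymbol n) (hdn : IsBddSymbol fun v => derivSym α v * n v) (f : H2) :
    Maps (Rq a b (1 + ε ^ 2 / 2) (ε * α)) (dilWeight α ε h.ε_pos (fmul n f))
      (((ε : ℂ) ^ 3 / 2) • dilWeight α ε h.ε_pos
        ((fmul (dampSym b α ε) * blockQ α (fun x => θ x) (fun x => θ' x) n) f)) := by
  have h1 := maps_mulBy_dilWeight (α := α) h.ε_pos hθ.bdd_deriv hθ.deriv_eq (fmul n f)
  have h2 := (maps_mulBy_dilWeight (α := α) h.ε_pos hθ.bdd hθ.eq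
    (fmul (fun v => derivSym α v * n v) f)).const_smul (ε : ℂ)
  have h3 := h1.add ((h2.prodOp (maps_derivOp_dilWeight h.ε_pos hn hdn f)).smul (2 : ℂ))
  simp only [← map_smul, ← map_add] at h3
  refine (((maps_Binv_dilWeight h _).prodOp h3).smul (1 / 2 : ℂ)).congr_right ?_
  rw [← map_smul, ← map_smul]
  simp only [blockQ, _root_.mul_apply_eq_comp, _root_.add_apply, _root_.smul_apply, map_add,
    map_smul, Complex.ofReal_pow]
  module

/-- The factor `-c` of `r` cancels against the `c⁻¹` split off from `S⁻¹`, which is why `speedSym`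
contains `c`; only the sign remains. -/
theorem maps_Rr_dilWeight (h : SmallParam a b α β ε) (hθ : IsRescaling a b ε θ θ') {n : ℝ → ℂ}
    (hn : IsBddSymbol n) (hdn : IsBddSymbol fun v => derivSym α v * n v) (f : H2) :
    Maps (Rr a b (1 + ε ^ 2 / 2) (ε * α)) (dilWeight α ε h.ε_pos (fmul n f))
      ((-(ε : ℂ) ^ 3 / 2) • dilWeight α ε h.ε_pos ((fmul (dampSym b α ε) *
        blockR α (fun x => θ x) (fun x => θ' x) fun v => speedSym a b α ε v * n v) f)) := by
  have hc : ((1 + ε ^ 2 / 2 : ℝ) : ℂ) ≠ 0 := Complex.ofReal_ne_zero.2 (by positivity)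
  have hsn := h.isBddSymbol_speedSym.mul hn
  have hdsn : IsBddSymbol fun v => derivSym α v * (speedSym a b α ε v * n v) := by
    have e : (fun v => derivSym α v * (speedSym a b α ε v * n v)) =
        fun v => speedSym a b α ε v * (derivSym α v * n v) := funext fun v => mul_left_comm _ _ _
    rw [e]
    exact h.isBddSymbol_speedSym.mul hdn
  have hr : ∀ x, rWave a b (1 + ε ^ 2 / 2) (ε⁻¹ * x) = -(1 + ε ^ 2 / 2) * ε ^ 2 * θ x :=
    fun x => by rw [rWave, hθ.eq, mul_assoc]
  have hr' : ∀ x, deriv (rWave a b (1 + ε ^ 2 / 2)) (ε⁻¹ * x) =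
      -(1 + ε ^ 2 / 2) * ε ^ 3 * θ' x := fun x => by
    have e : rWave a b (1 + ε ^ 2 / 2) =
      fun y => -(1 + ε ^ 2 / 2) * qWave a b (1 + ε ^ 2 / 2) y := rfl
    rw [e, deriv_const_mul_field, hθ.deriv_eq, mul_assoc]
  have h1 := (maps_mulBy_dilWeight (α := α) h.ε_pos hθ.bdd_deriv hr'
    (fmul (fun v => speedSym a b α ε v * n v) f)).smul (2 : ℂ)
  have h2 := ((maps_mulBy_dilWeight (α := α) h.ε_pos hθ.bdd hr
    (fmul (fun v => derivSym α v * (speedSym a b α ε v * n v)) f)).const_smul (ε : ℂ)).prodOp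
      (maps_derivOp_dilWeight h.ε_pos hsn hdsn f)
  have h3 := ((h2.add h1).const_smul ((1 + ε ^ 2 / 2 : ℝ) : ℂ)⁻¹).prodOp
    (maps_Sinv_dilWeight h hn f)
  simp only [← map_smul, ← map_add] at h3
  refine (((maps_Binv_dilWeight h _).prodOp h3).smul (1 / 2 : ℂ)).congr_right ?_
  rw [← map_smul, ← map_smul]
  obtain ⟨k, hk⟩ : ∃ k : ℂ, k = ((1 + ε ^ 2 / 2 : ℝ) : ℂ) := ⟨_, rfl⟩
  simp only [blockR, _root_.mul_apply_eq_comp, _root_.add_apply, _root_.smul_apply, map_add,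
    map_smul, Complex.ofReal_mul, Complex.ofReal_neg, Complex.ofReal_pow, ← hk, smul_add,
    smul_smul] at hc ⊢
  congr 2 <;> field_simp

end Bundle

/-! ## The bundles as bounded operators -/

/-- The operator on `L²(ℝ)` that corresponds to the bundle `W_ε(Λ)`, for the rescaled profile
`θ`. -/
def bundleOp (a b α ε : ℝ) (θ θ' : ℝ → ℂ) (Lam : ℂ) : H2 →L[ℂ] H2 :=
  1 + (fmul (dampSym b α ε) * blockQ α θ θ' (resPlus a b α ε Lam) -
      fmul (dampSym b α ε) *
        blockR α θ θ' fun v => speedSym a b α ε v * resPlus a b α ε Lam v) +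
    (fmul (dampSym b α ε) * blockQ α θ θ' (resMinus a b α ε Lam) +
      fmul (dampSym b α ε) *
        blockR α θ θ' fun v => speedSym a b α ε v * resMinus a b α ε Lam v)

/-- The operator on `L²(ℝ)` that corresponds to the KdV bundle `W₀(Λ)`. -/
def bundleOpKdV (a b α : ℝ) (θ θ' : ℝ → ℂ) (Lam : ℂ) : H2 →L[ℂ] H2 :=
  1 + (3 : ℂ) • (mulL2 θ' * fmul (resKdVSym a b α Lam) +
    mulL2 θ * fmul fun v => derivSym α v * resKdVSym a b α Lam v)

section Bundle

open SmallParam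

variable {a b α β ε : ℝ} {θ θ' : ℝ → ℝ} {Lam : ℂ}

theorem AreCloseSymbols.isBddSymbol {C : ℝ} {n n₀ : ℝ → ℂ} (hn : AreCloseSymbols α ε C n n₀)
    (hα : 0 < α) (hε : 0 < ε) (hε1 : ε ≤ 1) (hC : 0 ≤ C) : IsBddSymbol n :=
  ⟨hn.meas, _, hn.norm_le_const hα hε hε1 hC⟩

theorem closeConst_nonneg (h : SmallParam a b α β ε) : 0 ≤
    (coerc a b α β)⁻¹ + 10 * b * (b - a) / min (1 / 2) b * (coerc a b α β)⁻¹ ^ 2 := by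
  have := h.coerc_pos
  have hb := h.b_pos
  have := sub_pos.2 h.lt
  have : 0 < min (1 / 2) b := lt_min (by norm_num) hb
  positivity

theorem isBddSymbol_resMinus (h : SmallParam a b α β ε) (hL : -β / 2 ≤ Lam.re) :
    IsBddSymbol (resMinus a b α ε Lam) :=
  (h.areClose_resMinus hL).isBddSymbol h.α_pos h.ε_pos h.ε_le (closeConst_nonneg h)

theorem isBddSymbol_resPlus (h : SmallParam a b α β ε) (hL : -β / 2 ≤ Lam.re) :
    IsBddSymbol (resPlus a b α ε Lam) := by
  have := h.α_pos
  exact (h.areClose_resPlus hL).isBddSymbol h.α_pos h.ε_pos h.ε_le (by positivity)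

theorem denMinus_ne_zero (h : SmallParam a b α β ε) (hL : -β / 2 ≤ Lam.re) (v : ℝ) :
    denMinus a b ε Lam (lineVar α v) ≠ 0 :=
  norm_pos_iff.1 ((div_pos h.β_pos four_pos).trans_le (h.le_norm_denMinus (lineVar_im α v) hL))

theorem denPlus_ne_zero (h : SmallParam a b α β ε) (hL : -β / 2 ≤ Lam.re) (v : ℝ) :
    denPlus a b ε Lam (lineVar α v) ≠ 0 := by
  have := h.α_pos
  have := h.ε_pos
  exact norm_pos_iff.1 (lt_of_lt_of_le (by positivity) (h.le_norm_denPlus (lineVar_im α v) hL))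

theorem maps_resQplus_dilWeight (h : SmallParam a b α β ε) (hL : -β / 2 ≤ Lam.re) (f : H2) :
    Maps (resQplus a b (1 + ε ^ 2 / 2) (ε * α) ((ε : ℂ) ^ 3 / 2 * Lam))
      (dilWeight α ε h.ε_pos f)
      ((2 / (ε : ℂ) ^ 3) • dilWeight α ε h.ε_pos (fmul (resPlus a b α ε Lam) f)) := by
  have hr := isBddSymbol_resPlus h hL
  have hε : (ε : ℂ) ≠ 0 := Complex.ofReal_ne_zero.2 h.ε_pos.ne'
  refine (maps_inverseOp_dilWeight
    (m := fun ξ => (ε : ℂ) ^ 3 / 2 * Lam - symQplus a b (1 + ε ^ 2 / 2) ξ) h.ε_pos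
    (n := fun v => 2 / (ε : ℂ) ^ 3 * resPlus a b α ε Lam v)
    ((IsBddSymbol.const _).mul hr) (fun v => ?_) _).congr_right ?_
  · have hd := denPlus_ne_zero h hL v
    have e : (ε : ℂ) ^ 3 / 2 * Lam - symQplus a b (1 + ε ^ 2 / 2) (ε * lineVar α v) =
        (ε : ℂ) ^ 3 / 2 * denPlus a b ε Lam (lineVar α v) := by
      rw [denPlus]
      field_simp
    rw [e, resPlus]
    field_simp
  · rw [fmul_const_mul _ hr, _root_.smul_apply, map_smul]

theorem maps_resQminus_dilWeight (h : SmallParam a b α β ε) (hL : -β / 2 ≤ Lam.re) (f : H2) :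
    Maps (resQminus a b (1 + ε ^ 2 / 2) (ε * α) ((ε : ℂ) ^ 3 / 2 * Lam))
      (dilWeight α ε h.ε_pos f)
      ((2 / (ε : ℂ) ^ 3) • dilWeight α ε h.ε_pos (fmul (resMinus a b α ε Lam) f)) := by
  have hr := isBddSymbol_resMinus h hL
  have hε : (ε : ℂ) ≠ 0 := Complex.ofReal_ne_zero.2 h.ε_pos.ne'
  refine (maps_inverseOp_dilWeight
    (m := fun ξ => (ε : ℂ) ^ 3 / 2 * Lam - symQminus a b (1 + ε ^ 2 / 2) ξ) h.ε_pos
    (n := fun v => 2 / (ε : ℂ) ^ 3 * resMinus a b α ε Lam v)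
    ((IsBddSymbol.const _).mul hr) (fun v => ?_) _).congr_right ?_
  · have hd := denMinus_ne_zero h hL v
    have e : (ε : ℂ) ^ 3 / 2 * Lam - symQminus a b (1 + ε ^ 2 / 2) (ε * lineVar α v) =
        (ε : ℂ) ^ 3 / 2 * denMinus a b ε Lam (lineVar α v) := by
      rw [denMinus]
      field_simp
    rw [e, resMinus]
    field_simp
  · rw [fmul_const_mul _ hr, _root_.smul_apply, map_smul]

/-- The resolvents contribute `2/ε³`, which cancels `ε³/2` from `R_q` and `-ε³/2` from `R_r` up to
sign. The sign of `R_r` interchanges sum and difference relative to `bundleW`. -/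
theorem maps_bundleW_dilWeight (h : SmallParam a b α β ε) (hθ : IsRescaling a b ε θ θ')
    (hL : -β / 2 ≤ Lam.re) (f : H2) :
    Maps (bundleW a b (1 + ε ^ 2 / 2) (ε * α) ((ε : ℂ) ^ 3 / 2 * Lam)) (dilWeight α ε h.ε_pos f)
      (dilWeight α ε h.ε_pos (bundleOp a b α ε (fun x => θ x) (fun x => θ' x) Lam f)) := by
  have hε : (ε : ℂ) ≠ 0 := Complex.ofReal_ne_zero.2 h.ε_pos.ne'
  have hp := isBddSymbol_resPlus h hL
  have hm := isBddSymbol_resMinus h hL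
  have hdp := (h.areClose_resPlus hL).bdd_deriv
  have hdm := (h.areClose_resMinus hL).bdd_deriv
  have h1 := (((maps_Rq_dilWeight h hθ hp hdp f).add
    (maps_Rr_dilWeight h hθ hp hdp f)).const_smul (2 / (ε : ℂ) ^ 3)).prodOp
      (maps_resQplus_dilWeight h hL f)
  have h2 := (((maps_Rq_dilWeight h hθ hm hdm f).sub
    (maps_Rr_dilWeight h hθ hm hdm f)).const_smul (2 / (ε : ℂ) ^ 3)).prodOp
      (maps_resQminus_dilWeight h hL f)
  refine (((Maps.idOp (dilWeight α ε h.ε_pos f)).add h1).add h2).congr_right ?_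
  have k1 : 2 / (ε : ℂ) ^ 3 * ((ε : ℂ) ^ 3 / 2) = 1 := by field_simp
  have k2 : 2 / (ε : ℂ) ^ 3 * (-(ε : ℂ) ^ 3 / 2) = -1 := by field_simp
  rw [smul_add, smul_sub, smul_smul, smul_smul, smul_smul, smul_smul, k1, k2, bundleOp,
    _root_.add_apply, _root_.add_apply, _root_.sub_apply, _root_.add_apply, map_add, map_add,
    map_sub, map_add, _root_.one_apply_eq_self]
  module

theorem maps_bundleWeps (h : SmallParam a b α β ε) (hθ : IsRescaling a b ε θ θ')
    (hL : -β / 2 ≤ Lam.re) (f : L2w α) : Maps (bundleWeps a b α ε h.ε_pos Lam) f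
      (weightConj α (bundleOp a b α ε (fun x => θ x) (fun x => θ' x) Lam) f) := by
  refine Maps.conjOp _ ?_
  rw [scaling_weight_symm, scaling_weight_symm, map_smul, map_smul, weightConj_apply,
    LinearEquiv.apply_symm_apply]
  exact (maps_bundleW_dilWeight h hθ hL _).const_smul _

theorem denKdV_ne_zero (h : SmallParam a b α β ε) (hL : -β / 2 ≤ Lam.re) (v : ℝ) :
    denKdV a b Lam (lineVar α v) ≠ 0 := by
  have := h.coerc_pos
  have := h.α_pos.trans_le (le_norm_lineVar α v)
  exact norm_pos_iff.1 (lt_of_lt_of_le (by positivity) (h.norm_denKdV_ge (lineVar_im α v) hL))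

theorem isBddSymbol_resKdVSym (h : SmallParam a b α β ε) (hL : -β / 2 ≤ Lam.re) :
    IsBddSymbol (resKdVSym a b α Lam) :=
  ⟨measurable_resKdVSym _ _ _ _, _,
    (h.areClose_resMinus hL).norm₀_le_const h.α_pos (closeConst_nonneg h)⟩

theorem isBddSymbol_deriv_resKdVSym (h : SmallParam a b α β ε) (hL : -β / 2 ≤ Lam.re) :
    IsBddSymbol fun v => derivSym α v * resKdVSym a b α Lam v :=
  ⟨(measurable_derivSym α).mul (measurable_resKdVSym _ _ _ _), _, fun v =>
    ((h.areClose_resMinus hL).norm_deriv₀_le h.α_pos v).trans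
      (div_le_mul_of_le h.α_pos (le_norm_lineVar α v) (closeConst_nonneg h)).1⟩

/-- The product rule writes `θ₀N₀` as `∂⁻¹` of a bounded operator. This puts its range in the domain
of the outer `∂` and evaluates the derivative at once. -/
theorem maps_bundleW0 (h : SmallParam a b α β ε)
    (hθ : IsMultiplier (fun x => (theta0 a b x : ℂ)) fun x => (θ' x : ℂ))
    (hL : -β / 2 ≤ Lam.re) (f : L2w α) : Maps (bundleW0 a b α Lam) f
      (weightConj α (bundleOpKdV a b α (fun x => theta0 a b x) (fun x => θ' x) Lam) f) := by
  have hn := isBddSymbol_resKdVSym h hL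
  have hdn := isBddSymbol_deriv_resKdVSym h hL
  obtain ⟨g, rfl⟩ := (weight α).symm.surjective f
  have h1 := maps_inverseOp_fourierMul (α := α)
    (m := fun ξ => Lam - Complex.I * ξ + ((b - a : ℝ) : ℂ) * (Complex.I * ξ) ^ 3) hn
    (fun v => mul_inv_cancel₀ (denKdV_ne_zero h hL v)) g
  have h2 := maps_mulBy hθ.bdd (α := α) (fmul (resKdVSym a b α Lam) g)
  have h3 := maps_fourierMul_fmul (α := α) (m := fun ξ => Complex.I * ξ)
    (isBddSymbol_derivSym_inv h.α_pos) (IsBddSymbol.const 1)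
    (fun v => (mul_inv_cancel₀ (derivSym_ne_zero h.α_pos v)).symm)
    ((mulL2 (fun x => (θ' x : ℂ)) * fmul (resKdVSym a b α Lam) +
      mulL2 (fun x => (theta0 a b x : ℂ)) *
        fmul fun v => derivSym α v * resKdVSym a b α Lam v) g)
  have e := congrArg (fun V : H2 →L[ℂ] H2 => V g) (mulL2_mul_fmul h.α_pos hθ hdn)
  simp only [_root_.mul_apply_eq_comp] at e
  rw [e] at h2
  refine ((Maps.idOp _).add (((h3.prodOp h2).smul 3).prodOp h1)).congr_right ?_
  rw [weightConj_apply, LinearEquiv.apply_symm_apply, bundleOpKdV, fmul_one,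
    _root_.one_apply_eq_self, ← map_smul, ← map_add]
  rfl

/-- The constant in the estimates of the symbols that enter the bundle. -/
def symbolConst (a b α β : ℝ) : ℝ :=
  ((coerc a b α β)⁻¹ + 10 * b * (b - a) / min (1 / 2) b * (coerc a b α β)⁻¹ ^ 2 +
    (α⁻¹ + α⁻¹ ^ 2)) * (1 + (2 + (α⁻¹ + α⁻¹ ^ 3) + (b - a) / min (1 / 2) b * α⁻¹) / √(a / b))

/-- Four blocks are compared with their limits, the two from `N₊` with zero. The constant is `96 =
2(25 + 23)` and depends on neither `ε` nor `Λ`. -/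
theorem norm_bundleOp_sub_le {M τ : ℝ} {θ θ' θ₀ θ₀' θ₀'' : ℝ → ℂ} (h : SmallParam a b α β ε)
    (hθ : AreClose M τ θ θ' θ₀ θ₀' θ₀'') (hL : -β / 2 ≤ Lam.re) :
    ‖bundleOp a b α ε θ θ' Lam - bundleOpKdV a b α θ₀ θ₀' Lam‖ ≤
      96 * ((2 + b + 1 / b) * (1 + M) * symbolConst a b α β * (1 + α⁻¹) ^ 2) * (√ε + τ) := by
  have hα := h.α_pos
  have hb := h.b_pos
  have hg := sub_pos.2 h.lt
  have hm : 0 < min (1 / 2) b := lt_min (by norm_num) hb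
  have hc1 := closeConst_nonneg h
  have hc2 : 0 ≤ α⁻¹ + α⁻¹ ^ 2 := by positivity
  have hD : 1 ≤ 1 + (2 + (α⁻¹ + α⁻¹ ^ 3) + (b - a) / min (1 / 2) b * α⁻¹) / √(a / b) :=
    le_add_of_nonneg_right (by positivity)
  have hK : 0 ≤ 2 + b + 1 / b := by positivity
  have hC : 0 ≤ symbolConst a b α β := mul_nonneg (add_nonneg hc1 hc2) (by linarith)
  have n1 := h.areClose_resMinus hL
  have n3 := h.areClose_resPlus hL
  have n2 := (h.areClose_speed_mul hc1 n1).mono (C' := symbolConst a b α β)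
    (mul_le_mul_of_nonneg_right (le_add_of_nonneg_right hc2) (by linarith))
  have n4 := (h.areClose_speed_mul hc2 n3).mono (C' := symbolConst a b α β)
    (mul_le_mul_of_nonneg_right (le_add_of_nonneg_left hc1) (by linarith))
  replace n1 := n1.mono (C' := symbolConst a b α β)
    ((le_add_of_nonneg_right hc2).trans (le_mul_of_one_le_right (add_nonneg hc1 hc2) hD))
  replace n3 := n3.mono (C' := symbolConst a b α β)
    ((le_add_of_nonneg_left hc1).trans (le_mul_of_one_le_right (add_nonneg hc1 hc2) hD))
  have m1 := norm_damped_blockQ_sub_le hα h.ε_pos h.ε_le hK hC h.isDamping hθ n1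
  have m2 := norm_damped_blockR_sub_le hα h.ε_pos h.ε_le hK hC h.isDamping hθ n2
  have m3 := norm_damped_blockQ_sub_le hα h.ε_pos h.ε_le hK hC h.isDamping hθ n3
  have m4 := norm_damped_blockR_sub_le hα h.ε_pos h.ε_le hK hC h.isDamping hθ n4
  rw [blockQ_zero, sub_zero] at m3
  rw [blockR_zero, sub_zero] at m4
  -- The coefficients `1 + 2` and `2 + 1` of the two blocks combine to the `3` of the KdV bundle.
  have e0 : bundleOpKdV a b α θ₀ θ₀' Lam =
      1 + (blockQ α θ₀ θ₀' (resKdVSym a b α Lam) + blockR α θ₀ θ₀' (resKdVSym a b α Lam)) := by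
    rw [bundleOpKdV, blockQ, blockR]
    module
  have e : bundleOp a b α ε θ θ' Lam - bundleOpKdV a b α θ₀ θ₀' Lam =
      (fmul (dampSym b α ε) * blockQ α θ θ' (resPlus a b α ε Lam) -
        fmul (dampSym b α ε) *
          blockR α θ θ' fun v => speedSym a b α ε v * resPlus a b α ε Lam v) +
      ((fmul (dampSym b α ε) * blockQ α θ θ' (resMinus a b α ε Lam) -
          blockQ α θ₀ θ₀' (resKdVSym a b α Lam)) +
        (fmul (dampSym b α ε) *
          blockR α θ θ' (fun v => speedSym a b α ε v * resMinus a b α ε Lam v) -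
          blockR α θ₀ θ₀' (resKdVSym a b α Lam))) := by
    rw [e0, bundleOp]
    abel
  rw [e]
  refine (norm_add_le _ _).trans ((add_le_add (norm_sub_le _ _) (norm_add_le _ _)).trans ?_)
  linarith

end Bundle

/-! ## Scaling of the solitary wave -/

/-- The amplitude of the rescaled solitary wave. -/
def waveAmp (ε : ℝ) : ℝ := (1 + ε ^ 2 / 4) / (1 + ε ^ 2 / 2)

/-- The inverse width of the rescaled solitary wave. -/
def waveRate (a b ε : ℝ) : ℝ := 1 / 2 * √((1 + ε ^ 2 / 4) / (b * (1 + ε ^ 2 / 2) ^ 2 - a))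

/-- The inverse width of the KdV soliton. -/
def kdvRate (a b : ℝ) : ℝ := 1 / 2 * (1 / √(b - a))

theorem theta0_eq_profile (a b : ℝ) : theta0 a b = profile 1 (kdvRate a b) := by
  funext x
  rw [theta0, inv_cosh_sq_eq, profile, one_mul, kdvRate]

/-- From `c² - 1 = ε²(1 + ε²/4)` the amplitude acquires `ε²` and the inverse width `ε`; the latter
cancels `ε⁻¹` in the argument. -/
theorem qWave_inv_mul (a b : ℝ) {ε : ℝ} (hε : 0 < ε) (x : ℝ) :
    qWave a b (1 + ε ^ 2 / 2) (ε⁻¹ * x) = ε ^ 2 * profile (waveAmp ε) (waveRate a b ε) x := by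
  have h1 : (1 + ε ^ 2 / 2) ^ 2 - 1 = ε ^ 2 * (1 + ε ^ 2 / 4) := by ring
  have h2 : 1 / 2 * √(((1 + ε ^ 2 / 2) ^ 2 - 1) / (b * (1 + ε ^ 2 / 2) ^ 2 - a)) * (ε⁻¹ * x) =
      waveRate a b ε * x := by
    rw [h1, mul_div_assoc, Real.sqrt_mul (sq_nonneg ε), Real.sqrt_sq hε.le, waveRate]
    field_simp
  rw [qWave, h2, inv_cosh_sq_eq, h1, profile, waveAmp]
  ring

theorem isRescaling_profile (a b : ℝ) {ε : ℝ} (hε : 0 < ε) :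
    IsRescaling a b ε (profile (waveAmp ε) (waveRate a b ε))
      (profileDeriv (waveAmp ε) (waveRate a b ε)) := by
  obtain ⟨_, h, -⟩ := exists_isMultiplier_profile (waveAmp ε) (waveRate a b ε)
  refine ⟨qWave_inv_mul a b hε, fun x => ?_, h.bdd, h.bdd_deriv⟩
  have e : qWave a b (1 + ε ^ 2 / 2) =
      fun y => ε ^ 2 * profile (waveAmp ε) (waveRate a b ε) (ε * y) := by
    funext y
    rw [← qWave_inv_mul a b hε, inv_mul_cancel_left₀ hε.ne']
  have hd := ((hasDerivAt_profile (waveAmp ε) (waveRate a b ε) (ε * (ε⁻¹ * x))).comp (ε⁻¹ * x)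
    ((hasDerivAt_id (ε⁻¹ * x)).const_mul ε)).const_mul (ε ^ 2)
  rw [e]
  refine hd.deriv.trans ?_
  rw [mul_inv_cancel_left₀ hε.ne']
  ring

theorem tendsto_waveAmp : Tendsto waveAmp (𝓝[>] 0) (𝓝 1) := by
  have h : ContinuousAt waveAmp 0 := by
    unfold waveAmp
    fun_prop (disch := norm_num)
  have h1 := h.tendsto
  rw [show waveAmp 0 = 1 by norm_num [waveAmp]] at h1
  exact h1.mono_left nhdsWithin_le_nhds

theorem tendsto_waveRate {a b : ℝ} (hab : a < b) :
    Tendsto (waveRate a b) (𝓝[>] 0) (𝓝 (kdvRate a b)) := by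
  have hb : b * (1 + (0 : ℝ) ^ 2 / 2) ^ 2 - a ≠ 0 := by
    norm_num
    linarith
  have h : ContinuousAt (waveRate a b) 0 := by
    unfold waveRate
    fun_prop (disch := assumption)
  have h1 := h.tendsto
  rw [show waveRate a b 0 = kdvRate a b by
    rw [waveRate, kdvRate, ← Real.sqrt_one, ← Real.sqrt_div zero_le_one, Real.sqrt_one]
    norm_num] at h1
  exact h1.mono_left nhdsWithin_le_nhds

theorem eventually_smallParam {a b α β : ℝ} (ha : 0 < a) (hab : a < b)
    (hα : α ∈ Set.Ioo 0 (1 / √(b - a))) (hβ : β = α * (1 - (b - a) * α ^ 2)) :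
    ∀ᶠ ε : ℝ in 𝓝[>] 0, SmallParam a b α β ε := by
  have hg := sub_pos.2 hab
  have hα0 := hα.1
  have hs : (b - a) * α ^ 2 < 1 := by
    have h1 := (lt_div_iff₀ (Real.sqrt_pos.2 hg)).1 hα.2
    have h2 : (α * √(b - a)) ^ 2 < 1 := by
      rw [sq_lt_one_iff₀ (by positivity)]
      exact h1
    rwa [mul_pow, Real.sq_sqrt hg.le, mul_comm] at h2
  have hβ0 : 0 < β := by
    rw [hβ]
    exact mul_pos hα0 (by linarith)
  -- Each smallness condition holds strictly at `ε = 0`, hence near it by continuity.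
  have hlt : ∀ {f : ℝ → ℝ} {k : ℝ}, Continuous f → f 0 < k → ∀ᶠ ε : ℝ in 𝓝[>] 0, f ε ≤ k :=
    fun hf h0 => nhdsWithin_le_nhds
      ((hf.continuousAt.eventually_lt continuousAt_const h0).mono fun _ h => h.le)
  have hb0 := ha.trans hab
  filter_upwards [self_mem_nhdsWithin,
    hlt (f := fun ε => ε) (k := 1) (by fun_prop) zero_lt_one,
    hlt (f := fun ε => b * (ε * α) ^ 2) (k := 1 / 4) (by fun_prop) (by norm_num),
    hlt (f := fun ε => (b - a) * (ε * α) ^ 2) (k := √(a / b)) (by fun_prop)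
      (by
        rw [zero_mul, zero_pow two_ne_zero, mul_zero]
        positivity),
    hlt (f := fun ε => b * (ε * α) ^ 2 * ((b - a) * α ^ 3 + β / 4)) (k := β / 4) (by fun_prop)
      (by
        rw [zero_mul, zero_pow two_ne_zero, mul_zero, zero_mul]
        positivity)] with ε h1 h2 h3 h4 h5
  exact ⟨ha, hab, hα0, hs, hβ, h1, h2, h3, h4, h5⟩

theorem enorm_weightConj_sub_le {α C : ℝ} {V W : H2 →L[ℂ] H2} (h : ‖V - W‖ ≤ C) :
    ‖weightConj α V - weightConj α W‖ₑ ≤ ENNReal.ofReal C := by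
  rw [← weightConj_sub, ← ofReal_norm]
  exact ENNReal.ofReal_le_ofReal ((norm_weightConj_le _).trans h)

end

end BenneyLuke

/-! ### Conclusion: realization and uniform convergence -/

theorem theorem6p1 (a b : ℝ) (ha : 0 < a) (hab : a < b)
    (α : ℝ) (hα : α ∈ Set.Ioo 0 (1 / Real.sqrt (b - a)))
    (β : ℝ) (hβ : β = α * (1 - (b - a) * α ^ 2)) :
    ∃ (W₀ : ℂ → (L2w α →L[ℂ] L2w α)) (W : ℝ → ℂ → (L2w α →L[ℂ] L2w α)),
      (∀ Lam : ℂ, -β / 2 ≤ Lam.re → IsBoundedRealization (W₀ Lam) (bundleW0 a b α Lam)) ∧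
      (∃ ε₀ : ℝ, 0 < ε₀ ∧ ∀ (ε : ℝ) (hε : 0 < ε), ε < ε₀ → ∀ Lam : ℂ, -β / 2 ≤ Lam.re →
        IsBoundedRealization (W ε Lam) (bundleWeps a b α ε hε Lam)) ∧
      Tendsto (fun ε : ℝ => ⨆ (Lam : ℂ) (_ : -β / 2 ≤ Lam.re), ‖W ε Lam - W₀ Lam‖ₑ)
        (𝓝[>] 0) (𝓝 0) := by
  have hs₀ : 0 < kdvRate a b := by
    have := sub_pos.2 hab
    unfold kdvRate
    positivity
  have hsmall := eventually_smallParam ha hab hα hβ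
  have hamp := tendsto_waveAmp
  have hrate := tendsto_waveRate hab
  obtain ⟨M, p, hM⟩ := exists_areClose hs₀
  obtain ⟨_, hmult, -⟩ := exists_isMultiplier_profile 1 (kdvRate a b)
  refine ⟨fun Lam => weightConj α (bundleOpKdV a b α (fun x => profile 1 (kdvRate a b) x)
      (fun x => profileDeriv 1 (kdvRate a b) x) Lam),
    fun ε Lam => weightConj α (bundleOp a b α ε (fun x => profile (waveAmp ε) (waveRate a b ε) x)
      (fun x => profileDeriv (waveAmp ε) (waveRate a b ε) x) Lam), fun Lam hL => ?_, ?_, ?_⟩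
  -- `W₀` does not involve `ε`, but the KdV bounds are stated for admissible parameters; any small
  -- `ε` serves.
  · obtain ⟨ε, hε⟩ := hsmall.exists
    rw [← theta0_eq_profile] at hmult ⊢
    exact eq_toPMap_of_maps fun x => maps_bundleW0 hε hmult hL x
  · obtain ⟨ε₀, hε₀, hsub⟩ := mem_nhdsGT_iff_exists_Ioo_subset.1 hsmall
    refine ⟨ε₀, hε₀, fun ε hε hlt Lam hL => eq_toPMap_of_maps fun x => ?_⟩
    exact maps_bundleWeps (hsub ⟨hε, hlt⟩) (isRescaling_profile a b hε) hL x
  · have hbound : ∀ᶠ ε : ℝ in 𝓝[>] 0,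
        (⨆ (Lam : ℂ) (_ : -β / 2 ≤ Lam.re),
          ‖weightConj α (bundleOp a b α ε (fun x => profile (waveAmp ε) (waveRate a b ε) x)
            (fun x => profileDeriv (waveAmp ε) (waveRate a b ε) x) Lam) -
          weightConj α (bundleOpKdV a b α (fun x => profile 1 (kdvRate a b) x)
            (fun x => profileDeriv 1 (kdvRate a b) x) Lam)‖ₑ) ≤
        ENNReal.ofReal (96 * ((2 + b + 1 / b) * (1 + M) * symbolConst a b α β * (1 + α⁻¹) ^ 2) *
          (√ε + (|waveAmp ε - 1| + 4 / kdvRate a b * |waveRate a b ε - kdvRate a b| +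
            (2 * |waveAmp ε * waveRate a b ε - kdvRate a b| +
              8 * |waveRate a b ε - kdvRate a b|)))) := by
      have h1 : ∀ᶠ ε : ℝ in 𝓝[>] 0, |waveAmp ε| < 2 := hamp.abs.eventually_lt_const (by norm_num)
      filter_upwards [hsmall, h1, hrate.eventually_const_lt (half_lt_self hs₀),
        hrate.eventually_lt_const (show kdvRate a b < 2 * kdvRate a b by linarith)]
        with ε h h1 h2 h3
      -- The bound does not depend on `Λ`, so it passes to the supremum.
      exact iSup₂_le fun Lam hL => enorm_weightConj_sub_le
        (norm_bundleOp_sub_le h (hM _ _ h1.le h2.le h3.le) hL)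
    refine tendsto_of_tendsto_of_tendsto_of_le_of_le' tendsto_const_nhds ?_
      (Eventually.of_forall fun _ => zero_le) hbound
    have hsqrt : Tendsto (fun ε : ℝ => √ε) (𝓝[>] 0) (𝓝 0) := by
      have h := Real.continuous_sqrt.tendsto 0
      rw [Real.sqrt_zero] at h
      exact h.mono_left nhdsWithin_le_nhds
    have t1 := (hamp.sub_const 1).abs
    have t2 := (hrate.sub_const (kdvRate a b)).abs
    have t3 := ((hamp.mul hrate).sub_const (kdvRate a b)).abs
    have t := ENNReal.tendsto_ofReal ((hsqrt.add ((t1.add (t2.const_mul (4 / kdvRate a b))).add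
      ((t3.const_mul 2).add (t2.const_mul 8)))).const_mul
        (96 * ((2 + b + 1 / b) * (1 + M) * symbolConst a b α β * (1 + α⁻¹) ^ 2)))
    simpa using t
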